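/- **Setting.** Let $\mathcal K$ be a finite two-dimensional polygonal complex: vertices, edges (segments with two distinct endpoints, two distinct edges meeting in at most one vertex) and faces (simple polygons with at least three vertices, glued along edges; two distinct faces are disjoint, or meet in a single vertex, or in a single edge with its endpoints), whose underlying space is a surface, possibly with boundary. Place one qubit on each edge. The star of a vertex $s$ is the set of edges attached to $s$; the plaquette of a face $p$ is the set of its sides. For each vertex $s$ let $A_s$, and for each face $p$ let $B_p$, be a Hermitian operator that acts only on the qubits of its star, respectively plaquette, and let all these local terms commute pairwise. A term acts trivially on a qubit $q$ if it is $I_q\otimes h'$; $q$ is trivial if all terms act trivially on it, and classical if its space $\mathbb C^2$ is a direct sum of one-dimensional subspaces each of which is invariant under all terms. Assume that every classical qubit is trivial. A qubit is in the boundary if at most one plaquette term acts non-trivially on it, and in the coboundary if at most one star term does. A star or plaquette is in the interior of the system if none of its qubits is in the boundary or in the coboundary. A star and a plaquette are adjacent if they share two edges. A path from a star $s$ is a sequence of stars beginning with $s$ in which consecutive stars are distinct and share an edge; its edges $e_0,\dots,e_r$ ($r\ge 0$) are these shared edges, which are required to be pairwise distinct. A copath from a plaquette is defined in the same way with plaquettes;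 its last edge may also be an edge that has no second plaquette. The algebra induced by a term on a qubit $q$ is the C*-algebra, containing $I$, generated by the operators on $q$ in a Schmidt decomposition of the term between $q$ and the other qubits. **Statement.** There is a choice of an orthonormal basis for each qubit, with associated Pauli matrices $X_q,Z_q$, such that each star induces the algebra $\langle Z_q\rangle$ on each of its qubits not in the coboundary, each plaquette induces $\langle X_q\rangle$ on each of its qubits not in the boundary, and the following holds. Let $s,p$ be an adjacent star and plaquette, both in the interior of the system, and suppose that the connected component of $\mathcal K$ containing $s$ has at least one edge in the boundary or in the coboundary. Then at least one of the following holds: - there is a path $\gamma$ from $s$ whose last edge is in the coboundary, such that $L=\bigotimes_{q\in\gamma}X_q$ anticommutes with the traceless part $A_s-\frac{\operatorname{tr}A_s}{\dim}I$ of $A_s$ and commutes with all other local terms; - there is a copath $\gamma^*$ from $p$ whose last edge is in the boundary, such that $L^*=\bigotimes_{q\in\gamma^*}Z_q$ anticommutes with the traceless part $B_p-\frac{\operatorname{tr}B_p}{\dim}I$ of $B_p$ and commutes with all other local terms. -/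

import Mathlib

/-- A polygonal complex with vertices `V`, edges `E` and faces `F`: edges are segments with two
distinct endpoints, faces are simple polygons glued along edges. -/
structure PolygonalComplex (V E F : Type*) where
  /-- the two endpoints of an edge -/
  ends : E → Sym2 V
  ends_ne : ∀ e, ¬ (ends e).IsDiag
  /-- two distinct edges meet in at most one vertex -/
  ends_inj : Function.Injective ends
  /-- the sides of a face -/
  bd : F → Set E
  /-- the sides of a face form a simple closed polygon with at least three vertices -/
  bd_polygon : ∀ f, ∃ n : ℕ, 3 ≤ n ∧ ∃ (v : ZMod n → V) (e : ZMod n → E),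
    Function.Injective v ∧ (∀ i, ends (e i) = s(v i, v (i + 1))) ∧ bd f = Set.range e
  /-- two distinct faces are disjoint, or meet in a single vertex, or in a single edge together
  with its endpoints -/
  face_inter : ∀ f g, f ≠ g →
    {v | (∃ e ∈ bd f, v ∈ ends e) ∧ (∃ e ∈ bd g, v ∈ ends e)}.Subsingleton ∨
    ∃ e, e ∈ bd f ∧ e ∈ bd g ∧
      {v | (∃ e ∈ bd f, v ∈ ends e) ∧ (∃ e ∈ bd g, v ∈ ends e)} = {v | v ∈ ends e}

namespace PolygonalComplex

variable {V E F : Type*} (K : PolygonalComplex V E F)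

/-- The link of a vertex `v`: its nodes are the edges at `v`, two of them being joined when they
are sides of a common face. -/
def link (v : V) : SimpleGraph {e : E // v ∈ K.ends e} where
  Adj e e' := e ≠ e' ∧ ∃ f, e.1 ∈ K.bd f ∧ e'.1 ∈ K.bd f
  symm := ⟨fun _ _ h => ⟨h.1.symm, h.2.imp fun _ h' => ⟨h'.2, h'.1⟩⟩⟩
  loopless := ⟨fun _ h => h.1 rfl⟩

/-- The complex is two dimensional, i.e. its underlying space is a surface, possibly with
boundary: every edge is a side of one or two faces, and the link of every vertex is connected.
(Together these say that the link of each vertex is an arc or a circle.) -/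
def IsSurface : Prop :=
  (∀ e, 1 ≤ {f | e ∈ K.bd f}.encard ∧ {f | e ∈ K.bd f}.encard ≤ 2) ∧
  ∀ v, (K.link v).Connected

/-- The graph formed by vertices and edges. -/
def skeleton : SimpleGraph V where
  Adj a b := a ≠ b ∧ ∃ e, K.ends e = s(a, b)
  symm := ⟨fun _ _ h => ⟨h.1.symm, h.2.imp fun _ h' => h'.trans Sym2.eq_swap⟩⟩
  loopless := ⟨fun _ h => h.1 rfl⟩

/-- The edges of a star (edges attached to a vertex) or of a plaquette (sides of a face). -/
def edgesOf : V ⊕ F → Set E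
  | .inl v => {e | v ∈ K.ends e}
  | .inr f => K.bd f

/-- A star and a plaquette are adjacent if they share two edges. -/
def Adjacent (s : V) (p : F) : Prop :=
  ∃ e e', e ≠ e' ∧ e ∈ K.edgesOf (.inl s) ∧ e ∈ K.edgesOf (.inr p) ∧
    e' ∈ K.edgesOf (.inl s) ∧ e' ∈ K.edgesOf (.inr p)

/-- `c 0, …, c r` is a sequence of stars, starting at `s`, such that `c i` and `c (i + 1)` are
distinct and share the edge `e i`; the last edge `e r` leaves the last star `c r`. The edges are
pairwise distinct. (The star at the other end of the last edge is not listed.) -/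
def IsPath (s : V) {r : ℕ} (c : Fin (r + 1) → V) (e : Fin (r + 1) → E) : Prop :=
  c 0 = s ∧ (∀ i, e i ∈ K.edgesOf (.inl (c i))) ∧
  (∀ i : Fin r, c i.castSucc ≠ c i.succ ∧ e i.castSucc ∈ K.edgesOf (.inl (c i.succ))) ∧
  Function.Injective e

/-- The same for plaquettes. (The plaquette on the other side of the last edge is not listed; it
does not exist when that edge lies on the topological boundary of the surface.) -/
def IsCopath (p : F) {r : ℕ} (c : Fin (r + 1) → F) (e : Fin (r + 1) → E) : Prop :=
  c 0 = p ∧ (∀ i, e i ∈ K.edgesOf (.inr (c i))) ∧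
  (∀ i : Fin r, c i.castSucc ≠ c i.succ ∧ e i.castSucc ∈ K.edgesOf (.inr (c i.succ))) ∧
  Function.Injective e

end PolygonalComplex

/-- Operators on the Hilbert space `(ℂ²)^{⊗ E}` of qubits placed on the elements of `E`, as
matrices in the computational basis. -/
abbrev QOp (E : Type*) := Matrix (E → Fin 2) (E → Fin 2) ℂ

section Operators

variable {E : Type*}

/-- `h` acts trivially on the qubit `q`: `h = I ⊗ h'` with `I` the identity on `q` and `h'` an
operator on the other qubits. -/
def ActsTrivially (h : QOp E) (q : E) : Prop :=
  ∃ h' : QOp {e : E // e ≠ q}, ∀ x y : E → Fin 2,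
    h x y = (1 : Matrix (Fin 2) (Fin 2) ℂ) (x q) (y q) * h' (fun e => x e) (fun e => y e)

/-- The tensor product of single-qubit operators. -/
noncomputable def tensorOp [Fintype E] (M : E → Matrix (Fin 2) (Fin 2) ℂ) : QOp E :=
  Matrix.of fun x y => ∏ e, M e (x e) (y e)

/-- The subspace `L ⊗ (space of the other qubits)`, where `L` is a subspace of the space of the
qubit `q`. -/
def qubitSubspace [DecidableEq E] (q : E) (L : Submodule ℂ (Fin 2 → ℂ)) :
    Submodule ℂ ((E → Fin 2) → ℂ) where
  carrier := {ψ | ∀ x : E → Fin 2, (fun i => ψ (Function.update x q i)) ∈ L}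
  add_mem' := fun ha hb x => L.add_mem (ha x) (hb x)
  zero_mem' := fun _ => L.zero_mem
  smul_mem' := fun c _ ha x => L.smul_mem c (ha x)

/-- The algebra induced by `h` on the qubit `q`: write `h = ∑ h_{x y} ⊗ |x⟩⟨y|`, with `x`, `y`
running over the computational basis states of the other qubits, and take the C⋆-algebra
(containing the identity) generated by the `h_{x y}`. (The result is the same for every
decomposition of `h` whose second factors are linearly independent, such as a Schmidt
decomposition.) -/
noncomputable def inducedAlgebra [DecidableEq E] (h : QOp E) (q : E) :
    StarSubalgebra ℂ (Matrix (Fin 2) (Fin 2) ℂ) :=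
  StarAlgebra.adjoin ℂ {m | ∃ x y : E → Fin 2,
    m = Matrix.of fun i j => h (Function.update x q i) (Function.update y q j)}

/-- The Pauli matrices. -/
def pauliX : Matrix (Fin 2) (Fin 2) ℂ := !![0, 1; 1, 0]

def pauliZ : Matrix (Fin 2) (Fin 2) ℂ := !![1, 0; 0, -1]

/-- The operator on one qubit whose matrix in the orthonormal basis formed by the columns of `u`
is `m`. -/
def inBasis (u : Matrix.unitaryGroup (Fin 2) ℂ) (m : Matrix (Fin 2) (Fin 2) ℂ) :
    Matrix (Fin 2) (Fin 2) ℂ :=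
  (u : Matrix (Fin 2) (Fin 2) ℂ) * m * star (u : Matrix (Fin 2) (Fin 2) ℂ)

/-- The string operator `⨂_{q ∈ S} m_q` (identity on the other qubits), where `m_q` has matrix `m`
in the basis `U q`. -/
noncomputable def stringOp [Fintype E] [DecidableEq E] (U : E → Matrix.unitaryGroup (Fin 2) ℂ)
    (m : Matrix (Fin 2) (Fin 2) ℂ) (S : Finset E) : QOp E :=
  tensorOp fun q => if q ∈ S then inBasis (U q) m else 1

/-- The traceless part `h - (tr h / dim) I` of an operator. -/
noncomputable def tracelessPart [Fintype E] [DecidableEq E] (h : QOp E) : QOp E :=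
  h - (h.trace / (Fintype.card (E → Fin 2) : ℂ)) • (1 : QOp E)

end Operators

/-- A commuting local Hamiltonian with qubits on the edges of `K` and one local term for each
vertex (star) and each face (plaquette). -/
structure CLHInstance {V E F : Type*} [Fintype E] [DecidableEq E]
    (K : PolygonalComplex V E F) where
  term : V ⊕ F → QOp E
  hermitian : ∀ t, (term t).IsHermitian
  /-- a term acts only on the edges of its star or plaquette -/
  isLocal : ∀ t, ∀ q, q ∉ K.edgesOf t → ActsTrivially (term t) q
  commuting : ∀ t t', Commute (term t) (term t')

namespace CLHInstance

variable {V E F : Type*} [Fintype E] [DecidableEq E] {K : PolygonalComplex V E F}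
  (H : CLHInstance K)

/-- No local term acts non-trivially on `q`. -/
def IsTrivial (q : E) : Prop := ∀ t, ActsTrivially (H.term t) q

/-- The space of `q` is a direct sum of one-dimensional subspaces, each invariant under all local
terms. -/
def IsClassical (q : E) : Prop :=
  ∃ L : Fin 2 → Submodule ℂ (Fin 2 → ℂ), IsCompl (L 0) (L 1) ∧
    ∀ i, Module.finrank ℂ (L i) = 1 ∧
      ∀ t, ∀ ψ ∈ qubitSubspace q (L i), (H.term t).mulVec ψ ∈ qubitSubspace q (L i)

/-- At most one plaquette acts non-trivially on `q`. -/
def IsBoundary (q : E) : Prop := {p : F | ¬ ActsTrivially (H.term (.inr p)) q}.Subsingleton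

/-- At most one star acts non-trivially on `q`. -/
def IsCoboundary (q : E) : Prop := {s : V | ¬ ActsTrivially (H.term (.inl s)) q}.Subsingleton

/-- A term is in the interior of the system if all qubits of its star or plaquette are neither in
the boundary nor in the coboundary. -/
def IsInterior (t : V ⊕ F) : Prop :=
  ∀ q ∈ K.edgesOf t, ¬ H.IsBoundary q ∧ ¬ H.IsCoboundary q

/-- A choice of orthonormal bases of the qubits in which the terms look as in the toric code:
stars induce `⟨Z⟩` on each of their qubits not in the coboundary, plaquettes induce `⟨X⟩` on each
of their qubits not in the boundary. -/
def IsToricBasis (U : E → Matrix.unitaryGroup (Fin 2) ℂ) : Prop :=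
  (∀ s : V, ∀ q ∈ K.edgesOf (.inl s), ¬ H.IsCoboundary q →
    inducedAlgebra (H.term (.inl s)) q = StarAlgebra.adjoin ℂ {inBasis (U q) pauliZ}) ∧
  (∀ p : F, ∀ q ∈ K.edgesOf (.inr p), ¬ H.IsBoundary q →
    inducedAlgebra (H.term (.inr p)) q = StarAlgebra.adjoin ℂ {inBasis (U q) pauliX})

/-- `L` anticommutes with the term `t`, up to the addition of a multiple of the identity to that
term, and commutes with all other terms. -/
def Flips (L : QOp E) (t : V ⊕ F) : Prop :=
  L * tracelessPart (H.term t) = - (tracelessPart (H.term t) * L) ∧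
  ∀ t', t' ≠ t → Commute L (H.term t')

/-- The star `s` has access to the coboundary: some path from `s` ends at a coboundary edge and
has an `X`-string that flips `A_s` only. -/
def AccessToCoboundary (U : E → Matrix.unitaryGroup (Fin 2) ℂ) (s : V) : Prop :=
  ∃ (r : ℕ) (c : Fin (r + 1) → V) (e : Fin (r + 1) → E),
    K.IsPath s c e ∧ H.IsCoboundary (e (Fin.last r)) ∧
    H.Flips (stringOp U pauliX (Finset.univ.image e)) (.inl s)

/-- The plaquette `p` has access to the boundary: some copath from `p` ends at a boundary edge and
has a `Z`-string that flips `B_p` only. -/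
def AccessToBoundary (U : E → Matrix.unitaryGroup (Fin 2) ℂ) (p : F) : Prop :=
  ∃ (r : ℕ) (c : Fin (r + 1) → F) (e : Fin (r + 1) → E),
    K.IsCopath p c e ∧ H.IsBoundary (e (Fin.last r)) ∧
    H.Flips (stringOp U pauliZ (Finset.univ.image e)) (.inr p)

end CLHInstance

/-! Two distinct stars share at most one edge, likewise two distinct plaquettes, while a star and a
plaquette share no edge or exactly two. Coefficients of commuting terms on their only common qubit
commute. Hence outside the coboundary all stars act on a qubit through one reflection `Z`
(hermitian, traceless, square one), and outside the boundary all plaquettes act through one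
reflection `X`. A reflection commuting with all terms makes its qubit classical, hence trivial.

Let a star `A` and a plaquette `B` share the qubits `q`, `q'`, and write `A = a₀ + Z a₁`, `B = b₀ +
W b₁` with parts free of `q`. If `Z` and `W` do not commute, `commutation_of_split` shows that `a₁`,
`b₁` anticommute, that `a₀` commutes with `b₁` and `b₀` with `a₁`, and that `[a₀, b₀] = -tr(ZW) a₁
b₁`. Without classical qubits this yields anticommuting reflections `P`, `Q` at `q'`
(`exists_pairSplit`). A second plaquette at `q` forces `tr(ZW) = 0` (`PairSplit.anticommute`), so
`Z` and `W` are Pauli operators of one basis. Conjugating `A` by `W` at `q` or by `Q` at `q'` has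
the same effect, so a flip of `A` can be moved between the qubits. Going around an interior star,
all its flips agree, and a flip sends `A` to a constant minus `A`.

Strings end by `PairSplit.commute_or_commute`: at `q'`, `P` commutes with `A` or `Q` commutes with
`B`. On a qubit in both the boundary and the coboundary the basis is still free and is chosen to be
that of `P`, `Q` (`exists_isStringToric`).

It remains to route the strings. Stars are explored from `s` and plaquettes from `p` through the
interior. If the component is not wholly interior, the exploration meets an edge `q₀` of a reached
star and a reached plaquette that leads to a non-interior star `v'`, or dually to a plaquette.
Turning about `v'` from `q₀` to the first bad edge, either an `X`-string through `v'` or a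
`Z`-string through the plaquettes around `v'` can end there (`hasAccess_of_exit`, `hasAccess`).
`StarPlaquetteSystem` is symmetric under exchanging stars and plaquettes, so each argument is made
once. -/

/-- Operators on one qubit. -/
abbrev QubitOp := Matrix (Fin 2) (Fin 2) ℂ

/-! ### Coefficients of an operator at one qubit -/

section Blocks

variable {E : Type*} [DecidableEq E]

theorem eq_update_of_forall_ne {q : E} {x y : E → Fin 2} (h : ∀ e, e ≠ q → x e = y e) :
    Function.update x q (y q) = y := by
  ext1 e
  rcases eq_or_ne e q with rfl | he
  · simp
  · simp [he, h e he]

/-- The coefficient at `q` of `|x⟩⟨y|` on the other qubits. -/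
def block (q : E) (x y : E → Fin 2) (h : QOp E) : QubitOp :=
  Matrix.of fun i j => h (Function.update x q i) (Function.update y q j)

theorem block_add (q : E) (x y : E → Fin 2) (g h : QOp E) :
    block q x y (g + h) = block q x y g + block q x y h := rfl

theorem block_smul (q : E) (x y : E → Fin 2) (c : ℂ) (h : QOp E) :
    block q x y (c • h) = c • block q x y h := rfl

theorem block_conjTranspose (q : E) (x y : E → Fin 2) (h : QOp E) :
    block q x y h.conjTranspose = (block q y x h).conjTranspose := rfl

theorem block_ext (q : E) {g h : QOp E} (H : ∀ x y, block q x y g = block q x y h) : g = h := by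
  ext x y
  have := congrFun (congrFun (H x y) (x q)) (y q)
  simpa [block] using this

theorem block_sum {ι : Type*} (s : Finset ι) (q : E) (x y : E → Fin 2) (h : ι → QOp E) :
    block q x y (∑ i ∈ s, h i) = ∑ i ∈ s, block q x y (h i) := by
  classical
  induction s using Finset.induction_on with
  | empty => rfl
  | insert a s ha ih => rw [Finset.sum_insert ha, Finset.sum_insert ha, block_add, ih]

end Blocks

/-! ### One-qubit operators, locality and operators with few common qubits -/

section SiteOperators

variable {E : Type*} [Fintype E]

theorem tensorOp_mul [DecidableEq E] (M N : E → QubitOp) :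
    tensorOp M * tensorOp N = tensorOp (fun e => M e * N e) := by
  ext x y
  simp only [tensorOp, Matrix.mul_apply, Matrix.of_apply, ← Finset.prod_mul_distrib]
  rw [Finset.prod_univ_sum, Fintype.piFinset_univ]

theorem tensorOp_one [DecidableEq E] : tensorOp (fun _ : E => (1 : QubitOp)) = 1 := by
  ext x y
  simp only [tensorOp, Matrix.of_apply, Matrix.one_apply]
  by_cases h : x = y
  · simp [h]
  · obtain ⟨e, he⟩ := Function.ne_iff.1 h
    rw [if_neg h]
    exact Finset.prod_eq_zero (Finset.mem_univ e) (if_neg he)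

variable [DecidableEq E]

/-- The operator `m` acting on the qubit `q`. -/
noncomputable def siteOp (q : E) (m : QubitOp) : QOp E :=
  tensorOp (Function.update (fun _ => 1) q m)

theorem siteOp_apply (q : E) (m : QubitOp) (x y : E → Fin 2) :
    siteOp q m x y =
      m (x q) (y q) * ∏ e ∈ Finset.univ.erase q, (1 : QubitOp) (x e) (y e) := by
  simp only [siteOp, tensorOp, Matrix.of_apply]
  rw [← Finset.mul_prod_erase _ _ (Finset.mem_univ q)]
  congr 1
  · simp
  · refine Finset.prod_congr rfl fun e he => ?_
    rw [Function.update_of_ne (Finset.ne_of_mem_erase he)]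

theorem siteOp_one (q : E) : siteOp q 1 = 1 := by
  rw [siteOp, Function.update_eq_self_iff.2 rfl, tensorOp_one]

theorem siteOp_mul (q : E) (m n : QubitOp) : siteOp q (m * n) = siteOp q m * siteOp q n := by
  rw [siteOp, siteOp, siteOp, tensorOp_mul]
  congr 1
  ext1 e
  rcases eq_or_ne e q with rfl | h
  · simp
  · simp [h]

theorem siteOp_add (q : E) (m n : QubitOp) : siteOp q (m + n) = siteOp q m + siteOp q n := by
  ext x y
  simp [siteOp_apply, add_mul]

theorem siteOp_smul (q : E) (c : ℂ) (m : QubitOp) : siteOp q (c • m) = c • siteOp q m := by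
  ext x y
  simp [siteOp_apply, mul_assoc]

/-- `siteOp` as a homomorphism of algebras. -/
noncomputable def siteHom (q : E) : QubitOp →ₐ[ℂ] QOp E :=
  AlgHom.ofLinearMap
    { toFun := siteOp q
      map_add' := siteOp_add q
      map_smul' := siteOp_smul q } (siteOp_one q) (siteOp_mul q)

theorem siteHom_apply (q : E) (m : QubitOp) : siteHom q m = siteOp q m := rfl

theorem siteOp_neg (q : E) (m : QubitOp) : siteOp q (-m) = -siteOp q m := map_neg (siteHom q) m

theorem siteOp_sub (q : E) (m n : QubitOp) : siteOp q (m - n) = siteOp q m - siteOp q n :=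
  map_sub (siteHom q) m n

theorem siteOp_zero (q : E) : siteOp q 0 = 0 := map_zero (siteHom q)

theorem siteOp_smul_one (q : E) (c : ℂ) : siteOp q (c • 1) = c • 1 := by
  rw [siteOp_smul, siteOp_one]

theorem siteOp_commute {q e : E} (h : q ≠ e) (m n : QubitOp) :
    Commute (siteOp q m) (siteOp e n) := by
  rw [Commute, SemiconjBy, siteOp, siteOp, tensorOp_mul, tensorOp_mul]
  congr 1
  ext1 d
  rcases eq_or_ne d q with rfl | hd
  · simp [h]
  · simp [hd]

theorem siteOp_conjTranspose (q : E) (m : QubitOp) :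
    (siteOp q m).conjTranspose = siteOp q m.conjTranspose := by
  ext x y
  simp only [Matrix.conjTranspose_apply, siteOp_apply, star_mul', star_prod]
  congr 1
  refine Finset.prod_congr rfl fun e _ => ?_
  rw [← Matrix.conjTranspose_apply, Matrix.conjTranspose_one]

theorem siteOp_apply_update (q : E) (m : QubitOp) (x : E → Fin 2) (i : Fin 2) :
    siteOp q m x (Function.update x q i) = m (x q) i := by
  rw [siteOp_apply, Finset.prod_eq_one, mul_one, Function.update_self]
  intro e he
  rw [Function.update_of_ne (Finset.ne_of_mem_erase he), Matrix.one_apply_eq]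

theorem siteOp_update_apply (q : E) (m : QubitOp) (x : E → Fin 2) (i : Fin 2) :
    siteOp q m (Function.update x q i) x = m i (x q) := by
  rw [siteOp_apply, Finset.prod_eq_one, mul_one, Function.update_self]
  intro e he
  rw [Function.update_of_ne (Finset.ne_of_mem_erase he), Matrix.one_apply_eq]

theorem siteOp_apply_eq_zero (q : E) (m : QubitOp) {x y : E → Fin 2}
    (h : ∃ e, e ≠ q ∧ x e ≠ y e) : siteOp q m x y = 0 := by
  obtain ⟨e, he, hxy⟩ := h
  have : ∏ e ∈ Finset.univ.erase q, (1 : QubitOp) (x e) (y e) = 0 :=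
    Finset.prod_eq_zero (Finset.mem_erase.2 ⟨he, Finset.mem_univ e⟩) (Matrix.one_apply_ne hxy)
  rw [siteOp_apply, this, mul_zero]

theorem siteOp_mulVec_apply (q : E) (m : QubitOp) (ψ : (E → Fin 2) → ℂ) (x : E → Fin 2) :
    (siteOp q m).mulVec ψ x = ∑ i, m (x q) i * ψ (Function.update x q i) := by
  rw [Matrix.mulVec, dotProduct]
  symm
  refine Fintype.sum_of_injective (fun i => Function.update x q i)
    (Function.update_injective x q) _ _ ?_ fun i => by rw [siteOp_apply_update]
  intro z hz
  rw [siteOp_apply_eq_zero, zero_mul]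
  by_contra! hc
  exact hz ⟨z q, eq_update_of_forall_ne hc⟩

theorem siteOp_mul_apply (q : E) (m : QubitOp) (h : QOp E) (x y : E → Fin 2) :
    (siteOp q m * h) x y = ∑ i, m (x q) i * h (Function.update x q i) y :=
  siteOp_mulVec_apply q m (fun z => h z y) x

theorem mul_siteOp_apply (q : E) (m : QubitOp) (h : QOp E) (x y : E → Fin 2) :
    (h * siteOp q m) x y = ∑ i, h x (Function.update y q i) * m i (y q) := by
  rw [Matrix.mul_apply]
  symm
  refine Fintype.sum_of_injective (fun i => Function.update y q i)
    (Function.update_injective y q) _ _ ?_ fun i => by rw [siteOp_update_apply]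
  intro z hz
  rw [siteOp_apply_eq_zero, mul_zero]
  by_contra! hc
  exact hz ⟨z q, eq_update_of_forall_ne fun e he => (hc e he).symm⟩

theorem block_siteOp_mul (q : E) (x y : E → Fin 2) (m : QubitOp) (h : QOp E) :
    block q x y (siteOp q m * h) = m * block q x y h := by
  ext i j
  rw [Matrix.mul_apply, block, Matrix.of_apply, siteOp_mul_apply]
  simp [block]

theorem block_mul_siteOp (q : E) (x y : E → Fin 2) (m : QubitOp) (h : QOp E) :
    block q x y (h * siteOp q m) = block q x y h * m := by
  ext i j
  rw [Matrix.mul_apply, block, Matrix.of_apply, mul_siteOp_apply]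
  simp [block]

theorem commute_siteOp_iff {q : E} {m : QubitOp} {h : QOp E} :
    Commute (siteOp q m) h ↔ ∀ x y, Commute m (block q x y h) := by
  constructor
  · intro H x y
    have := congrArg (block q x y) H.eq
    rwa [block_siteOp_mul, block_mul_siteOp] at this
  · intro H
    refine block_ext q fun x y => ?_
    rw [block_siteOp_mul, block_mul_siteOp]
    exact H x y

/-- The scalars let one statement cover commutation `(1, 1)`, anticommutation `(1, -1)` and
vanishing products `(1, 0)`. -/
theorem smul_siteOp_mul_iff {q : E} {m : QubitOp} {h : QOp E} {a b : ℂ} :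
    a • (siteOp q m * h) = b • (h * siteOp q m) ↔
      ∀ x y, a • (m * block q x y h) = b • (block q x y h * m) := by
  constructor
  · intro H x y
    have := congrArg (block q x y) H
    rwa [block_smul, block_smul, block_siteOp_mul, block_mul_siteOp] at this
  · intro H
    refine block_ext q fun x y => ?_
    rw [block_smul, block_smul, block_siteOp_mul, block_mul_siteOp]
    exact H x y

/-- `h` commutes with all operators on the qubit `q`. -/
def TrivialAt (h : QOp E) (q : E) : Prop := ∀ m, Commute (siteOp q m) h

theorem QubitOp.eq_smul_one_of_forall_commute {m : QubitOp} (h : ∀ n, Commute n m) :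
    m = m 0 0 • 1 := by
  have h1 := congrFun (congrFun (h !![0, 1; 0, 0]).eq 0) 1
  have h2 := congrFun (congrFun (h !![0, 1; 0, 0]).eq 0) 0
  have h3 := congrFun (congrFun (h !![0, 0; 1, 0]).eq 0) 0
  simp [Matrix.mul_apply] at h1 h2 h3
  ext i j
  fin_cases i <;> fin_cases j <;> simp [h1, h2, ← h3]

theorem trivialAt_iff_block {h : QOp E} {q : E} :
    TrivialAt h q ↔ ∀ x y, block q x y h = block q x y h 0 0 • 1 := by
  constructor
  · intro H x y
    exact QubitOp.eq_smul_one_of_forall_commute fun n => commute_siteOp_iff.1 (H n) x y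
  · intro H m
    refine commute_siteOp_iff.2 fun x y => ?_
    rw [H x y]
    exact (Commute.one_right m).smul_right _

theorem actsTrivially_iff {h : QOp E} {q : E} : ActsTrivially h q ↔ TrivialAt h q := by
  rw [trivialAt_iff_block]
  constructor
  · rintro ⟨h', H⟩ x y
    have hr : ∀ (z : E → Fin 2) (i : Fin 2),
        (fun e : {e : E // e ≠ q} => Function.update z q i e) = fun e => z e.1 := by
      intro z i
      ext1 e
      rw [Function.update_of_ne e.2]
    ext i j
    have hu : ∀ (z : E → Fin 2) (i : Fin 2), Function.update z q i q = i := fun z i => by simp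
    have key : ∀ i j, h (Function.update x q i) (Function.update y q j) =
        (1 : QubitOp) i j * h' (fun e => x e.1) (fun e => y e.1) := fun i j => by
      rw [H, hr, hr]
      exact congrArg₂ (fun a b => (1 : QubitOp) a b * h' (fun e => x e.1) (fun e => y e.1))
        (hu x i) (hu y j)
    rw [Matrix.smul_apply, block, Matrix.of_apply, Matrix.of_apply, key, key, Matrix.one_apply_eq,
      one_mul, smul_eq_mul, mul_comm]
  · intro H
    -- The value 0 at `q` is arbitrary, since the coefficients of `h` at `q` are scalar.
    refine ⟨fun x y => h (fun e => if he : e = q then 0 else x ⟨e, he⟩)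
      (fun e => if he : e = q then 0 else y ⟨e, he⟩), fun x y => ?_⟩
    have hr : ∀ z : E → Fin 2,
        (fun e => if _ : e = q then 0 else z e) = Function.update z q 0 := by
      intro z
      ext1 e
      by_cases he : e = q
      · subst he; simp
      · simp [he]
    have := congrFun (congrFun (H x y) (x q)) (y q)
    simp only [block, Matrix.of_apply, Function.update_eq_self, Matrix.smul_apply,
      smul_eq_mul] at this
    simp only [hr]
    rw [this, mul_comm]

theorem TrivialAt.mul {g h : QOp E} {q : E} (hg : TrivialAt g q) (hh : TrivialAt h q) :
    TrivialAt (g * h) q := fun m => (hg m).mul_right (hh m)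

theorem TrivialAt.add {g h : QOp E} {q : E} (hg : TrivialAt g q) (hh : TrivialAt h q) :
    TrivialAt (g + h) q := fun m => (hg m).add_right (hh m)

theorem TrivialAt.sum {ι : Type*} {s : Finset ι} {h : ι → QOp E} {q : E}
    (H : ∀ i ∈ s, TrivialAt (h i) q) : TrivialAt (∑ i ∈ s, h i) q :=
  fun m => Commute.sum_right _ _ _ fun i hi => H i hi m

theorem TrivialAt.smul {h : QOp E} {q : E} (hh : TrivialAt h q) (c : ℂ) : TrivialAt (c • h) q :=
  fun m => (hh m).smul_right c

theorem trivialAt_siteOp {q e : E} (h : e ≠ q) (m : QubitOp) : TrivialAt (siteOp q m) e :=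
  fun n => siteOp_commute h n m

/-- The coefficient of the matrix unit `E i j` at the qubit `q`. -/
noncomputable def slice (q : E) (i j : Fin 2) (h : QOp E) : QOp E :=
  ∑ k, siteOp q (Matrix.single k i 1) * h * siteOp q (Matrix.single j k 1)

/-- For a matrix `m`, the sum over `k` of `E_{ki} m E_{jk}` is `m_{ij}` times the identity. -/
theorem block_slice (q : E) (i j : Fin 2) (h : QOp E) (x y : E → Fin 2) :
    block q x y (slice q i j h) = block q x y h i j • 1 := by
  rw [slice, block_sum]
  simp only [block_mul_siteOp, block_siteOp_mul]
  ext k l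
  fin_cases k <;> fin_cases l <;> simp

theorem trivialAt_slice_self (q : E) (i j : Fin 2) (h : QOp E) : TrivialAt (slice q i j h) q :=
  trivialAt_iff_block.2 fun x y => by rw [block_slice]; simp

theorem TrivialAt.slice {h : QOp E} {e : E} (hh : TrivialAt h e) (q : E) (i j : Fin 2) :
    TrivialAt (slice q i j h) e := by
  rcases eq_or_ne e q with rfl | he
  · exact trivialAt_slice_self e i j h
  · exact TrivialAt.sum fun k _ => ((trivialAt_siteOp he _).mul hh).mul (trivialAt_siteOp he _)

theorem sum_siteOp_mul_slice (q : E) (h : QOp E) :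
    ∑ i, ∑ j, siteOp q (Matrix.single i j 1) * slice q i j h = h := by
  refine block_ext q fun x y => ?_
  simp only [block_sum, block_siteOp_mul, block_slice]
  ext k l
  fin_cases k <;> fin_cases l <;> simp

theorem slice_mul {q : E} (i j : Fin 2) (g : QOp E) {h : QOp E} (hh : TrivialAt h q) :
    slice q i j (g * h) = slice q i j g * h := by
  simp only [slice, Finset.sum_mul]
  refine Finset.sum_congr rfl fun k _ => ?_
  simp only [mul_assoc]
  rw [(hh _).eq]

theorem slice_mul' {q : E} (i j : Fin 2) (g : QOp E) {h : QOp E} (hh : TrivialAt h q) :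
    slice q i j (h * g) = h * slice q i j g := by
  simp only [slice, Finset.mul_sum]
  refine Finset.sum_congr rfl fun k _ => ?_
  simp only [← mul_assoc]
  rw [(hh _).eq]

theorem slice_smul (q : E) (i j : Fin 2) (c : ℂ) (h : QOp E) :
    slice q i j (c • h) = c • slice q i j h := by
  simp only [slice, Finset.smul_sum, mul_smul_comm, smul_mul_assoc]

/-- The slice is the identity at `e`, so it has to be read at equal values of `x` and `y` there. -/
theorem block_slice_of_ne {q e : E} (hqe : e ≠ q) (i j : Fin 2) (h : QOp E) {x y : E → Fin 2}
    (hxy : x e = y e) :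
    block q x y (slice e i j h) =
      block q (Function.update x e i) (Function.update y e j) h := by
  ext k l
  have key := congrFun (congrFun
    (block_slice e i j h (Function.update x q k) (Function.update y q l)) (x e)) (y e)
  have hx : Function.update (Function.update x q k) e (x e) = Function.update x q k := by
    rw [Function.update_eq_self_iff, Function.update_of_ne hqe]
  have hy : Function.update (Function.update y q l) e (y e) = Function.update y q l := by
    rw [Function.update_eq_self_iff, Function.update_of_ne hqe]
  simp only [block, Matrix.of_apply, hy, hxy, Matrix.smul_apply, Matrix.one_apply_eq,
    smul_eq_mul, mul_one] at key
  rw [hxy] at hx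
  rw [hx] at key
  simp only [block, Matrix.of_apply, key]
  rw [Function.update_comm hqe, Function.update_comm hqe]

/-- Matrix units are tensor products of one-qubit matrix units, so `h` commutes with all of them. -/
theorem eq_smul_one_of_forall_trivialAt {h : QOp E} (H : ∀ e, TrivialAt h e) :
    ∃ c : ℂ, h = c • 1 := by
  have key : ∀ x y : E → Fin 2, Commute (Matrix.single x y (1 : ℂ)) h := by
    intro x y
    have aux : ∀ S : Finset E, ∀ M : E → QubitOp, (∀ e, e ∉ S → M e = 1) →
        Commute (tensorOp M) h := by
      intro S
      induction S using Finset.induction_on with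
      | empty =>
        intro M hM
        have : M = fun _ => 1 := funext fun e => hM e (Finset.notMem_empty e)
        rw [this, tensorOp_one]
        exact Commute.one_left h
      | insert a S ha ih =>
        intro M hM
        have : tensorOp M = siteOp a (M a) * tensorOp (Function.update M a 1) := by
          rw [siteOp, tensorOp_mul]
          congr 1
          ext1 e
          rcases eq_or_ne e a with rfl | he
          · simp
          · simp [he]
        rw [this]
        refine (H a _).mul_left (ih _ fun e he => ?_)
        rcases eq_or_ne e a with rfl | hea
        · simp
        · rw [Function.update_of_ne hea]
          exact hM e (by simp [hea, he])
    have : Matrix.single x y (1 : ℂ) = tensorOp fun e => Matrix.single (x e) (y e) (1 : ℂ) := by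
      ext a b
      simp only [tensorOp, Matrix.of_apply, Matrix.single_apply]
      by_cases hab : x = a ∧ y = b
      · obtain ⟨rfl, rfl⟩ := hab
        simp
      · rw [if_neg hab]
        have : ∃ e, ¬ (x e = a e ∧ y e = b e) := by
          by_contra! hc
          exact hab ⟨funext fun e => (hc e).1, funext fun e => (hc e).2⟩
        obtain ⟨e, he⟩ := this
        exact (Finset.prod_eq_zero (Finset.mem_univ e) (if_neg he)).symm
    rw [this]
    exact aux Finset.univ _ fun e he => absurd (Finset.mem_univ e) he
  obtain ⟨c, hc⟩ := Matrix.mem_range_scalar_of_commute_single (M := h) fun i j _ => key i j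
  refine ⟨c, ?_⟩
  rw [← hc, Matrix.scalar_apply, Matrix.smul_one_eq_diagonal]

/-- Expanding `g` in matrix units at a qubit where `h` is trivial leaves slices that are trivial
there too; after all such qubits `g` is a scalar. -/
theorem commute_of_disjoint {g h : QOp E} (H : ∀ e, TrivialAt g e ∨ TrivialAt h e) :
    Commute g h := by
  have aux : ∀ S : Finset E, ∀ g : QOp E, (∀ e ∈ S, TrivialAt h e) →
      (∀ e, e ∉ S → TrivialAt g e) → Commute g h := by
    intro S
    induction S using Finset.induction_on with
    | empty =>
      intro g _ hg
      obtain ⟨c, rfl⟩ := eq_smul_one_of_forall_trivialAt fun e => hg e (Finset.notMem_empty e)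
      exact (Commute.one_left h).smul_left c
    | insert a S ha ih =>
      intro g hS hg
      rw [← sum_siteOp_mul_slice a g]
      refine Commute.sum_left _ _ _ fun i _ => Commute.sum_left _ _ _ fun j _ => ?_
      refine (hS a (Finset.mem_insert_self a S) _).mul_left
        (ih _ (fun e he => hS e (Finset.mem_insert_of_mem he)) fun e he => ?_)
      rcases eq_or_ne e a with rfl | hea
      · exact trivialAt_slice_self _ _ _ _
      · exact (hg e (by simp [hea, he])).slice _ _ _
  classical
  refine aux (Finset.univ.filter fun e => TrivialAt h e) g (by simp) fun e he => ?_
  exact (H e).resolve_right fun h' => he (by simp [h'])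

theorem exists_eq_siteOp {h : QOp E} {q : E} (H : ∀ e, e ≠ q → TrivialAt h e) :
    ∃ m, h = siteOp q m := by
  have : ∀ i j, ∃ c : ℂ, slice q i j h = c • 1 := fun i j =>
    eq_smul_one_of_forall_trivialAt fun e => by
      rcases eq_or_ne e q with rfl | he
      · exact trivialAt_slice_self _ _ _ _
      · exact (H e he).slice _ _ _
  choose c hc using this
  refine ⟨∑ i, ∑ j, c i j • Matrix.single i j 1, ?_⟩
  conv_lhs => rw [← sum_siteOp_mul_slice q h]
  simp only [← siteHom_apply, map_sum, map_smul, hc, mul_smul_comm, mul_one]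

theorem block_siteOp (q : E) (m : QubitOp) (x y : E → Fin 2) :
    ∃ c : ℂ, block q x y (siteOp q m) = c • m := by
  have h1 : TrivialAt (1 : QOp E) q := fun m => Commute.one_right _
  refine ⟨block q x y 1 0 0, ?_⟩
  rw [← mul_one (siteOp q m), block_siteOp_mul, trivialAt_iff_block.1 h1 x y]
  simp

/-- A commutation relation between two operators with at most one common qubit is inherited by
their coefficients on that qubit. -/
theorem smul_siteOp_block_mul {a b : ℂ} {g h : QOp E} {q : E}
    (hgh : a • (g * h) = b • (h * g))
    (H : ∀ e, e ≠ q → TrivialAt g e ∨ TrivialAt h e) (x y : E → Fin 2) :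
    a • (siteOp q (block q x y g) * h) = b • (h * siteOp q (block q x y g)) := by
  -- `S` holds the qubits still to be sliced off `g`. Slicing where `h` is trivial preserves the
  -- relation, and once `S` is empty `g` acts on `q` alone.
  have aux : ∀ S : Finset E, q ∉ S → ∀ g : QOp E, a • (g * h) = b • (h * g) →
      (∀ e ∈ S, TrivialAt h e) → (∀ e, e ∉ S → e ≠ q → TrivialAt g e) →
      ∀ x y, a • (siteOp q (block q x y g) * h) = b • (h * siteOp q (block q x y g)) := by
    intro S
    induction S using Finset.induction_on with
    | empty =>
      intro _ g hgh _ hg x y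
      obtain ⟨m, rfl⟩ := exists_eq_siteOp fun e he => hg e (Finset.notMem_empty e) he
      obtain ⟨c, hc⟩ := block_siteOp q m x y
      rw [hc, siteOp_smul, smul_mul_assoc, mul_smul_comm, smul_comm a, smul_comm b, hgh]
    | insert d S hd ih =>
      intro hq g hgh hS hg x y
      have hdq : d ≠ q := fun h => hq (h ▸ Finset.mem_insert_self d S)
      have hhd := hS d (Finset.mem_insert_self d S)
      have := ih (fun h => hq (Finset.mem_insert_of_mem h)) (slice d (x d) (y d) g)
        (by rw [← slice_mul _ _ _ hhd, ← slice_mul' _ _ _ hhd, ← slice_smul, ← slice_smul, hgh])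
        (fun e he => hS e (Finset.mem_insert_of_mem he))
        (fun e he heq => by
          rcases eq_or_ne e d with rfl | hea
          · exact trivialAt_slice_self _ _ _ _
          · exact (hg e (by simp [hea, he]) heq).slice _ _ _)
        x (Function.update y d (x d))
      rwa [block_slice_of_ne hdq _ _ _ (by simp), Function.update_idem,
        Function.update_eq_self, Function.update_eq_self] at this
  classical
  refine aux (Finset.univ.filter fun e => e ≠ q ∧ TrivialAt h e) (by simp) g hgh (by simp)
    (fun e he heq => (H e heq).resolve_right fun h' => he (by simp [h', heq])) x y

theorem smul_block_mul_block {a b : ℂ} {g h : QOp E} {q : E}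
    (hgh : a • (g * h) = b • (h * g))
    (H : ∀ e, e ≠ q → TrivialAt g e ∨ TrivialAt h e) (x y x' y' : E → Fin 2) :
    a • (block q x y g * block q x' y' h) = b • (block q x' y' h * block q x y g) :=
  smul_siteOp_mul_iff.1 (smul_siteOp_block_mul hgh H x y) x' y'

theorem commute_block_block {g h : QOp E} {q : E} (hgh : Commute g h)
    (H : ∀ e, e ≠ q → TrivialAt g e ∨ TrivialAt h e) (x y x' y' : E → Fin 2) :
    Commute (block q x y g) (block q x' y' h) := by
  have := smul_block_mul_block (a := 1) (b := 1) (by rw [hgh.eq]) H x y x' y'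
  rwa [one_smul, one_smul] at this

/-- The normalized partial trace over the qubit `q`. -/
noncomputable def partialTrace (q : E) (h : QOp E) : QOp E := (2⁻¹ : ℂ) • ∑ i, slice q i i h

theorem block_partialTrace (q : E) (h : QOp E) (x y : E → Fin 2) :
    block q x y (partialTrace q h) = ((block q x y h).trace / 2) • 1 := by
  rw [partialTrace, block_smul, block_sum]
  simp only [block_slice, Matrix.trace, Matrix.diag]
  rw [← Finset.sum_smul, smul_smul]
  congr 1
  ring

theorem trivialAt_partialTrace_self (q : E) (h : QOp E) : TrivialAt (partialTrace q h) q :=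
  (TrivialAt.sum fun _ _ => trivialAt_slice_self _ _ _ _).smul _

theorem TrivialAt.partialTrace {h : QOp E} {e : E} (hh : TrivialAt h e) (q : E) :
    TrivialAt (partialTrace q h) e :=
  (TrivialAt.sum fun _ _ => hh.slice _ _ _).smul _

theorem partialTrace_isHermitian {h : QOp E} (hh : h.IsHermitian) (q : E) :
    (partialTrace q h).IsHermitian := by
  refine block_ext q fun x y => ?_
  rw [block_conjTranspose, block_partialTrace, block_partialTrace, Matrix.conjTranspose_smul,
    Matrix.conjTranspose_one]
  congr 1
  have : block q x y h = (block q y x h).conjTranspose := by rw [← block_conjTranspose, hh.eq]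
  rw [this, Matrix.trace_conjTranspose]
  simp

theorem Commute.partialTrace_right {g h : QOp E} {q : E} (hgh : Commute g h)
    (hg : TrivialAt g q) : Commute g (partialTrace q h) := by
  rw [Commute, SemiconjBy, partialTrace, mul_smul_comm, smul_mul_assoc, Finset.mul_sum,
    Finset.sum_mul]
  congr 1
  refine Finset.sum_congr rfl fun i _ => ?_
  rw [← slice_mul _ _ _ hg, ← slice_mul' _ _ _ hg, hgh.eq]

end SiteOperators

/-! ### Algebra of one qubit: reflections and their commutants -/

/-- The reflections of a qubit: hermitian, traceless and of square one. These are the Pauli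
operators in some orthonormal basis. -/
structure IsReflection (P : QubitOp) : Prop where
  herm : P.IsHermitian
  sq : P * P = 1
  trace : P.trace = 0

namespace QubitOp

theorem mul_self_of_trace_eq_zero {m : QubitOp} (h : m.trace = 0) : m * m = (-m.det) • 1 := by
  rw [Matrix.trace_fin_two] at h
  rw [Matrix.det_fin_two]
  have h' : m 1 1 = -m 0 0 := by linear_combination h
  ext i j
  fin_cases i <;> fin_cases j <;> simp [Matrix.mul_apply, h'] <;> ring

theorem mul_self_eq (m : QubitOp) : m * m = m.trace • m - m.det • 1 := by
  rw [Matrix.trace_fin_two, Matrix.det_fin_two]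
  ext i j
  fin_cases i <;> fin_cases j <;> simp [Matrix.mul_apply] <;> ring

/-- Anticommuting operators with nonzero product are traceless. -/
theorem trace_eq_zero_of_anticommute {a b : QubitOp} (h : a * b = -(b * a)) (h0 : a * b ≠ 0) :
    a.trace = 0 ∧ b.trace = 0 := by
  -- By Cayley–Hamilton `a²` is `tr a • a` up to a scalar; as it commutes with `b`, also `tr a • a`
  -- commutes with `b`, which forces `tr a = 0`.
  have h2 : a * a * b = b * (a * a) := by
    rw [mul_assoc, h, mul_neg, ← mul_assoc, h, neg_mul, neg_neg, mul_assoc]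
  have h3 : a * (b * b) = b * b * a := by
    rw [← mul_assoc, h, neg_mul, mul_assoc, h, mul_neg, neg_neg, mul_assoc]
  constructor
  · rw [mul_self_eq, sub_mul, mul_sub, smul_mul_assoc, smul_mul_assoc, mul_smul_comm,
      mul_smul_comm, one_mul, mul_one, sub_left_inj] at h2
    have : b * a = -(a * b) := by rw [h, neg_neg]
    rw [this, smul_neg, eq_neg_iff_add_eq_zero, ← add_smul] at h2
    have := (smul_eq_zero.1 h2).resolve_right h0
    linear_combination this / 2
  · rw [mul_self_eq, sub_mul, mul_sub, smul_mul_assoc, smul_mul_assoc, mul_smul_comm,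
      mul_smul_comm, one_mul, mul_one, sub_left_inj] at h3
    have : b * a = -(a * b) := by rw [h, neg_neg]
    rw [this, smul_neg, eq_neg_iff_add_eq_zero, ← add_smul] at h3
    have := (smul_eq_zero.1 h3).resolve_right h0
    linear_combination this / 2

/-- A nonzero traceless hermitian operator is a multiple of a reflection. -/
theorem exists_reflection_of_trace_eq_zero {m : QubitOp} (hm : m.IsHermitian)
    (ht : m.trace = 0) (h0 : m ≠ 0) : ∃ (P : QubitOp) (r : ℂ), IsReflection P ∧ r ≠ 0 ∧
      m = r • P := by
  have h11 : m 1 1 = -m 0 0 := by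
    rw [Matrix.trace_fin_two] at ht
    linear_combination ht
  have h10 : m 1 0 = star (m 0 1) := (hm.apply 1 0).symm
  have h00 : star (m 0 0) = m 0 0 := hm.apply 0 0
  obtain ⟨t, ht0⟩ : ∃ t : ℝ, m 0 0 = t := ⟨_, (Complex.conj_eq_iff_re.1 h00).symm⟩
  -- `m² = d`, so dividing `m` by the square root of `d` gives a reflection.
  set d : ℝ := t ^ 2 + Complex.normSq (m 0 1) with hd
  have hdet : -m.det = d := by
    rw [Matrix.det_fin_two, h11, h10, ht0, hd]
    push_cast
    rw [← Complex.mul_conj]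
    simp
    ring
  have hd0 : 0 < d := by
    have h1 : 0 ≤ Complex.normSq (m 0 1) := Complex.normSq_nonneg _
    rcases lt_or_eq_of_le (show 0 ≤ d by positivity) with h | h
    · exact h
    · exfalso
      apply h0
      have h2 : t = 0 := by nlinarith
      have h3 : Complex.normSq (m 0 1) = 0 := by nlinarith
      rw [Complex.normSq_eq_zero] at h3
      ext i j
      fin_cases i <;> fin_cases j <;> simp [h11, h10, ht0, h2, h3]
  have hs : ((Real.sqrt d : ℝ) : ℂ) ≠ 0 := by
    exact_mod_cast (Real.sqrt_pos.2 hd0).ne'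
  have hs2 : ((Real.sqrt d : ℝ) : ℂ) * (Real.sqrt d : ℝ) = d := by
    exact_mod_cast Real.mul_self_sqrt hd0.le
  refine ⟨((Real.sqrt d : ℝ) : ℂ)⁻¹ • m, (Real.sqrt d : ℝ), ⟨?_, ?_, ?_⟩, hs, ?_⟩
  · rw [Matrix.IsHermitian, Matrix.conjTranspose_smul, hm.eq]
    simp
  · rw [smul_mul_smul_comm, mul_self_of_trace_eq_zero ht, hdet, smul_smul, ← hs2]
    have : ((Real.sqrt d : ℝ) : ℂ)⁻¹ * ((Real.sqrt d : ℝ) : ℂ)⁻¹ *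
        (((Real.sqrt d : ℝ) : ℂ) * (Real.sqrt d : ℝ)) = 1 := by field_simp
    rw [this, one_smul]
  · rw [Matrix.trace_smul, ht, smul_zero]
  · rw [smul_smul, mul_inv_cancel₀ hs, one_smul]

/-- A hermitian operator that is not a multiple of the identity is a combination of the identity
and a reflection. -/
theorem exists_reflection {m : QubitOp} (hm : m.IsHermitian) (h0 : ∀ c : ℂ, m ≠ c • 1) :
    ∃ (P : QubitOp) (c r : ℂ), IsReflection P ∧ r ≠ 0 ∧ m = c • 1 + r • P := by
  have h2 : (m - (m.trace / 2) • 1).IsHermitian := by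
    rw [Matrix.IsHermitian, Matrix.conjTranspose_sub, Matrix.conjTranspose_smul, hm.eq,
      Matrix.conjTranspose_one]
    congr 2
    conv_rhs => rw [← hm.eq, Matrix.trace_conjTranspose]
    simp
  obtain ⟨P, r, hP, hr, h⟩ := exists_reflection_of_trace_eq_zero h2
    (by simp [Matrix.trace_sub, Matrix.trace_smul]) (fun h => h0 _ (sub_eq_zero.1 h))
  exact ⟨P, m.trace / 2, r, hP, hr, by rw [← h]; abel⟩

end QubitOp

namespace IsReflection

variable {P Q : QubitOp}

theorem ne_smul_one (hP : IsReflection P) (c : ℂ) : P ≠ c • 1 := by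
  rintro rfl
  have h1 := hP.sq
  have h2 := hP.trace
  rw [Matrix.trace_smul, Matrix.trace_one] at h2
  have : c = 0 := by simpa using h2
  rw [this, zero_smul, zero_mul] at h1
  exact zero_ne_one h1

theorem ne_zero (hP : IsReflection P) : P ≠ 0 := by
  have := hP.ne_smul_one 0
  rwa [zero_smul] at this

/-- Anticommuting reflections are the Pauli operators of some orthonormal basis. -/
theorem exists_inBasis (hP : IsReflection P) (hQ : IsReflection Q) (hPQ : P * Q = -(Q * P)) :
    ∃ U : Matrix.unitaryGroup (Fin 2) ℂ, inBasis U pauliZ = P ∧ inBasis U pauliX = Q := by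
  -- Every nonzero value of `1 + P` is fixed by `P`. Normalized, it is the first basis vector; its
  -- image under `Q`, on which `P` is `-1`, is the second.
  obtain ⟨w, hw0, hPw⟩ : ∃ w : Fin 2 → ℂ, w ≠ 0 ∧ P.mulVec w = w := by
    have h0 : 1 + P ≠ 0 := fun h => hP.ne_smul_one (-1) (by
      rw [neg_smul, one_smul]; exact (neg_eq_of_add_eq_zero_right h).symm)
    obtain ⟨v, hv⟩ : ∃ v, (1 + P).mulVec v ≠ 0 := by
      by_contra! hc
      exact h0 (Matrix.mulVec_injective (by ext1 v; simp [hc]))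
    refine ⟨_, hv, ?_⟩
    rw [Matrix.mulVec_mulVec, mul_add, hP.sq, mul_one, add_comm]
  set n : ℂ := star w ⬝ᵥ w with hn
  set d : ℝ := Complex.normSq (w 0) + Complex.normSq (w 1) with hdef
  have hd : n = d := by
    rw [hn, hdef]
    push_cast
    rw [← Complex.mul_conj, ← Complex.mul_conj]
    simp [dotProduct, mul_comm]
  have hd0 : 0 < d := by
    refine lt_of_le_of_ne (add_nonneg (Complex.normSq_nonneg _) (Complex.normSq_nonneg _)) ?_
    intro h
    apply hw0
    have h1 := Complex.normSq_nonneg (w 0)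
    have h2 := Complex.normSq_nonneg (w 1)
    have h3 : w 0 = 0 := Complex.normSq_eq_zero.1 (by linarith)
    have h4 : w 1 = 0 := Complex.normSq_eq_zero.1 (by linarith)
    ext1 i
    fin_cases i
    · exact h3
    · exact h4
  set s : ℂ := (((Real.sqrt d)⁻¹ : ℝ) : ℂ) with hs
  have hss : s * s * n = 1 := by
    rw [hs, hd]
    norm_cast
    rw [← mul_inv, Real.mul_self_sqrt hd0.le, inv_mul_cancel₀ hd0.ne']
  have hsstar : star s = s := by rw [hs]; exact Complex.conj_ofReal _
  set v : Fin 2 → ℂ := s • w with hv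
  have hPv : P.mulVec v = v := by rw [hv, Matrix.mulVec_smul, hPw]
  have hvv : star v ⬝ᵥ v = 1 := by
    rw [hv, star_smul, smul_dotProduct, dotProduct_smul, hsstar, smul_smul, smul_eq_mul, hss]
  set u : Fin 2 → ℂ := Q.mulVec v with hu
  have hPu : P.mulVec u = -u := by
    rw [hu, Matrix.mulVec_mulVec, hPQ, Matrix.neg_mulVec, ← Matrix.mulVec_mulVec, hPv]
  have hQu : Q.mulVec u = v := by
    rw [hu, Matrix.mulVec_mulVec, hQ.sq, Matrix.one_mulVec]
  have adj : ∀ {M : QubitOp}, M.IsHermitian → ∀ a b : Fin 2 → ℂ,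
      star (M.mulVec a) ⬝ᵥ b = star a ⬝ᵥ M.mulVec b := by
    intro M hM a b
    rw [Matrix.star_mulVec, hM.eq, Matrix.dotProduct_mulVec]
  have huu : star u ⬝ᵥ u = 1 := by
    conv_lhs => rw [hu]
    rw [adj hQ.herm, ← hu, hQu, hvv]
  have hvu : star v ⬝ᵥ u = 0 := by
    have h := adj hP.herm v u
    rw [hPv, hPu, dotProduct_neg] at h
    linear_combination h / 2
  have huv : star u ⬝ᵥ v = 0 := by
    have h := adj hP.herm u v
    rw [hPv, hPu, star_neg, neg_dotProduct] at h
    linear_combination -h / 2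
  set U : QubitOp := Matrix.of fun i j => if j = 0 then v i else u i with hU
  have hUU : star U * U = 1 := by
    simp only [dotProduct, Fin.sum_univ_two, Pi.star_apply] at hvv huu hvu huv
    ext i j
    fin_cases i <;> fin_cases j <;>
      simp [Matrix.mul_apply, Matrix.star_apply, hU] <;> assumption
  have hUZ : U * pauliZ = P * U := by
    have h0 := congrFun hPv
    have h1 := congrFun hPu
    simp only [Matrix.mulVec, dotProduct, Fin.sum_univ_two, Pi.neg_apply] at h0 h1
    ext i j
    fin_cases j <;> simp [Matrix.mul_apply, hU, pauliZ, h0, h1]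
  have hUX : U * pauliX = Q * U := by
    have h0 := congrFun hu.symm
    have h1 := congrFun hQu
    simp only [Matrix.mulVec, dotProduct, Fin.sum_univ_two] at h0 h1
    ext i j
    fin_cases j <;> simp [Matrix.mul_apply, hU, pauliX, h0, h1]
  have hUU' : U * star U = 1 := mul_eq_one_comm.1 hUU
  refine ⟨⟨U, Matrix.mem_unitaryGroup_iff.2 hUU'⟩, ?_, ?_⟩
  · rw [inBasis, hUZ, mul_assoc, hUU', mul_one]
  · rw [inBasis, hUX, mul_assoc, hUU', mul_one]

theorem exists_anticommuting (hP : IsReflection P) :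
    ∃ Q, IsReflection Q ∧ P * Q = -(Q * P) := by
  have h11 : P 1 1 = -P 0 0 := by
    have := hP.trace
    rw [Matrix.trace_fin_two] at this
    linear_combination this
  have h10 : P 1 0 = star (P 0 1) := (hP.herm.apply 1 0).symm
  -- `Q` is sought off-diagonal; its entry `z` is a unit complex number orthogonal to `P 0 1` in the
  -- plane.
  suffices ∃ z : ℂ, z * star z = 1 ∧ P 0 1 * star z + z * star (P 0 1) = 0 by
    obtain ⟨z, hz, hz'⟩ := this
    refine ⟨!![0, z; star z, 0], ⟨?_, ?_, ?_⟩, ?_⟩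
    · ext i j
      fin_cases i <;> fin_cases j <;> simp
    · ext i j
      have hz2 : star z * z = 1 := by rw [mul_comm, hz]
      fin_cases i <;> fin_cases j <;> simp [Matrix.mul_apply] <;> assumption
    · simp [Matrix.trace_fin_two]
    · ext i j
      rw [mul_comm z] at hz'
      fin_cases i <;> fin_cases j <;> simp [Matrix.mul_apply, Matrix.vecMul, dotProduct, h11, h10] at hz' ⊢ <;>
        first | ring1 | linear_combination hz'
  by_cases h0 : P 0 1 = 0
  · exact ⟨1, by simp, by simp [h0]⟩
  · have hn : ((‖P 0 1‖ : ℝ) : ℂ) ≠ 0 := by exact_mod_cast norm_ne_zero_iff.2 h0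
    have hc : P 0 1 * star (P 0 1) = (‖P 0 1‖ : ℝ) ^ 2 := Complex.mul_conj' _
    refine ⟨Complex.I * P 0 1 / (‖P 0 1‖ : ℝ), ?_, ?_⟩
    · have : star (Complex.I * P 0 1 / (‖P 0 1‖ : ℝ)) =
          -Complex.I * star (P 0 1) / (‖P 0 1‖ : ℝ) := by simp
      rw [this]
      field_simp
      rw [mul_assoc, hc]
      linear_combination (-(‖P 0 1‖ : ℂ) ^ 2) * Complex.I_sq
    · have : star (Complex.I * P 0 1 / (‖P 0 1‖ : ℝ)) =
          -Complex.I * star (P 0 1) / (‖P 0 1‖ : ℝ) := by simp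
      rw [this]
      ring

/-- The identity, two anticommuting reflections and their product span all operators. -/
theorem exists_eq_combination (hP : IsReflection P) (hQ : IsReflection Q)
    (hPQ : P * Q = -(Q * P)) (m : QubitOp) :
    ∃ a b c d : ℂ, m = a • 1 + b • P + c • Q + d • (P * Q) := by
  obtain ⟨U, rfl, rfl⟩ := hP.exists_inBasis hQ hPQ
  have h1 : star (U : QubitOp) * (U : QubitOp) = 1 := Matrix.mem_unitaryGroup_iff'.1 U.2
  have h2 : (U : QubitOp) * star (U : QubitOp) = 1 := Matrix.mem_unitaryGroup_iff.1 U.2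
  set n : QubitOp := star (U : QubitOp) * m * (U : QubitOp) with hn
  have hm : m = (U : QubitOp) * n * star (U : QubitOp) := by
    rw [hn]
    simp only [mul_assoc, h2, mul_one]
    rw [← mul_assoc, h2, one_mul]
  have hpr : inBasis U pauliZ * inBasis U pauliX = inBasis U (pauliZ * pauliX) := by
    simp only [inBasis, mul_assoc]
    rw [← mul_assoc (star (U : QubitOp)) (U : QubitOp), h1, one_mul]
  have hone : (1 : QubitOp) = inBasis U 1 := by rw [inBasis, mul_one, h2]
  refine ⟨(n 0 0 + n 1 1) / 2, (n 0 0 - n 1 1) / 2, (n 0 1 + n 1 0) / 2, (n 0 1 - n 1 0) / 2, ?_⟩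
  rw [hpr, hone]
  rw [hm]
  simp only [inBasis, ← smul_mul_assoc, ← add_mul]
  congr 2
  ext i j
  fin_cases i <;> fin_cases j <;> simp [pauliX, pauliZ, Matrix.mul_apply] <;> ring

/-- The components of `m` along `Q` and `P * Q` anticommute with `P` and must vanish; traces read
off the other two. -/
theorem eq_of_commute (hP : IsReflection P) {m : QubitOp} (h : Commute P m) :
    m = (m.trace / 2) • 1 + ((P * m).trace / 2) • P := by
  obtain ⟨Q, hQ, hPQ⟩ := hP.exists_anticommuting
  obtain ⟨a, b, c, d, rfl⟩ := hP.exists_eq_combination hQ hPQ m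
  have hz : (c • Q + d • (P * Q)) = 0 := by
    have h1 := h.eq
    have h2 : P * (P * Q) = Q := by rw [← mul_assoc, hP.sq, one_mul]
    have h3 : P * Q * P = -Q := by rw [hPQ, neg_mul, mul_assoc, hP.sq, mul_one]
    have h4 : Q * P = -(P * Q) := by rw [hPQ, neg_neg]
    simp only [mul_add, add_mul, mul_smul_comm, smul_mul_assoc, mul_one, one_mul, h2, h3, h4,
      smul_neg] at h1
    have h5 : (2 : ℂ) • (c • (P * Q) + d • Q) = 0 := by
      rw [two_smul]
      rw [← sub_eq_zero] at h1
      rw [← h1]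
      abel
    have h6 := (smul_eq_zero.1 h5).resolve_left two_ne_zero
    have h7 := congrArg (P * ·) h6
    simpa only [mul_add, mul_smul_comm, h2, mul_zero] using h7
  rw [add_assoc _ (c • Q), hz, add_zero]
  simp only [mul_add, mul_smul_comm, mul_one, hP.sq, Matrix.trace_add, Matrix.trace_smul,
    hP.trace, Matrix.trace_one]
  simp

theorem exists_eq_of_commute (hP : IsReflection P) {m : QubitOp} (h : Commute P m) :
    ∃ a b : ℂ, m = a • 1 + b • P := ⟨_, _, hP.eq_of_commute h⟩

/-- Whatever commutes with a non-scalar operator that commutes with `P` commutes with `P`. -/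
theorem commute_of_commute (hP : IsReflection P) {m n : QubitOp} (h : Commute P m)
    (h0 : ∀ c : ℂ, m ≠ c • 1) (hmn : Commute m n) : Commute P n := by
  obtain ⟨a, b, rfl⟩ := hP.exists_eq_of_commute h
  have hb : b ≠ 0 := by
    rintro rfl
    exact h0 a (by simp)
  have : Commute (b⁻¹ • (a • 1 + b • P - a • 1)) n :=
    (hmn.sub_left ((Commute.one_left n).smul_left a)).smul_left _
  rwa [add_sub_cancel_left, smul_smul, inv_mul_cancel₀ hb, one_smul] at this

theorem eq_or_eq_neg_of_commute (hP : IsReflection P) (hQ : IsReflection Q) (h : Commute P Q) :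
    Q = P ∨ Q = -P := by
  have h1 := hP.eq_of_commute h
  rw [hQ.trace, zero_div, zero_smul, zero_add] at h1
  set b := (P * Q).trace / 2
  have h2 := hQ.sq
  rw [h1, smul_mul_smul_comm, hP.sq, ← sub_eq_zero] at h2
  have h3 : (b * b - 1) • (1 : QubitOp) = 0 := by rw [sub_smul, one_smul, h2]
  have h4 := (smul_eq_zero.1 h3).resolve_right one_ne_zero
  have h5 : (b - 1) * (b + 1) = 0 := by linear_combination h4
  rcases mul_eq_zero.1 h5 with h | h
  · left; rw [h1, sub_eq_zero.1 h, one_smul]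
  · right; rw [h1, eq_neg_of_add_eq_zero_left h, neg_one_smul]

/-- A non-scalar operator commuting with both would make `P` and `Q` commute, but they anticommute
and are invertible. -/
theorem eq_smul_one_of_commute (hP : IsReflection P) (hQ : IsReflection Q)
    (hPQ : P * Q = -(Q * P)) {m : QubitOp} (h : Commute P m) (h' : Commute Q m) :
    ∃ c : ℂ, m = c • 1 := by
  by_contra! hc
  have h1 := hP.commute_of_commute h hc h'.symm
  have h2 : (2 : ℂ) • (P * Q) = 0 := by
    rw [two_smul]
    nth_rewrite 1 [hPQ]
    rw [h1.eq, neg_add_cancel]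
  have h3 := (smul_eq_zero.1 h2).resolve_left two_ne_zero
  have h4 := congrArg (P * ·) h3
  simp only [← mul_assoc, hP.sq, one_mul, mul_zero] at h4
  exact hQ.ne_zero h4

/-- If `n` anticommutes with `P` and with an operator `m` that anticommutes with `Q` and does not
commute with `P`, then `n` commutes with `Q`. -/
theorem commute_of_anticommute (hP : IsReflection P) (hQ : IsReflection Q)
    (hPQ : P * Q = -(Q * P)) {m n : QubitOp} (hm : Q * m = -(m * Q)) (hmP : ¬ Commute m P)
    (hn : n * P = -(P * n)) (hmn : n * m = -(m * n)) : Commute Q n := by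
  -- The signs cancel in pairs, so `P * m` commutes with `Q` and with `n`; it is not scalar, since
  -- `m` is not a multiple of `P`.
  have hQPm : Q * (P * m) = (P * m) * Q := by
    rw [mul_assoc, ← neg_eq_iff_eq_neg.2 hm, mul_neg, ← mul_assoc, ← mul_assoc, hPQ, neg_mul,
      neg_neg]
  have hnPm : n * (P * m) = (P * m) * n := by
    rw [← mul_assoc, hn, neg_mul, mul_assoc, hmn, mul_neg, neg_neg, mul_assoc]
  refine hQ.commute_of_commute (m := P * m) hQPm ?_ (Commute.symm hnPm)
  intro c hc
  apply hmP
  have : m = c • P := by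
    rw [← one_mul m, ← hP.sq, mul_assoc, hc, mul_smul_comm, mul_one]
  rw [this]
  exact (Commute.refl P).smul_left c

/-- The anticommutator of two reflections is a scalar. -/
theorem anticommutator_eq (hP : IsReflection P) (hQ : IsReflection Q) :
    P * Q + Q * P = ((P * Q).trace) • 1 := by
  obtain ⟨R, hR, hPR⟩ := hP.exists_anticommuting
  -- `Q` is traceless, so it has no identity component, and its components along `R` and `P * R`
  -- anticommute with `P`.
  obtain ⟨a, b, c, d, rfl⟩ := hP.exists_eq_combination hR hPR Q
  have ht := hQ.trace
  have hPR0 : (P * R).trace = 0 := by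
    have := congrArg Matrix.trace hPR
    rw [Matrix.trace_neg, Matrix.trace_mul_comm R P] at this
    linear_combination this / 2
  simp only [Matrix.trace_add, Matrix.trace_smul, hP.trace, hR.trace, hPR0, smul_zero,
    add_zero, Matrix.trace_one, Fintype.card_fin] at ht
  have ha : a = 0 := by simpa using ht
  subst ha
  have h2 : P * (P * R) = R := by rw [← mul_assoc, hP.sq, one_mul]
  have h3 : P * R * P = -R := by rw [hPR, neg_mul, mul_assoc, hP.sq, mul_one]
  have h4 : R * P = -(P * R) := by rw [hPR, neg_neg]
  simp only [zero_smul, zero_add, mul_add, add_mul, mul_smul_comm, smul_mul_assoc, hP.sq, h2, h3,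
    h4, Matrix.trace_add, Matrix.trace_smul, hR.trace, hPR0, smul_zero, add_zero,
    Matrix.trace_one, Fintype.card_fin]
  have : (b • ((2 : ℕ) : ℂ)) • (1 : QubitOp) = b • 1 + b • 1 := by
    rw [← add_smul]; congr 1; simp [mul_two]
  rw [this]
  simp only [smul_neg]
  abel

end IsReflection

/-! ### Splitting a commuting pair at a shared qubit -/

section Splitting

variable {E : Type*} [Fintype E] [DecidableEq E]

theorem isHermitian_siteOp_mul {q : E} {Z : QubitOp} (hZ : IsReflection Z) {A : QOp E}
    (hA : A.IsHermitian) (hZA : Commute (siteOp q Z) A) : (siteOp q Z * A).IsHermitian := by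
  rw [Matrix.IsHermitian, Matrix.conjTranspose_mul, siteOp_conjTranspose, hA.eq, hZ.herm.eq,
    hZA.eq]

/-- The part of `A` that goes with `Z` at the qubit `q`. -/
noncomputable def reflectionPart (q : E) (Z : QubitOp) (A : QOp E) : QOp E :=
  partialTrace q (siteOp q Z * A)

theorem trivialAt_reflectionPart_self (q : E) (Z : QubitOp) (A : QOp E) :
    TrivialAt (reflectionPart q Z A) q := trivialAt_partialTrace_self _ _

theorem TrivialAt.reflectionPart {A : QOp E} {e : E} (hA : TrivialAt A e) (q : E) (Z : QubitOp) :
    TrivialAt (reflectionPart q Z A) e := by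
  rcases eq_or_ne e q with rfl | he
  · exact trivialAt_reflectionPart_self _ _ _
  · exact ((trivialAt_siteOp he Z).mul hA).partialTrace q

/-- Every coefficient at `q` commutes with `Z`, so it lies in the span of `1` and `Z`. -/
theorem eq_partialTrace_add {q : E} {Z : QubitOp} (hZ : IsReflection Z) {A : QOp E}
    (hZA : Commute (siteOp q Z) A) :
    A = partialTrace q A + siteOp q Z * reflectionPart q Z A := by
  refine block_ext q fun x y => ?_
  rw [reflectionPart, block_add, block_siteOp_mul, block_partialTrace, block_partialTrace,
    block_siteOp_mul, mul_smul_comm, mul_one]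
  exact hZ.eq_of_commute (commute_siteOp_iff.1 hZA x y)

theorem siteOp_mul_siteOp_self {Z : QubitOp} (hZ : IsReflection Z) (q : E) :
    siteOp q Z * siteOp q Z = 1 := by rw [← siteOp_mul, hZ.sq, siteOp_one]

theorem reflectionPart_ne_zero {q : E} {Z : QubitOp} (hZ : IsReflection Z) {A : QOp E}
    (hZA : Commute (siteOp q Z) A) (hA : ¬ TrivialAt A q) : reflectionPart q Z A ≠ 0 := by
  intro h
  apply hA
  rw [eq_partialTrace_add hZ hZA, h, mul_zero, add_zero]
  exact trivialAt_partialTrace_self _ _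

/-- Commutation relations between the parts of two commuting operators of the form
`a₀ + Z a₁` and `b₀ + W b₁`. -/
theorem commutation_of_split {R : Type*} [Ring R] [Algebra ℂ R] {Z W a₀ a₁ b₀ b₁ : R} {c : ℂ}
    (hZ : Z * Z = 1) (hW : W * W = 1) (hc : Z * W + W * Z = c • 1) (hc2 : c * c ≠ 4)
    (ha₀Z : Commute Z a₀) (ha₀W : Commute W a₀) (ha₁Z : Commute Z a₁) (ha₁W : Commute W a₁)
    (hb₀Z : Commute Z b₀) (hb₀W : Commute W b₀) (hb₁Z : Commute Z b₁) (hb₁W : Commute W b₁)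
    (h : Commute (a₀ + Z * a₁) (b₀ + W * b₁)) :
    a₁ * b₁ = -(b₁ * a₁) ∧ Commute a₀ b₁ ∧ a₀ * b₀ - b₀ * a₀ = -(c • (a₁ * b₁)) := by
  -- `K²` is a nonzero scalar, so multiplication by `K` is injective. `K` anticommutes with `Z` and
  -- `W` and commutes with all four parts.
  set K := Z * W - W * Z with hK
  have hKK : K * K = (c * c - 4) • 1 := by
    have h1 : Z * W = c • 1 - W * Z := eq_sub_of_add_eq hc
    have h2 : W * Z * (W * Z) = c • (W * Z) - 1 := by
      have : W * Z * (W * Z) = W * (Z * W) * Z := by noncomm_ring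
      rw [this, h1, mul_sub, sub_mul, mul_smul_comm, mul_one, smul_mul_assoc]
      congr 1
      rw [← mul_assoc, hW, one_mul, hZ]
    have h3 : K = c • 1 - (2 : ℂ) • (W * Z) := by
      rw [hK, h1, two_smul]; abel
    rw [h3, sub_mul, mul_sub, mul_sub]
    simp only [smul_mul_assoc, mul_smul_comm, one_mul, mul_one, h2, smul_sub, smul_smul, sub_smul]
    have : (2 * (2 * c) : ℂ) • (W * Z) = (c * 2) • (W * Z) + (2 * c) • (W * Z) := by
      rw [← add_smul]; congr 1; ring
    rw [this]
    have h4 : (2 * 2 : ℂ) = 4 := by norm_num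
    rw [h4]
    abel
  have hK0 : ∀ x : R, K * x = 0 → x = 0 := by
    intro x hx
    have : (c * c - 4) • x = 0 := by
      rw [← one_mul x, ← smul_mul_assoc, ← hKK, mul_assoc, hx, mul_zero]
    exact (smul_eq_zero.1 this).resolve_left (sub_ne_zero.2 hc2)
  have hZK : Z * K = -(K * Z) := by
    rw [hK, mul_sub, sub_mul]
    have e1 : Z * (Z * W) = W * Z * Z := by rw [← mul_assoc, hZ, mul_assoc, hZ, one_mul, mul_one]
    rw [e1]
    noncomm_ring
  have hKW : K * W = -(W * K) := by
    rw [hK, mul_sub, sub_mul]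
    have e1 : Z * W * W = W * (W * Z) := by rw [← mul_assoc, hW, mul_assoc, hW, one_mul, mul_one]
    rw [e1]
    noncomm_ring
  have hKr : ∀ {x : R}, Commute Z x → Commute W x → Commute K x := fun h1 h2 =>
    (h1.mul_left h2).sub_left (h2.mul_left h1)
  have hZA : Commute Z (a₀ + Z * a₁) := ha₀Z.add_right ((Commute.refl Z).mul_right ha₁Z)
  -- `K * b₁` is the commutator of `Z` with `b₀ + W * b₁`, and `a₀ + Z * a₁` commutes with both of
  -- these.
  have h1 : Commute (a₀ + Z * a₁) (K * b₁) := by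
    have e : K * b₁ = Z * (b₀ + W * b₁) - (b₀ + W * b₁) * Z := by
      rw [hK, mul_add, add_mul, hb₀Z.eq, mul_assoc W b₁ Z, ← hb₁Z.eq]
      noncomm_ring
    rw [e]
    exact (hZA.symm.mul_right h).sub_right (h.mul_right hZA.symm)
  have h2 : K * (a₀ * b₁ - b₁ * a₀ - Z * (a₁ * b₁ + b₁ * a₁)) = 0 := by
    have e1 : (a₀ + Z * a₁) * (K * b₁) = K * (a₀ * b₁ - Z * (a₁ * b₁)) := by
      have e2 : Z * a₁ * (K * b₁) = -(K * Z * (a₁ * b₁)) := by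
        rw [mul_assoc, ← mul_assoc a₁, ← (hKr ha₁Z ha₁W).eq, mul_assoc K, ← mul_assoc Z, hZK,
          neg_mul]
      rw [add_mul, e2, ← mul_assoc a₀, ← (hKr ha₀Z ha₀W).eq]
      noncomm_ring
    have e3 : K * b₁ * (a₀ + Z * a₁) = K * (b₁ * a₀ + Z * (b₁ * a₁)) := by
      rw [mul_assoc, mul_add, ← mul_assoc b₁ Z, ← hb₁Z.eq, mul_assoc Z]
    have := h1.eq
    rw [e1, e3, ← sub_eq_zero] at this
    rw [← this]
    noncomm_ring
  have h3 := hK0 _ h2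
  -- `Z` times this anticommutator is the commutator of `a₀` and `b₁`. That commutes with `W`, and
  -- so does the anticommutator, hence `[Z, W]` annihilates it.
  have h4 : K * (a₁ * b₁ + b₁ * a₁) = 0 := by
    have e1 : Z * (a₁ * b₁ + b₁ * a₁) = a₀ * b₁ - b₁ * a₀ := (sub_eq_zero.1 h3).symm
    have e2 : Commute W (a₀ * b₁ - b₁ * a₀) :=
      (ha₀W.mul_right hb₁W).sub_right (hb₁W.mul_right ha₀W)
    have e3 : Commute W (a₁ * b₁ + b₁ * a₁) :=
      (ha₁W.mul_right hb₁W).add_right (hb₁W.mul_right ha₁W)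
    have e4 := e2.eq
    rw [← e1, mul_assoc, ← e3.eq, ← mul_assoc, ← mul_assoc, ← sub_eq_zero, ← sub_mul] at e4
    rw [hK, ← neg_eq_zero, ← neg_mul, neg_sub, e4]
  have h5 := hK0 _ h4
  have h6 : a₁ * b₁ = -(b₁ * a₁) := eq_neg_of_add_eq_zero_left h5
  have h7 : Commute a₀ b₁ := by
    rw [h5, mul_zero, sub_zero] at h3
    exact sub_eq_zero.1 h3
  refine ⟨h6, h7, ?_⟩
  have h1' : Commute (b₀ + W * b₁) (K * a₁) := by
    have e : K * a₁ = (a₀ + Z * a₁) * W - W * (a₀ + Z * a₁) := by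
      rw [hK, mul_add, add_mul, ha₀W.eq, mul_assoc Z a₁ W, ← ha₁W.eq]
      noncomm_ring
    have hWB : Commute W (b₀ + W * b₁) := hb₀W.add_right ((Commute.refl W).mul_right hb₁W)
    rw [e]
    exact (h.symm.mul_right hWB.symm).sub_right (hWB.symm.mul_right h.symm)
  have h8 : Commute b₀ a₁ := by
    have e1 : (b₀ + W * b₁) * (K * a₁) = K * (b₀ * a₁ - W * (b₁ * a₁)) := by
      have e2 : W * b₁ * (K * a₁) = -(K * W * (b₁ * a₁)) := by
        rw [mul_assoc, ← mul_assoc b₁, ← (hKr hb₁Z hb₁W).eq, mul_assoc K, ← mul_assoc W,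
          hKW, neg_mul, neg_neg]
      rw [add_mul, e2, ← mul_assoc b₀, ← (hKr hb₀Z hb₀W).eq]
      noncomm_ring
    have e3 : K * a₁ * (b₀ + W * b₁) = K * (a₁ * b₀ + W * (a₁ * b₁)) := by
      rw [mul_assoc, mul_add, ← mul_assoc a₁ W, ← ha₁W.eq, mul_assoc W]
    have e4 := h1'.eq
    rw [e1, e3, h6, ← sub_eq_zero, ← mul_sub] at e4
    have e5 := hK0 _ e4
    have : b₀ * a₁ - W * (b₁ * a₁) - (a₁ * b₀ + W * -(b₁ * a₁)) = b₀ * a₁ - a₁ * b₀ := by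
      noncomm_ring
    rw [this] at e5
    exact sub_eq_zero.1 e5
  have h9 := h.eq
  have e1 : (a₀ + Z * a₁) * (b₀ + W * b₁) =
      a₀ * b₀ + W * (a₀ * b₁) + Z * (a₁ * b₀) + Z * W * (a₁ * b₁) := by
    rw [add_mul, mul_add, mul_add, ← mul_assoc a₀ W, ← ha₀W.eq, mul_assoc Z a₁ (W * b₁),
      ← mul_assoc a₁ W, ← ha₁W.eq]
    noncomm_ring
  have e2 : (b₀ + W * b₁) * (a₀ + Z * a₁) =
      b₀ * a₀ + W * (b₁ * a₀) + Z * (b₀ * a₁) + W * Z * (b₁ * a₁) := by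
    rw [add_mul, mul_add, mul_add, ← mul_assoc b₀ Z, ← hb₀Z.eq, mul_assoc W b₁ (Z * a₁),
      ← mul_assoc b₁ Z, ← hb₁Z.eq]
    noncomm_ring
  have e3 : b₁ * a₁ = -(a₁ * b₁) := by rw [h6, neg_neg]
  rw [e1, e2, ← h7.eq, h8.eq, e3, ← sub_eq_zero] at h9
  have e4 : c • (a₁ * b₁) = Z * W * (a₁ * b₁) + W * Z * (a₁ * b₁) := by
    rw [← add_mul, hc, smul_mul_assoc, one_mul]
  rw [e4, ← sub_eq_zero, ← h9]
  noncomm_ring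

open scoped ComplexOrder in
/-- Reflections that do not commute have an anticommutator different from `± 2`. -/
theorem IsReflection.trace_mul_self_ne {Z W : QubitOp} (hZ : IsReflection Z)
    (hW : IsReflection W) (hZW : ¬ Commute Z W) : (Z * W).trace * (Z * W).trace ≠ 4 := by
  intro h
  apply hZW
  set c := (Z * W).trace with hc
  have hac : Z * W + W * Z = c • 1 := hZ.anticommutator_eq hW
  -- If `c² = 4`, this operator has square zero and is hermitian, hence vanishes, and `W` is a
  -- multiple of `Z`.
  have hN : ((c / 2) • Z - W) * ((c / 2) • Z - W) = 0 := by
    rw [sub_mul, mul_sub, mul_sub, smul_mul_smul_comm, hZ.sq, hW.sq, smul_mul_assoc,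
      mul_smul_comm]
    have : (c / 2 * (c / 2)) • (1 : QubitOp) - (c / 2) • (Z * W) - ((c / 2) • (W * Z) - 1) =
        (c / 2 * (c / 2) + 1) • (1 : QubitOp) - (c / 2) • (Z * W + W * Z) := by
      rw [add_smul, smul_add, one_smul]; abel
    rw [this, hac, smul_smul, ← sub_smul]
    have : c / 2 * (c / 2) + 1 - c / 2 * c = 0 := by linear_combination -h / 4
    rw [this, zero_smul]
  have hreal : star c = c := by
    have h1 : (Z * W).conjTranspose = W * Z := by
      rw [Matrix.conjTranspose_mul, hZ.herm.eq, hW.herm.eq]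
    have h2 := Matrix.trace_conjTranspose (Z * W)
    rw [h1, Matrix.trace_mul_comm] at h2
    exact h2.symm
  have hH : ((c / 2) • Z - W).conjTranspose = (c / 2) • Z - W := by
    rw [Matrix.conjTranspose_sub, Matrix.conjTranspose_smul, hZ.herm.eq, hW.herm.eq]
    congr 2
    rw [star_div₀, hreal]
    simp
  have h0 : (c / 2) • Z - W = 0 := by
    rw [← Matrix.conjTranspose_mul_self_eq_zero, hH, hN]
  rw [← sub_eq_zero.1 h0]
  exact (Commute.refl Z).smul_right _

/-- A pair of commuting operators that share the qubits `q`, `q'` only and are, at `q`, in the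
algebras generated by reflections `Z` and `W`; the reflections `P`, `Q` at `q'` describe them
there. -/
structure PairSplit (A B : QOp E) (q q' : E) (Z W P Q : QubitOp) : Prop where
  anti : reflectionPart q Z A * reflectionPart q W B =
    -(reflectionPart q W B * reflectionPart q Z A)
  comm_left : Commute (partialTrace q A) (reflectionPart q W B)
  comm_right : Commute (partialTrace q B) (reflectionPart q Z A)
  commutator : partialTrace q A * partialTrace q B - partialTrace q B * partialTrace q A =
    -((Z * W).trace • (reflectionPart q Z A * reflectionPart q W B))
  reflP : IsReflection P
  reflQ : IsReflection Q
  antiPQ : P * Q = -(Q * P)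
  P_right : siteOp q' P * reflectionPart q W B = -(reflectionPart q W B * siteOp q' P)
  P_trace : Commute (siteOp q' P) (partialTrace q B)
  Q_left : siteOp q' Q * reflectionPart q Z A = -(reflectionPart q Z A * siteOp q' Q)
  Q_trace : Commute (siteOp q' Q) (partialTrace q A)
  comm_P : ∀ m, Commute (siteOp q' m) A → Commute m P
  comm_Q : ∀ m, Commute (siteOp q' m) B → Commute m Q
  cancel : ∀ G, (∀ e, e ≠ q' → TrivialAt (reflectionPart q W B) e ∨ TrivialAt G e) →
    reflectionPart q W B * G = 0 → G = 0

end Splitting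

/-- `m` is a combination of two hermitian elements of `S`, and `f` cannot vanish on both. -/
theorem QubitOp.exists_isHermitian {S : Submodule ℂ QubitOp}
    (hS : ∀ m ∈ S, m.conjTranspose ∈ S) (f : QubitOp →ₗ[ℂ] QubitOp) {m : QubitOp} (hm : m ∈ S)
    (hf : f m ≠ 0) : ∃ h ∈ S, h.IsHermitian ∧ f h ≠ 0 := by
  by_contra! hc
  have h1 := hc (m + m.conjTranspose) (S.add_mem hm (hS m hm))
    (by rw [Matrix.IsHermitian, Matrix.conjTranspose_add, Matrix.conjTranspose_conjTranspose,
      add_comm])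
  have h2 := hc (Complex.I • (m - m.conjTranspose))
    (S.smul_mem _ (S.sub_mem hm (hS m hm)))
    (by rw [Matrix.IsHermitian, Matrix.conjTranspose_smul, Matrix.conjTranspose_sub,
      Matrix.conjTranspose_conjTranspose, ← neg_sub, smul_neg, ← neg_smul]; simp)
  rw [map_smul] at h2
  have h3 := (smul_eq_zero.1 h2).resolve_left Complex.I_ne_zero
  apply hf
  have h4 : (2 : ℂ) • f m = f (m + m.conjTranspose) + f (m - m.conjTranspose) := by
    rw [← map_add, ← map_smul, two_smul]
    congr 1
    abel
  rw [h1, h3, add_zero] at h4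
  exact (smul_eq_zero.1 h4).resolve_left two_ne_zero

/-! ### The reflections at the second shared qubit -/

section PairSplit

variable {E : Type*} [DecidableEq E]

/-- The span of the coefficients of `h` at the qubit `q`. -/
def blockSpan (q : E) (h : QOp E) : Submodule ℂ QubitOp :=
  Submodule.span ℂ {m | ∃ x y, m = block q x y h}

theorem block_mem_blockSpan (q : E) (h : QOp E) (x y : E → Fin 2) :
    block q x y h ∈ blockSpan q h := Submodule.subset_span ⟨x, y, rfl⟩
theorem conjTranspose_mem_blockSpan {q : E} {h : QOp E} (hh : h.IsHermitian) :
    ∀ m ∈ blockSpan q h, m.conjTranspose ∈ blockSpan q h := by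
  intro m hm
  induction hm using Submodule.span_induction with
  | mem m hm =>
    obtain ⟨x, y, rfl⟩ := hm
    rw [← block_conjTranspose, hh.eq]
    exact block_mem_blockSpan q h y x
  | zero => rw [Matrix.conjTranspose_zero]; exact Submodule.zero_mem _
  | add a b _ _ ha hb => rw [Matrix.conjTranspose_add]; exact Submodule.add_mem _ ha hb
  | smul c a _ ha => rw [Matrix.conjTranspose_smul]; exact Submodule.smul_mem _ _ ha

theorem exists_mem_blockSpan_ne_zero {h : QOp E} (h0 : h ≠ 0) (q : E) :
    ∃ m ∈ blockSpan q h, m ≠ 0 := by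
  by_contra! hc
  exact h0 (block_ext q fun x y => hc _ (block_mem_blockSpan q h x y))

variable [Fintype E]

theorem smul_siteOp_mul_of_mem_blockSpan {q : E} {g h : QOp E} {a b : ℂ}
    (hgh : a • (g * h) = b • (h * g))
    (H : ∀ e, e ≠ q → TrivialAt g e ∨ TrivialAt h e) {m : QubitOp} (hm : m ∈ blockSpan q g) :
    a • (siteOp q m * h) = b • (h * siteOp q m) := by
  induction hm using Submodule.span_induction with
  | mem m hm =>
    obtain ⟨x, y, rfl⟩ := hm
    exact smul_siteOp_block_mul hgh H x y
  | zero => simp [siteOp_zero]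
  | add m n _ _ hm hn => simp only [siteOp_add, add_mul, mul_add, smul_add, hm, hn]
  | smul c m _ hm =>
    simp only [siteOp_smul, smul_mul_assoc, mul_smul_comm]
    rw [smul_comm a, hm, smul_comm b]

theorem smul_mul_of_mem_blockSpan {q : E} {h : QOp E} {a b : ℂ} {m : QubitOp}
    (H : a • (siteOp q m * h) = b • (h * siteOp q m)) {n : QubitOp} (hn : n ∈ blockSpan q h) :
    a • (m * n) = b • (n * m) := by
  induction hn using Submodule.span_induction with
  | mem n hn =>
    obtain ⟨x, y, rfl⟩ := hn
    exact smul_siteOp_mul_iff.1 H x y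
  | zero => simp
  | add n n' _ _ hm hn => simp only [add_mul, mul_add, smul_add, hm, hn]
  | smul c m _ hm =>
    simp only [smul_mul_assoc, mul_smul_comm]
    rw [smul_comm a, hm, smul_comm b]

theorem commute_of_mem_blockSpan {q : E} {h : QOp E} {m n : QubitOp}
    (H : Commute (siteOp q m) h) (hn : n ∈ blockSpan q h) : Commute m n := by
  have := smul_mul_of_mem_blockSpan (a := 1) (b := 1) (by rw [H.eq]) hn
  rwa [one_smul, one_smul] at this

theorem commute_siteOp_of_mem_blockSpan {q : E} {g h : QOp E} (hgh : Commute g h)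
    (H : ∀ e, e ≠ q → TrivialAt g e ∨ TrivialAt h e) {m : QubitOp} (hm : m ∈ blockSpan q g) :
    Commute (siteOp q m) h := by
  have := smul_siteOp_mul_of_mem_blockSpan (a := 1) (b := 1) (by rw [hgh.eq]) H hm
  rwa [one_smul, one_smul] at this

theorem eq_smul_one_of_mem_blockSpan {q : E} {h : QOp E} (hh : TrivialAt h q) {m : QubitOp}
    (hm : m ∈ blockSpan q h) : ∃ c : ℂ, m = c • 1 :=
  ⟨_, QubitOp.eq_smul_one_of_forall_commute fun n => commute_of_mem_blockSpan (hh n) hm⟩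

theorem commute_siteOp_of_split {A : QOp E} {q q' : E} (hqq' : q ≠ q') {Z P : QubitOp}
    (hZ : IsReflection Z) (hZA : Commute (siteOp q Z) A)
    (h0 : Commute (siteOp q' P) (partialTrace q A))
    (h1 : Commute (siteOp q' P) (reflectionPart q Z A)) : Commute (siteOp q' P) A := by
  rw [eq_partialTrace_add hZ hZA]
  exact h0.add_right ((siteOp_commute hqq'.symm P Z).mul_right h1)

theorem commute_siteOp_reflectionPart {A : QOp E} {q q' : E} (hqq' : q ≠ q') {Z m : QubitOp}
    (h : Commute (siteOp q' m) A) : Commute (siteOp q' m) (reflectionPart q Z A) :=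
  ((siteOp_commute hqq'.symm m Z).mul_right h).partialTrace_right (trivialAt_siteOp hqq' m)

/-- The parts `a₁`, `b₁` anticommute and share only `q'`, so their coefficients there anticommute.
If two of them have a nonzero product, hermitian ones can be found that are traceless, hence
multiples of `P` and `Q`. If all products vanish, a coefficient of `a₁` gives a reflection commuting
with both `A` and `B`, against `hnc`. -/
theorem exists_pairSplit {A B : QOp E} {q q' : E} (hqq' : q ≠ q') {Z W : QubitOp}
    (hZ : IsReflection Z) (hW : IsReflection W) (hZW : ¬ Commute Z W)
    (hA : A.IsHermitian) (hB : B.IsHermitian) (hAB : Commute A B)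
    (hZA : Commute (siteOp q Z) A) (hWB : Commute (siteOp q W) B)
    (hAq : ¬ TrivialAt A q) (hBq : ¬ TrivialAt B q)
    (hsupp : ∀ e, e ≠ q → e ≠ q' → TrivialAt A e ∨ TrivialAt B e)
    (hnc : ∀ P, IsReflection P → Commute (siteOp q' P) A → Commute (siteOp q' P) B →
      ¬ TrivialAt A q' → ¬ TrivialAt B q' → False) :
    ∃ P Q, PairSplit A B q q' Z W P Q := by
  have hsum : siteOp q Z * siteOp q W + siteOp q W * siteOp q Z =
      ((Z * W).trace) • (1 : QOp E) := by
    rw [← siteOp_mul, ← siteOp_mul, ← siteOp_add, hZ.anticommutator_eq hW, siteOp_smul_one]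
  have ht := hZ.trace_mul_self_ne hW hZW
  have ta₀ := trivialAt_partialTrace_self q A
  have ta₁ := trivialAt_reflectionPart_self q Z A
  have tb₀ := trivialAt_partialTrace_self q B
  have tb₁ := trivialAt_reflectionPart_self q W B
  have eA := eq_partialTrace_add hZ hZA
  have eB := eq_partialTrace_add hW hWB
  obtain ⟨anti, comm_left, commutator⟩ := commutation_of_split
    (siteOp_mul_siteOp_self hZ q) (siteOp_mul_siteOp_self hW q) hsum ht
    (ta₀ Z) (ta₀ W) (ta₁ Z) (ta₁ W) (tb₀ Z) (tb₀ W) (tb₁ Z) (tb₁ W)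
    (by rwa [← eA, ← eB])
  obtain ⟨-, comm_right, -⟩ := commutation_of_split
    (siteOp_mul_siteOp_self hW q) (siteOp_mul_siteOp_self hZ q) (by rw [add_comm]; exact hsum) ht
    (tb₀ W) (tb₀ Z) (tb₁ W) (tb₁ Z) (ta₀ W) (ta₀ Z) (ta₁ W) (ta₁ Z)
    (by rw [← eA, ← eB]; exact hAB.symm)
  set a₀ := partialTrace q A with ha₀
  set a₁ := reflectionPart q Z A with ha₁
  set b₀ := partialTrace q B with hb₀
  set b₁ := reflectionPart q W B with hb₁
  have s11 : ∀ e, e ≠ q' → TrivialAt a₁ e ∨ TrivialAt b₁ e := fun e he => by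
    rcases eq_or_ne e q with rfl | h
    · exact Or.inl ta₁
    · exact (hsupp e h he).imp (fun h => h.reflectionPart q Z) fun h => h.reflectionPart q W
  have s01 : ∀ e, e ≠ q' → TrivialAt b₁ e ∨ TrivialAt a₀ e := fun e he => by
    rcases eq_or_ne e q with rfl | h
    · exact Or.inr ta₀
    · exact ((hsupp e h he).imp (fun h => h.partialTrace q) fun h => h.reflectionPart q W).symm
  have s10 : ∀ e, e ≠ q' → TrivialAt a₁ e ∨ TrivialAt b₀ e := fun e he => by
    rcases eq_or_ne e q with rfl | h
    · exact Or.inr tb₀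
    · exact (hsupp e h he).imp (fun h => h.reflectionPart q Z) fun h => h.partialTrace q
  have anti' : (1 : ℂ) • (a₁ * b₁) = (-1 : ℂ) • (b₁ * a₁) := by
    rw [one_smul, neg_one_smul, anti]
  have hspan : ∀ m ∈ blockSpan q' a₁, siteOp q' m * b₁ = -(b₁ * siteOp q' m) := by
    intro m hm
    have := smul_siteOp_mul_of_mem_blockSpan anti' s11 hm
    rwa [one_smul, neg_one_smul] at this
  have hspan2 : ∀ m ∈ blockSpan q' a₁, ∀ n ∈ blockSpan q' b₁, m * n = -(n * m) := by
    intro m hm n hn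
    have := smul_mul_of_mem_blockSpan (a := 1) (b := -1)
      (by rw [one_smul, neg_one_smul, hspan m hm]) hn
    rwa [one_smul, neg_one_smul] at this
  have starA := conjTranspose_mem_blockSpan (q := q')
    (partialTrace_isHermitian (isHermitian_siteOp_mul hZ hA hZA) q)
  have starB := conjTranspose_mem_blockSpan (q := q')
    (partialTrace_isHermitian (isHermitian_siteOp_mul hW hB hWB) q)
  by_cases hcase : ∀ m ∈ blockSpan q' a₁, ∀ n ∈ blockSpan q' b₁, m * n = 0
  · exfalso
    obtain ⟨m, hm, hm0⟩ := exists_mem_blockSpan_ne_zero (reflectionPart_ne_zero hZ hZA hAq) q'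
    obtain ⟨α, hα, hαh, hα0⟩ := QubitOp.exists_isHermitian starA LinearMap.id hm hm0
    obtain ⟨β, hβ, hβ0⟩ := exists_mem_blockSpan_ne_zero (reflectionPart_ne_zero hW hWB hBq) q'
    rw [LinearMap.id_apply] at hα0
    have hcase' : ∀ m ∈ blockSpan q' a₁, ∀ n ∈ blockSpan q' b₁, n * m = 0 := by
      intro m hm n hn
      rw [← neg_eq_zero, ← hspan2 m hm n hn, hcase m hm n hn]
    have hαs : ∀ c : ℂ, α ≠ c • 1 := by
      rintro c rfl
      have := hcase _ hα _ hβ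
      rw [smul_mul_assoc, one_mul] at this
      rcases smul_eq_zero.1 this with h | h
      · exact hα0 (by rw [h, zero_smul])
      · exact hβ0 h
    have hβs : ∀ c : ℂ, β ≠ c • 1 := by
      rintro c rfl
      have := hcase _ hα _ hβ
      rw [mul_smul_comm, mul_one] at this
      rcases smul_eq_zero.1 this with h | h
      · exact hβ0 (by rw [h, zero_smul])
      · exact hα0 h
    obtain ⟨P, c, r, hP, hr, hαP⟩ := QubitOp.exists_reflection hαh hαs
    have hPα : Commute P α := by
      rw [hαP]
      exact ((Commute.one_right P).smul_right c).add_right ((Commute.refl P).smul_right r)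
    -- Products with `α` vanish in both orders, so `α` commutes with the coefficients of `b₁`; being
    -- non-scalar, it passes this on to `P`. `β` plays the same role for `a₁`.
    have hPB : ∀ n ∈ blockSpan q' b₁, Commute P n := fun n hn =>
      hP.commute_of_commute hPα hαs ((hcase α hα n hn).trans (hcase' α hα n hn).symm)
    have hPA : ∀ m ∈ blockSpan q' a₁, Commute P m := fun m hm =>
      hP.commute_of_commute (hPB β hβ) hβs ((hcase' m hm β hβ).trans (hcase m hm β hβ).symm)
    -- `a₀` commutes with `b₁`, hence with `β` placed at `q'`; likewise `b₀` commutes with `α`.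
    have hPa₀ : Commute (siteOp q' P) a₀ := commute_siteOp_iff.2 fun x y =>
      hP.commute_of_commute (hPB β hβ) hβs (commute_of_mem_blockSpan
        (commute_siteOp_of_mem_blockSpan comm_left.symm s01 hβ) (block_mem_blockSpan _ _ _ _))
    have hPb₀ : Commute (siteOp q' P) b₀ := commute_siteOp_iff.2 fun x y =>
      hP.commute_of_commute hPα hαs (commute_of_mem_blockSpan
        (commute_siteOp_of_mem_blockSpan comm_right.symm s10 hα) (block_mem_blockSpan _ _ _ _))
    refine hnc P hP
      (commute_siteOp_of_split hqq' hZ hZA hPa₀ (commute_siteOp_iff.2 fun x y =>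
        hPA _ (block_mem_blockSpan _ _ _ _)))
      (commute_siteOp_of_split hqq' hW hWB hPb₀ (commute_siteOp_iff.2 fun x y =>
        hPB _ (block_mem_blockSpan _ _ _ _))) ?_ ?_
    · intro h
      obtain ⟨c, hc⟩ := eq_smul_one_of_mem_blockSpan (h.reflectionPart q Z) hα
      exact hαs c hc
    · intro h
      obtain ⟨c, hc⟩ := eq_smul_one_of_mem_blockSpan (h.reflectionPart q W) hβ
      exact hβs c hc
  · push Not at hcase
    obtain ⟨m, hm, n, hn, hmn⟩ := hcase
    obtain ⟨α, hα, hαh, hαn⟩ := QubitOp.exists_isHermitian starA (LinearMap.mulRight ℂ n) hm hmn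
    obtain ⟨β, hβ, hβh, hαβ⟩ := QubitOp.exists_isHermitian starB (LinearMap.mulLeft ℂ α) hn hαn
    rw [LinearMap.mulLeft_apply] at hαβ
    obtain ⟨hα0, hβ0⟩ := QubitOp.trace_eq_zero_of_anticommute (hspan2 α hα β hβ) hαβ
    obtain ⟨P, r, hP, hr, hαP⟩ := QubitOp.exists_reflection_of_trace_eq_zero hαh hα0
      (by rintro rfl; simp at hαβ)
    obtain ⟨Q, s, hQ, hs, hβQ⟩ := QubitOp.exists_reflection_of_trace_eq_zero hβh hβ0
      (by rintro rfl; simp at hαβ)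
    have hPm : P ∈ blockSpan q' a₁ := by
      have : P = r⁻¹ • α := by rw [hαP, smul_smul, inv_mul_cancel₀ hr, one_smul]
      rw [this]
      exact Submodule.smul_mem _ _ hα
    have hQm : Q ∈ blockSpan q' b₁ := by
      have : Q = s⁻¹ • β := by rw [hβQ, smul_smul, inv_mul_cancel₀ hs, one_smul]
      rw [this]
      exact Submodule.smul_mem _ _ hβ
    have s11' : ∀ e, e ≠ q' → TrivialAt b₁ e ∨ TrivialAt a₁ e := fun e he => (s11 e he).symm
    refine ⟨P, Q, anti, comm_left, comm_right, commutator, hP, hQ, hspan2 P hPm Q hQm,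
      hspan P hPm, commute_siteOp_of_mem_blockSpan comm_right.symm s10 hPm, ?_,
      commute_siteOp_of_mem_blockSpan comm_left.symm s01 hQm,
      fun m hm => commute_of_mem_blockSpan (commute_siteOp_reflectionPart hqq' hm) hPm,
      fun m hm => commute_of_mem_blockSpan (commute_siteOp_reflectionPart hqq' hm) hQm, ?_⟩
    · have := smul_siteOp_mul_of_mem_blockSpan (a := 1) (b := -1)
        (by rw [one_smul, neg_one_smul, anti, neg_neg]) s11' hQm
      rwa [one_smul, neg_one_smul] at this
    · intro G hG h0
      -- The scalars `1`, `0` pass from `b₁ * G = 0` to `Q * G = 0`, and `Q` is invertible.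
      have := smul_siteOp_mul_of_mem_blockSpan (a := 1) (b := 0)
        (by rw [one_smul, zero_smul, h0]) hG hQm
      rw [one_smul, zero_smul] at this
      rw [← one_mul G, ← siteOp_mul_siteOp_self hQ q', mul_assoc, this, mul_zero]

/-- The reflections at a qubit on which one star and two plaquettes act anticommute. -/
theorem PairSplit.anticommute {A B C : QOp E} {q q' q'' : E} (hqq' : q ≠ q')
    {Z W P Q P' Q' : QubitOp} (hZ : IsReflection Z) (hW : IsReflection W)
    (hZA : Commute (siteOp q Z) A) (hAq : ¬ TrivialAt A q)
    (hB : PairSplit A B q q' Z W P Q) (hC : PairSplit A C q q'' Z W P' Q')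
    (hAB : ∀ e, e ≠ q → e ≠ q' → TrivialAt A e ∨ TrivialAt B e)
    (hAC : ∀ e, e ≠ q → e ≠ q'' → TrivialAt A e ∨ TrivialAt C e)
    (hBC : ∀ e, e ≠ q → TrivialAt B e ∨ TrivialAt C e) : Z * W = -(W * Z) := by
  set a₀ := partialTrace q A with ha₀
  set a₁ := reflectionPart q Z A with ha₁
  set b₀ := partialTrace q B with hb₀
  set b₁ := reflectionPart q W B with hb₁
  set c₁ := reflectionPart q W C with hc₁
  have tc₁ : TrivialAt c₁ q := trivialAt_reflectionPart_self q W C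
  have hcb₀ : Commute c₁ b₀ := commute_of_disjoint fun e => by
    rcases eq_or_ne e q with rfl | he
    · exact Or.inl tc₁
    · exact ((hBC e he).imp (fun h => h.partialTrace q) fun h => h.reflectionPart q W).symm
  have hbc : ∀ e, TrivialAt b₁ e ∨ TrivialAt c₁ e := fun e => by
    rcases eq_or_ne e q with rfl | he
    · exact Or.inr tc₁
    · exact (hBC e he).imp (fun h => h.reflectionPart q W) fun h => h.reflectionPart q W
  have hcb₁ : Commute c₁ b₁ := (commute_of_disjoint hbc).symm
  have hca₀ : Commute c₁ a₀ := hC.comm_left.symm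
  have hca₁ : a₁ * c₁ = -(c₁ * a₁) := hC.anti
  -- `b₁` and `c₁` can be cancelled in turn, and `a₁` is nonzero because `A` acts on `q`.
  have hab : b₁ * (a₁ * c₁) ≠ 0 := by
    intro h
    have h1 := hB.cancel (a₁ * c₁) (fun e he => by
      rcases eq_or_ne e q with rfl | heq
      · exact Or.inl (trivialAt_reflectionPart_self _ _ _)
      · rcases hAB e heq he with h | h
        · rcases hbc e with h' | h'
          · exact Or.inl h'
          · exact Or.inr ((h.reflectionPart q Z).mul h')
        · exact Or.inl (h.reflectionPart q W)) h
    rw [hca₁, neg_eq_zero] at h1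
    have h2 := hC.cancel a₁ (fun e he => by
      rcases eq_or_ne e q with rfl | heq
      · exact Or.inl (trivialAt_reflectionPart_self _ _ _)
      · exact ((hAC e heq he).imp (fun h => h.reflectionPart q Z)
          fun h => h.reflectionPart q W).symm) h1
    exact reflectionPart_ne_zero hZ hZA hAq h2
  -- Up to sign this is `[a₀, b₀]`, and `c₁` commutes with `a₀` and `b₀`. But `c₁` anticommutes with
  -- `a₁` and commutes with `b₁`, so the multiple is zero.
  have hcom : Commute c₁ ((Z * W).trace • (a₁ * b₁)) := by
    have := hB.commutator
    rw [eq_neg_iff_add_eq_zero, add_comm, ← eq_neg_iff_add_eq_zero] at this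
    rw [this]
    exact ((hca₀.mul_right hcb₀).sub_right (hcb₀.mul_right hca₀)).neg_right
  have h3 : (Z * W).trace • (b₁ * (a₁ * c₁)) = 0 := by
    have e1 : c₁ * (a₁ * b₁) = b₁ * (a₁ * c₁) := by
      rw [← mul_assoc, ← neg_eq_iff_eq_neg.2 hca₁, neg_mul, mul_assoc, hcb₁.eq, ← mul_assoc,
        hB.anti, neg_mul, neg_neg, mul_assoc]
    have e2 : a₁ * b₁ * c₁ = -(b₁ * (a₁ * c₁)) := by rw [hB.anti, neg_mul, mul_assoc]
    have e3 := hcom.eq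
    rw [mul_smul_comm, smul_mul_assoc, e1, e2, smul_neg, eq_neg_iff_add_eq_zero, ← two_smul ℂ]
      at e3
    exact (smul_eq_zero.1 e3).resolve_left two_ne_zero
  have h4 := (smul_eq_zero.1 h3).resolve_right hab
  rw [eq_neg_iff_add_eq_zero, hZ.anticommutator_eq hW, h4, zero_smul]

theorem trace_mul_eq_zero_of_anticommute {Z W : QubitOp} (h : Z * W = -(W * Z)) :
    (Z * W).trace = 0 := by
  have := congrArg Matrix.trace h
  rw [Matrix.trace_neg, Matrix.trace_mul_comm W Z] at this
  linear_combination this / 2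

/-- This lets one of the two kinds of string stop at `q'`. A coefficient of `A` not commuting with
`P` forces all coefficients of `B` to commute with `Q`. If it comes from `a₀`, it commutes with `Q`
and with the coefficients of `B`'s parts; if it comes from `a₁`, it anticommutes with `Q`. -/
theorem PairSplit.commute_or_commute {A B : QOp E} {q q' : E} (hqq' : q ≠ q')
    {Z W P Q : QubitOp} (hZ : IsReflection Z) (hW : IsReflection W) (hZW : Z * W = -(W * Z))
    (hZA : Commute (siteOp q Z) A) (hWB : Commute (siteOp q W) B)
    (hsupp : ∀ e, e ≠ q → e ≠ q' → TrivialAt A e ∨ TrivialAt B e)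
    (H : PairSplit A B q q' Z W P Q) : Commute (siteOp q' P) A ∨ Commute (siteOp q' Q) B := by
  by_contra! hc
  obtain ⟨hPA, hQB⟩ := hc
  apply hQB
  have hcomm : Commute (partialTrace q A) (partialTrace q B) := by
    have := H.commutator
    rw [trace_mul_eq_zero_of_anticommute hZW, zero_smul, neg_zero] at this
    exact sub_eq_zero.1 this
  by_cases h1 : Commute (siteOp q' P) (reflectionPart q Z A)
  · have h0 : ¬ Commute (siteOp q' P) (partialTrace q A) := fun h0 =>
      hPA (commute_siteOp_of_split hqq' hZ hZA h0 h1)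
    rw [commute_siteOp_iff] at h0
    push Not at h0
    obtain ⟨x, y, hxy⟩ := h0
    have hns : ∀ c : ℂ, block q' x y (partialTrace q A) ≠ c • 1 := fun c hc =>
      hxy (hc ▸ (Commute.one_right P).smul_right c)
    have hQ := commute_siteOp_iff.1 H.Q_trace x y
    refine commute_siteOp_of_split hqq' hW hWB (commute_siteOp_iff.2 fun x' y' => ?_)
      (commute_siteOp_iff.2 fun x' y' => ?_)
    · refine H.reflQ.commute_of_commute hQ hns (commute_block_block hcomm (fun e he => ?_) _ _ _ _)
      rcases eq_or_ne e q with rfl | heq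
      · exact Or.inl (trivialAt_partialTrace_self _ _)
      · exact (hsupp e heq he).imp (fun h => h.partialTrace q) fun h => h.partialTrace q
    · refine H.reflQ.commute_of_commute hQ hns
        (commute_block_block H.comm_left (fun e he => ?_) _ _ _ _)
      rcases eq_or_ne e q with rfl | heq
      · exact Or.inl (trivialAt_partialTrace_self _ _)
      · exact (hsupp e heq he).imp (fun h => h.partialTrace q) fun h => h.reflectionPart q W
  · rw [commute_siteOp_iff] at h1
    push Not at h1
    obtain ⟨x, y, hxy⟩ := h1
    set α := block q' x y (reflectionPart q Z A) with hα
    have hQα : Q * α = -(α * Q) := by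
      have := (smul_siteOp_mul_iff (a := 1) (b := -1)).1
        (by rw [one_smul, neg_one_smul, H.Q_left]) x y
      rwa [one_smul, neg_one_smul] at this
    refine commute_siteOp_of_split hqq' hW hWB (commute_siteOp_iff.2 fun x' y' => ?_)
      (commute_siteOp_iff.2 fun x' y' => ?_)
    -- Coefficients of `b₀` commute with `P` and with `α`, which do not commute with each other, so
    -- they are scalar.
    · have h2 : Commute (block q' x' y' (partialTrace q B)) α :=
        commute_block_block H.comm_right (fun e he => by
          rcases eq_or_ne e q with rfl | heq
          · exact Or.inl (trivialAt_partialTrace_self _ _)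
          · exact ((hsupp e heq he).imp (fun h => h.reflectionPart q Z)
              fun h => h.partialTrace q).symm) _ _ _ _
      have h3 := commute_siteOp_iff.1 H.P_trace x' y'
      by_cases hs : ∃ c : ℂ, block q' x' y' (partialTrace q B) = c • 1
      · obtain ⟨c, hc⟩ := hs
        rw [hc]
        exact (Commute.one_right Q).smul_right c
      · push Not at hs
        exact absurd (H.reflP.commute_of_commute h3 hs h2) hxy
    · refine H.reflP.commute_of_anticommute H.reflQ H.antiPQ hQα (fun h => hxy h.symm) ?_ ?_
      · have := (smul_siteOp_mul_iff (a := 1) (b := -1)).1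
          (by rw [one_smul, neg_one_smul, H.P_right]) x' y'
        rw [one_smul, neg_one_smul] at this
        rw [this, neg_neg]
      · have := smul_block_mul_block (a := 1) (b := -1) (q := q')
          (g := reflectionPart q Z A) (h := reflectionPart q W B)
          (by rw [one_smul, neg_one_smul, H.anti]) (fun e he => by
            rcases eq_or_ne e q with rfl | heq
            · exact Or.inl (trivialAt_reflectionPart_self _ _ _)
            · exact (hsupp e heq he).imp (fun h => h.reflectionPart q Z)
                fun h => h.reflectionPart q W) x y x' y'
        rw [one_smul, neg_one_smul] at this
        rw [this, neg_neg]

/-- Conjugation of an operator with an operator on the qubit `q`. -/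
noncomputable def siteConj (q : E) (X : QubitOp) (A : QOp E) : QOp E :=
  siteOp q X * A * siteOp q X

theorem siteConj_eq_of_anticommute {A : QOp E} {q : E} {Z W : QubitOp} (hZ : IsReflection Z)
    (hW : IsReflection W) (hZW : Z * W = -(W * Z)) (hZA : Commute (siteOp q Z) A) :
    siteConj q W A = partialTrace q A - siteOp q Z * reflectionPart q Z A := by
  have e1 : siteOp q W * siteOp q Z = -(siteOp q Z * siteOp q W) := by
    rw [← siteOp_mul, ← siteOp_mul, hZW, siteOp_neg, neg_neg]
  have e2 := siteOp_mul_siteOp_self hW q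
  have e3 := (trivialAt_partialTrace_self q A W).eq
  have e4 := (trivialAt_reflectionPart_self q Z A W).eq
  have e5 : siteOp q W * partialTrace q A * siteOp q W = partialTrace q A := by
    rw [e3, mul_assoc, e2, mul_one]
  have e6 : siteOp q W * (siteOp q Z * reflectionPart q Z A) * siteOp q W =
      -(siteOp q Z * reflectionPart q Z A) := by
    rw [← mul_assoc, e1, neg_mul, neg_mul, mul_assoc, mul_assoc, ← mul_assoc (siteOp q W), e4,
      mul_assoc, e2, mul_one]
  conv_lhs => rw [siteConj, eq_partialTrace_add hZ hZA, mul_add, add_mul, e5, e6]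
  rw [sub_eq_add_neg]

/-- Both conjugations fix `a₀` and reverse the sign of `Z a₁`: `W` anticommutes with `Z`, and `Q`
with `a₁`. This is what moves a flip along a string. -/
theorem PairSplit.siteConj_left {A B : QOp E} {q q' : E} (hqq' : q ≠ q')
    {Z W P Q : QubitOp} (hZ : IsReflection Z) (hW : IsReflection W) (hZW : Z * W = -(W * Z))
    (hZA : Commute (siteOp q Z) A) (H : PairSplit A B q q' Z W P Q) :
    siteConj q W A = siteConj q' Q A := by
  rw [siteConj_eq_of_anticommute hZ hW hZW hZA]
  have e2 := siteOp_mul_siteOp_self H.reflQ q'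
  have e5 : siteOp q' Q * partialTrace q A * siteOp q' Q = partialTrace q A := by
    rw [H.Q_trace.eq, mul_assoc, e2, mul_one]
  have e6 : siteOp q' Q * (siteOp q Z * reflectionPart q Z A) * siteOp q' Q =
      -(siteOp q Z * reflectionPart q Z A) := by
    rw [← mul_assoc, (siteOp_commute hqq'.symm Q Z).eq, mul_assoc, mul_assoc,
      ← mul_assoc (siteOp q' Q), H.Q_left, neg_mul,
      mul_assoc, e2, mul_one, mul_neg]
  conv_rhs => rw [siteConj, eq_partialTrace_add hZ hZA, mul_add, add_mul, e5, e6]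
  rw [sub_eq_add_neg]

theorem PairSplit.siteConj_right {A B : QOp E} {q q' : E} (hqq' : q ≠ q')
    {Z W P Q : QubitOp} (hZ : IsReflection Z) (hW : IsReflection W) (hZW : Z * W = -(W * Z))
    (hWB : Commute (siteOp q W) B) (H : PairSplit A B q q' Z W P Q) :
    siteConj q Z B = siteConj q' P B := by
  rw [siteConj_eq_of_anticommute hW hZ (by rw [hZW, neg_neg]) hWB]
  have e2 := siteOp_mul_siteOp_self H.reflP q'
  have e5 : siteOp q' P * partialTrace q B * siteOp q' P = partialTrace q B := by
    rw [H.P_trace.eq, mul_assoc, e2, mul_one]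
  have e6 : siteOp q' P * (siteOp q W * reflectionPart q W B) * siteOp q' P =
      -(siteOp q W * reflectionPart q W B) := by
    rw [← mul_assoc, (siteOp_commute hqq'.symm P W).eq, mul_assoc, mul_assoc,
      ← mul_assoc (siteOp q' P), H.P_right, neg_mul,
      mul_assoc, e2, mul_one, mul_neg]
  conv_rhs => rw [siteConj, eq_partialTrace_add hW hWB, mul_add, add_mul, e5, e6]
  rw [sub_eq_add_neg]

theorem PairSplit.not_trivialAt_left {A B : QOp E} {q q' : E} {Z W P Q : QubitOp}
    (H : PairSplit A B q q' Z W P Q) : ¬ TrivialAt A q' := fun h =>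
  H.reflP.ne_smul_one _ (QubitOp.eq_smul_one_of_forall_commute fun m => H.comm_P m (h m))

theorem PairSplit.not_trivialAt_right {A B : QOp E} {q q' : E} {Z W P Q : QubitOp}
    (H : PairSplit A B q q' Z W P Q) : ¬ TrivialAt B q' := fun h =>
  H.reflQ.ne_smul_one _ (QubitOp.eq_smul_one_of_forall_commute fun m => H.comm_Q m (h m))

theorem siteConj_neg (q : E) (X : QubitOp) (A : QOp E) : siteConj q (-X) A = siteConj q X A := by
  simp [siteConj, siteOp_neg]

end PairSplit

/-! ### Star-plaquette systems and the choice of bases -/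

/-- The edges of a set `S`, two of them being joined when they both belong to some `T f`. -/
def linkGraph {E F : Type*} (S : Set E) (T : F → Set E) : SimpleGraph E where
  Adj a b := a ≠ b ∧ a ∈ S ∧ b ∈ S ∧ ∃ f, a ∈ T f ∧ b ∈ T f
  symm := ⟨fun _ _ h => ⟨h.1.symm, h.2.2.1, h.2.1, h.2.2.2.imp fun _ h' => ⟨h'.2, h'.1⟩⟩⟩
  loopless := ⟨fun _ h => h.1 rfl⟩

/-- Commuting star and plaquette operators without classical qubits, in a form that is symmetric
under the exchange of stars and plaquettes. -/
structure StarPlaquetteSystem (V F E : Type*) [Fintype E] [DecidableEq E] where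
  starOf : V → Set E
  plaqOf : F → Set E
  A : V → QOp E
  B : F → QOp E
  hermA : ∀ v, (A v).IsHermitian
  hermB : ∀ f, (B f).IsHermitian
  trivA : ∀ v e, e ∉ starOf v → TrivialAt (A v) e
  trivB : ∀ f e, e ∉ plaqOf f → TrivialAt (B f) e
  commAA : ∀ v v', Commute (A v) (A v')
  commBB : ∀ f f', Commute (B f) (B f')
  commAB : ∀ v f, Commute (A v) (B f)
  star_inter : ∀ v v' a b, v ≠ v' → a ∈ starOf v → a ∈ starOf v' → b ∈ starOf v →
    b ∈ starOf v' → a = b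
  plaq_inter : ∀ f f' a b, f ≠ f' → a ∈ plaqOf f → a ∈ plaqOf f' → b ∈ plaqOf f →
    b ∈ plaqOf f' → a = b
  star_le_two : ∀ e u v w, e ∈ starOf u → e ∈ starOf v → e ∈ starOf w → u = v ∨ u = w ∨ v = w
  plaq_le_two : ∀ e u v w, e ∈ plaqOf u → e ∈ plaqOf v → e ∈ plaqOf w → u = v ∨ u = w ∨ v = w
  exists_shared : ∀ v f e, e ∈ starOf v → e ∈ plaqOf f →
    ∃ e', e' ≠ e ∧ e' ∈ starOf v ∧ e' ∈ plaqOf f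
  shared_le_two : ∀ v f a b c, a ∈ starOf v → b ∈ starOf v → c ∈ starOf v → a ∈ plaqOf f →
    b ∈ plaqOf f → c ∈ plaqOf f → a = b ∨ a = c ∨ b = c
  star_conn : ∀ v a b, a ∈ starOf v → b ∈ starOf v → (linkGraph (starOf v) plaqOf).Reachable a b
  plaq_conn : ∀ f a b, a ∈ plaqOf f → b ∈ plaqOf f → (linkGraph (plaqOf f) starOf).Reachable a b
  not_classical : ∀ q P, IsReflection P → (∀ v, Commute (siteOp q P) (A v)) →
    (∀ f, Commute (siteOp q P) (B f)) → (∀ v, TrivialAt (A v) q) ∧ ∀ f, TrivialAt (B f) q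

theorem commute_siteOp_of_commute {E : Type*} [Fintype E] [DecidableEq E] {g h : QOp E} {q : E}
    (hgh : Commute g h) (H : ∀ e, e ≠ q → TrivialAt g e ∨ TrivialAt h e)
    (hg : ¬ TrivialAt g q) {P : QubitOp} (hP : IsReflection P) (hPg : Commute (siteOp q P) g) :
    Commute (siteOp q P) h := by
  rw [trivialAt_iff_block] at hg
  push Not at hg
  obtain ⟨x, y, hxy⟩ := hg
  have hns : ∀ c : ℂ, block q x y g ≠ c • 1 := by
    intro c hc
    apply hxy
    rw [hc]
    simp
  exact commute_siteOp_iff.2 fun x' y' => hP.commute_of_commute (commute_siteOp_iff.1 hPg x y) hns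
    (commute_block_block hgh H x y x' y')

/-- A hermitian operator that acts nontrivially on `q` has a reflection in its induced algebra. -/
theorem exists_reflection_of_not_trivialAt {E : Type*} [Fintype E] [DecidableEq E] {g : QOp E}
    {q : E} (hg : g.IsHermitian) (hgq : ¬ TrivialAt g q) :
    ∃ P, IsReflection P ∧ ∀ h, Commute g h → (∀ e, e ≠ q → TrivialAt g e ∨ TrivialAt h e) →
      Commute (siteOp q P) h := by
  rw [trivialAt_iff_block] at hgq
  push Not at hgq
  obtain ⟨x, y, hxy⟩ := hgq
  -- `f` takes the traceless part, so that `f m ≠ 0` selects a non-scalar hermitian combination of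
  -- coefficients.
  let f : QubitOp →ₗ[ℂ] QubitOp :=
    LinearMap.id - (2⁻¹ : ℂ) • ((Matrix.traceLinearMap (Fin 2) ℂ ℂ).smulRight (1 : QubitOp))
  have hf : ∀ m, f m = m - (2⁻¹ : ℂ) • (m.trace • (1 : QubitOp)) := fun m => rfl
  obtain ⟨m, hm, hmh, hm0⟩ := QubitOp.exists_isHermitian
    (conjTranspose_mem_blockSpan (q := q) hg) f (block_mem_blockSpan q g x y) (by
      rw [hf]
      intro h
      apply hxy
      rw [sub_eq_zero, smul_smul] at h
      rw [h]
      simp)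
  obtain ⟨P, c, r, hP, hr, hmP⟩ := QubitOp.exists_reflection hmh (by
    rintro c rfl
    apply hm0
    rw [hf, Matrix.trace_smul, Matrix.trace_one, smul_smul, ← sub_smul]
    simp
    ring)
  refine ⟨P, hP, fun h hgh H => ?_⟩
  have h1 := commute_siteOp_of_mem_blockSpan hgh H hm
  have h2 : P = r⁻¹ • (m - c • 1) := by
    rw [hmP, add_sub_cancel_left, smul_smul, inv_mul_cancel₀ hr, one_smul]
  rw [h2, siteOp_smul, siteOp_sub, siteOp_smul, siteOp_one]
  exact (h1.sub_left ((Commute.one_left h).smul_left c)).smul_left _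

namespace StarPlaquetteSystem

variable {V F E : Type*} [Fintype E] [DecidableEq E] (S : StarPlaquetteSystem V F E)

/-- The system in which stars and plaquettes are exchanged. -/
def swap : StarPlaquetteSystem F V E where
  starOf := S.plaqOf
  plaqOf := S.starOf
  A := S.B
  B := S.A
  hermA := S.hermB
  hermB := S.hermA
  trivA := S.trivB
  trivB := S.trivA
  commAA := S.commBB
  commBB := S.commAA
  commAB := fun f v => (S.commAB v f).symm
  star_inter := S.plaq_inter
  plaq_inter := S.star_inter
  star_le_two := S.plaq_le_two
  plaq_le_two := S.star_le_two
  exists_shared := fun f v e he he' => by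
    obtain ⟨e', h1, h2, h3⟩ := S.exists_shared v f e he' he
    exact ⟨e', h1, h3, h2⟩
  shared_le_two := fun f v a b c h1 h2 h3 h4 h5 h6 => S.shared_le_two v f a b c h4 h5 h6 h1 h2 h3
  star_conn := S.plaq_conn
  plaq_conn := S.star_conn
  not_classical := fun q P hP h1 h2 => (S.not_classical q P hP h2 h1).symm

/-- At most one plaquette acts nontrivially on `q`. -/
def IsBd (q : E) : Prop := {f | ¬ TrivialAt (S.B f) q}.Subsingleton

/-- At most one star acts nontrivially on `q`. -/
def IsCobd (q : E) : Prop := {v | ¬ TrivialAt (S.A v) q}.Subsingleton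

/-- The qubit is neither in the boundary nor in the coboundary. -/
def IsGood (q : E) : Prop := ¬ S.IsBd q ∧ ¬ S.IsCobd q

theorem isGood_swap {q : E} : S.swap.IsGood q ↔ S.IsGood q := and_comm

variable {S}

theorem mem_starOf {v : V} {e : E} (h : ¬ TrivialAt (S.A v) e) : e ∈ S.starOf v := by
  by_contra hc
  exact h (S.trivA v e hc)

theorem trivialAt_or_of_ne {v v' : V} (hv : v ≠ v') {q : E} (hq : q ∈ S.starOf v)
    (hq' : q ∈ S.starOf v') (e : E) (he : e ≠ q) :
    TrivialAt (S.A v) e ∨ TrivialAt (S.A v') e := by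
  by_contra! hc
  exact he (S.star_inter v v' e q hv (mem_starOf hc.1) (mem_starOf hc.2) hq hq')

theorem trivialAt_or_of_shared {v : V} {f : F} {a b : E} (hab : a ≠ b) (ha : a ∈ S.starOf v)
    (ha' : a ∈ S.plaqOf f) (hb : b ∈ S.starOf v) (hb' : b ∈ S.plaqOf f) (e : E) (hea : e ≠ a)
    (heb : e ≠ b) : TrivialAt (S.A v) e ∨ TrivialAt (S.B f) e := by
  by_contra! hc
  rcases S.shared_le_two v f e a b (mem_starOf hc.1) ha hb (mem_starOf (S := S.swap) hc.2) ha' hb'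
    with h | h | h
  · exact hea h
  · exact heb h
  · exact hab h

/-- Distinct stars at `q` share no other qubit, so the reflection passes from one star acting on `q`
to all of them. -/
theorem commute_star_of_commute {v : V} {q : E} (hv : ¬ TrivialAt (S.A v) q) {P : QubitOp}
    (hP : IsReflection P) (hPv : Commute (siteOp q P) (S.A v)) (v' : V) :
    Commute (siteOp q P) (S.A v') := by
  rcases eq_or_ne v v' with rfl | hne
  · exact hPv
  · by_cases hv' : q ∈ S.starOf v'
    · exact commute_siteOp_of_commute (S.commAA v v')
        (trivialAt_or_of_ne hne (mem_starOf hv) hv') hv hP hPv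
    · exact S.trivA v' q hv' P

theorem exists_pairSplit {v : V} {f : F} {a b : E} (hab : a ≠ b) (ha : a ∈ S.starOf v)
    (ha' : a ∈ S.plaqOf f) (hb : b ∈ S.starOf v) (hb' : b ∈ S.plaqOf f) {Z W : QubitOp}
    (hZ : IsReflection Z) (hW : IsReflection W) (hZW : ¬ Commute Z W)
    (hZA : Commute (siteOp a Z) (S.A v)) (hWB : Commute (siteOp a W) (S.B f))
    (hA : ¬ TrivialAt (S.A v) a) (hB : ¬ TrivialAt (S.B f) a) :
    ∃ P Q, PairSplit (S.A v) (S.B f) a b Z W P Q := by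
  refine _root_.exists_pairSplit hab hZ hW hZW (S.hermA v) (S.hermB f) (S.commAB v f) hZA hWB hA hB
    (trivialAt_or_of_shared hab ha ha' hb hb') ?_
  intro P hP hPA hPB hAb hBb
  exact hAb ((S.not_classical b P hP (commute_star_of_commute hAb hP hPA)
    (commute_star_of_commute (S := S.swap) hBb hP hPB)).1 v)

theorem exists_ne_of_not_isCobd {q : E} (hq : ¬ S.IsCobd q) :
    ∃ v v', v ≠ v' ∧ ¬ TrivialAt (S.A v) q ∧ ¬ TrivialAt (S.A v') q := by
  rw [IsCobd, Set.not_subsingleton_iff] at hq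
  obtain ⟨v, hv, v', hv', hne⟩ := hq
  exact ⟨v, v', hne, hv, hv'⟩

theorem not_trivialAt_of_not_isCobd {q : E} (hq : ¬ S.IsCobd q) {v : V} (hv : q ∈ S.starOf v) :
    ¬ TrivialAt (S.A v) q := by
  obtain ⟨u, u', hne, hu, hu'⟩ := exists_ne_of_not_isCobd hq
  rcases S.star_le_two q v u u' hv (mem_starOf hu) (mem_starOf hu') with h | h | h
  · rwa [h]
  · rwa [h]
  · exact absurd h hne

theorem exists_reflection_of_not_isCobd {q : E} (hq : ¬ S.IsCobd q) :
    ∃ Z, IsReflection Z ∧ ∀ v, Commute (siteOp q Z) (S.A v) := by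
  obtain ⟨v, v', hne, hv, hv'⟩ := exists_ne_of_not_isCobd hq
  obtain ⟨Z, hZ, h⟩ := exists_reflection_of_not_trivialAt (S.hermA v) hv
  exact ⟨Z, hZ, commute_star_of_commute hv' hZ
    (h _ (S.commAA v v') (trivialAt_or_of_ne hne (mem_starOf hv) (mem_starOf hv')))⟩

/-- Commuting reflections agree up to sign; then `Z` would commute with all terms and `q` would be
trivial. -/
theorem not_commute_of_isGood {q : E} (hq : ¬ S.IsCobd q) {Z W : QubitOp} (hZ : IsReflection Z)
    (hW : IsReflection W) (hZA : ∀ v, Commute (siteOp q Z) (S.A v))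
    (hWB : ∀ f, Commute (siteOp q W) (S.B f)) : ¬ Commute Z W := by
  intro h
  have hZB : ∀ f, Commute (siteOp q Z) (S.B f) := by
    intro f
    rcases hW.eq_or_eq_neg_of_commute hZ h.symm with rfl | rfl
    · exact hWB f
    · rw [siteOp_neg]
      exact (hWB f).neg_left
  obtain ⟨v, -, -, hv, -⟩ := exists_ne_of_not_isCobd hq
  exact hv ((S.not_classical q Z hZ hZA hZB).1 v)

/-- A star and the two plaquettes acting on `q` are the configuration of `PairSplit.anticommute`. -/
theorem anticommute_of_isGood {q : E} (hq : S.IsGood q) {Z W : QubitOp} (hZ : IsReflection Z)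
    (hW : IsReflection W) (hZA : ∀ v, Commute (siteOp q Z) (S.A v))
    (hWB : ∀ f, Commute (siteOp q W) (S.B f)) : Z * W = -(W * Z) := by
  have hZW := not_commute_of_isGood hq.2 hZ hW hZA hWB
  obtain ⟨v, -, -, hv, -⟩ := exists_ne_of_not_isCobd hq.2
  obtain ⟨f, f', hne, hf, hf'⟩ := exists_ne_of_not_isCobd (S := S.swap) hq.1
  have mv := mem_starOf hv
  have mf : q ∈ S.plaqOf f := mem_starOf (S := S.swap) hf
  have mf' : q ∈ S.plaqOf f' := mem_starOf (S := S.swap) hf'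
  obtain ⟨a, ha, hav, haf⟩ := S.exists_shared v f q mv mf
  obtain ⟨b, hb, hbv, hbf⟩ := S.exists_shared v f' q mv mf'
  obtain ⟨P, Q, h1⟩ := exists_pairSplit ha.symm mv mf hav haf hZ hW hZW (hZA v) (hWB f) hv hf
  obtain ⟨P', Q', h2⟩ := exists_pairSplit hb.symm mv mf' hbv hbf hZ hW hZW (hZA v) (hWB f') hv hf'
  exact h1.anticommute ha.symm hZ hW (hZA v) hv h2
    (trivialAt_or_of_shared ha.symm mv mf hav haf) (trivialAt_or_of_shared hb.symm mv mf' hbv hbf)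
    (trivialAt_or_of_ne (S := S.swap) hne mf mf')

variable (S)

/-- Reflections `Z q`, `X q`, one pair for each qubit, such that star operators commute with `Z q`
outside the coboundary and plaquette operators commute with `X q` outside the boundary. -/
structure IsToric (Z X : E → QubitOp) : Prop where
  reflZ : ∀ q, IsReflection (Z q)
  reflX : ∀ q, IsReflection (X q)
  anti : ∀ q, Z q * X q = -(X q * Z q)
  commZ : ∀ q, ¬ S.IsCobd q → ∀ v, Commute (siteOp q (Z q)) (S.A v)
  commX : ∀ q, ¬ S.IsBd q → ∀ f, Commute (siteOp q (X q)) (S.B f)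

variable {S}

theorem IsToric.swap {Z X : E → QubitOp} (T : S.IsToric Z X) : S.swap.IsToric X Z where
  reflZ := T.reflX
  reflX := T.reflZ
  anti q := by rw [T.anti, neg_neg]
  commZ := T.commX
  commX := T.commZ

variable (S) in
theorem exists_isToric_at (q : E) : ∃ Z X : QubitOp, IsReflection Z ∧ IsReflection X ∧
    Z * X = -(X * Z) ∧ (¬ S.IsCobd q → ∀ v, Commute (siteOp q Z) (S.A v)) ∧
    (¬ S.IsBd q → ∀ f, Commute (siteOp q X) (S.B f)) := by
  by_cases hc : S.IsCobd q
  · by_cases hb : S.IsBd q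
    · have h0 : IsReflection pauliZ := ⟨by
        ext i j; fin_cases i <;> fin_cases j <;> simp [pauliZ], by
        ext i j; fin_cases i <;> fin_cases j <;> simp [pauliZ], by
        simp [pauliZ, Matrix.trace_fin_two]⟩
      obtain ⟨X, hX, h⟩ := h0.exists_anticommuting
      exact ⟨_, X, h0, hX, h, fun h => absurd hc h, fun h => absurd hb h⟩
    · obtain ⟨X, hX, h⟩ := exists_reflection_of_not_isCobd (S := S.swap) hb
      obtain ⟨Z, hZ, h'⟩ := hX.exists_anticommuting
      exact ⟨Z, X, hZ, hX, by rw [h', neg_neg], fun h => absurd hc h, fun _ => h⟩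
  · obtain ⟨Z, hZ, hZA⟩ := exists_reflection_of_not_isCobd hc
    by_cases hb : S.IsBd q
    · obtain ⟨X, hX, h'⟩ := hZ.exists_anticommuting
      exact ⟨Z, X, hZ, hX, h', fun _ => hZA, fun h => absurd hb h⟩
    · obtain ⟨X, hX, hXB⟩ := exists_reflection_of_not_isCobd (S := S.swap) hb
      exact ⟨Z, X, hZ, hX, anticommute_of_isGood ⟨hb, hc⟩ hZ hX hZA hXB, fun _ => hZA,
        fun _ => hXB⟩

theorem IsToric.exists_pairSplit {Z X : E → QubitOp} (T : S.IsToric Z X) {v : V} {f : F} {a b : E}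
    (hab : a ≠ b) (hga : S.IsGood a) (ha : a ∈ S.starOf v) (ha' : a ∈ S.plaqOf f)
    (hb : b ∈ S.starOf v) (hb' : b ∈ S.plaqOf f) :
    ∃ P Q, PairSplit (S.A v) (S.B f) a b (Z a) (X a) P Q :=
  StarPlaquetteSystem.exists_pairSplit hab ha ha' hb hb' (T.reflZ a) (T.reflX a)
    (not_commute_of_isGood hga.2 (T.reflZ a) (T.reflX a) (T.commZ a hga.2) (T.commX a hga.1))
    (T.commZ a hga.2 v) (T.commX a hga.1 f) (not_trivialAt_of_not_isCobd hga.2 ha)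
    (not_trivialAt_of_not_isCobd (S := S.swap) hga.1 ha')

/-- Flipping a star operator at two of its qubits on a common plaquette has the same effect. -/
theorem IsToric.siteConj_eq {Z X : E → QubitOp} (T : S.IsToric Z X) {v : V} {f : F} {a b : E}
    (hab : a ≠ b) (hga : S.IsGood a) (ha : a ∈ S.starOf v) (ha' : a ∈ S.plaqOf f)
    (hb : b ∈ S.starOf v) (hb' : b ∈ S.plaqOf f) (hbd : ¬ S.IsBd b) :
    siteConj a (X a) (S.A v) = siteConj b (X b) (S.A v) ∧ ¬ TrivialAt (S.A v) b := by
  obtain ⟨P, Q, H⟩ := T.exists_pairSplit hab hga ha ha' hb hb'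
  refine ⟨?_, H.not_trivialAt_left⟩
  rw [H.siteConj_left hab (T.reflZ a) (T.reflX a) (T.anti a) (T.commZ a hga.2 v)]
  -- `X b` commutes with `B f` and therefore with `Q`, so they agree up to a sign, which conjugation
  -- does not see.
  rcases (T.reflX b).eq_or_eq_neg_of_commute H.reflQ (H.comm_Q _ (T.commX b hbd f)) with h | h
  · rw [h]
  · rw [h, siteConj_neg]

variable (S)

/-- Reflections as in `IsToric` such that moreover every string of flips that arrives at the
boundary or coboundary can be ended there. -/
structure IsStringToric (Z X : E → QubitOp) : Prop extends S.IsToric Z X where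
  final : ∀ {v : V} {f : F} {a b : E}, a ≠ b → S.IsGood a → ¬ S.IsGood b → a ∈ S.starOf v →
    a ∈ S.plaqOf f → b ∈ S.starOf v → b ∈ S.plaqOf f →
    (S.IsCobd b ∧ siteConj a (X a) (S.A v) = siteConj b (X b) (S.A v) ∧ ¬ TrivialAt (S.A v) b ∧
      ∀ f', Commute (siteOp b (X b)) (S.B f')) ∨
    (S.IsBd b ∧ siteConj a (Z a) (S.B f) = siteConj b (Z b) (S.B f) ∧ ¬ TrivialAt (S.B f) b ∧
      ∀ v', Commute (siteOp b (Z b)) (S.A v'))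

variable {S}

theorem IsStringToric.swap {Z X : E → QubitOp} (T : S.IsStringToric Z X) :
    S.swap.IsStringToric X Z where
  toIsToric := T.toIsToric.swap
  final hab hga hgb h1 h2 h3 h4 :=
    (T.final hab (S.isGood_swap.1 hga) (fun h => hgb (S.isGood_swap.2 h)) h2 h1 h4 h3).symm

theorem commute_of_isBd {f : F} {b : E} (hb : S.IsBd b) (hf : ¬ TrivialAt (S.B f) b)
    {X : QubitOp} (hX : Commute (siteOp b X) (S.B f)) (f' : F) :
    Commute (siteOp b X) (S.B f') := by
  by_cases h : TrivialAt (S.B f') b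
  · exact h X
  · rwa [hb h hf]

/-- `IsToric` imposes no commutation at such a qubit, so the `P`, `Q` of a pair meeting there may be
used. One choice serves all `v`, `f`, `a`: only one star and one plaquette act on `b`, and they
share a single further qubit. -/
theorem IsToric.exists_final_at {Z X : E → QubitOp} (T : S.IsToric Z X) {b : E}
    (hcb : S.IsCobd b) (hbb : S.IsBd b) :
    ∃ Z' X' : QubitOp, IsReflection Z' ∧ IsReflection X' ∧ Z' * X' = -(X' * Z') ∧
    ∀ {v : V} {f : F} {a : E}, a ≠ b → S.IsGood a → a ∈ S.starOf v →
    a ∈ S.plaqOf f → b ∈ S.starOf v → b ∈ S.plaqOf f →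
    (siteConj a (X a) (S.A v) = siteConj b X' (S.A v) ∧ ¬ TrivialAt (S.A v) b ∧
      ∀ f', Commute (siteOp b X') (S.B f')) ∨
    (siteConj a (Z a) (S.B f) = siteConj b Z' (S.B f) ∧ ¬ TrivialAt (S.B f) b ∧
      ∀ v', Commute (siteOp b Z') (S.A v')) := by
  by_cases hex : ∃ (v : V) (f : F) (a : E), a ≠ b ∧ S.IsGood a ∧ a ∈ S.starOf v ∧
    a ∈ S.plaqOf f ∧ b ∈ S.starOf v ∧ b ∈ S.plaqOf f
  · obtain ⟨v, f, a, hab, hga, ha, ha', hb, hb'⟩ := hex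
    obtain ⟨P, Q, H⟩ := T.exists_pairSplit hab hga ha ha' hb hb'
    refine ⟨P, Q, H.reflP, H.reflQ, H.antiPQ, ?_⟩
    intro v' f' a' hab' hga' ha₁ ha₁' hb₁ hb₁'
    obtain ⟨P', Q', H'⟩ := T.exists_pairSplit hab' hga' ha₁ ha₁' hb₁ hb₁'
    obtain rfl : v = v' := hcb H.not_trivialAt_left H'.not_trivialAt_left
    obtain rfl : f = f' := hbb H.not_trivialAt_right H'.not_trivialAt_right
    obtain rfl : a = a' := by
      rcases S.shared_le_two v f a a' b ha ha₁ hb ha' ha₁' hb' with h | h | h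
      · exact h
      · exact absurd h hab
      · exact absurd h hab'
    rcases H.commute_or_commute hab (T.reflZ a) (T.reflX a) (T.anti a) (T.commZ a hga.2 v)
      (T.commX a hga.1 f) (trivialAt_or_of_shared hab ha ha' hb hb') with h | h
    · exact Or.inr ⟨H.siteConj_right hab (T.reflZ a) (T.reflX a) (T.anti a) (T.commX a hga.1 f),
        H.not_trivialAt_right,
        commute_of_isBd (S := S.swap) hcb H.not_trivialAt_left h⟩
    · exact Or.inl ⟨H.siteConj_left hab (T.reflZ a) (T.reflX a) (T.anti a) (T.commZ a hga.2 v),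
        H.not_trivialAt_left, commute_of_isBd hbb H.not_trivialAt_right h⟩
  · refine ⟨Z b, X b, T.reflZ b, T.reflX b, T.anti b, ?_⟩
    intro v f a hab hga ha ha' hb hb'
    exact absurd ⟨v, f, a, hab, hga, ha, ha', hb, hb'⟩ hex

variable (S) in
-- Only qubits in both the boundary and the coboundary get new reflections. Good qubits keep theirs,
-- so the conjugations at `a` are unaffected; the other bad qubits are handled by
-- `IsToric.siteConj_eq`.
theorem exists_isStringToric : ∃ Z X : E → QubitOp, S.IsStringToric Z X := by
  classical
  choose Z₀ X₀ hZ₀ hX₀ hanti hcZ hcX using S.exists_isToric_at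
  have T : S.IsToric Z₀ X₀ := ⟨hZ₀, hX₀, hanti, hcZ, hcX⟩
  have hfin : ∀ b, ∃ Z' X' : QubitOp, (¬ (S.IsCobd b ∧ S.IsBd b) → Z' = Z₀ b ∧ X' = X₀ b) ∧
      IsReflection Z' ∧ IsReflection X' ∧ Z' * X' = -(X' * Z') ∧
      (S.IsCobd b ∧ S.IsBd b → ∀ {v : V} {f : F} {a : E}, a ≠ b → S.IsGood a → a ∈ S.starOf v →
      a ∈ S.plaqOf f → b ∈ S.starOf v → b ∈ S.plaqOf f →
      (siteConj a (X₀ a) (S.A v) = siteConj b X' (S.A v) ∧ ¬ TrivialAt (S.A v) b ∧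
        ∀ f', Commute (siteOp b X') (S.B f')) ∨
      (siteConj a (Z₀ a) (S.B f) = siteConj b Z' (S.B f) ∧ ¬ TrivialAt (S.B f) b ∧
        ∀ v', Commute (siteOp b Z') (S.A v'))) := by
    intro b
    by_cases hb : S.IsCobd b ∧ S.IsBd b
    · obtain ⟨Z', X', h1, h2, h3, h4⟩ := T.exists_final_at hb.1 hb.2
      exact ⟨Z', X', fun h => absurd hb h, h1, h2, h3, fun _ => h4⟩
    · exact ⟨Z₀ b, X₀ b, fun _ => ⟨rfl, rfl⟩, hZ₀ b, hX₀ b, hanti b, fun h => absurd h hb⟩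
  choose Z X heq hZ hX hZX hbb using hfin
  have T' : S.IsToric Z X := by
    refine ⟨hZ, hX, hZX, fun q hq => ?_, fun q hq => ?_⟩
    · rw [(heq q fun h => hq h.1).1]
      exact hcZ q hq
    · rw [(heq q fun h => hq h.2).2]
      exact hcX q hq
  refine ⟨Z, X, T', ?_⟩
  intro v f a b hab hga hgb ha ha' hb hb'
  by_cases hbd : S.IsBd b
  · by_cases hcb : S.IsCobd b
    · have hna : ¬ (S.IsCobd a ∧ S.IsBd a) := fun h => hga.2 h.1
      rw [(heq a hna).1, (heq a hna).2]
      rcases hbb b ⟨hcb, hbd⟩ hab hga ha ha' hb hb' with h | h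
      · exact Or.inl ⟨hcb, h⟩
      · exact Or.inr ⟨hbd, h⟩
    · obtain ⟨h1, h2⟩ := T'.swap.siteConj_eq hab (S.isGood_swap.2 hga) ha' ha hb' hb hcb
      exact Or.inr ⟨hbd, h1, h2, T'.commZ b hcb⟩
  · have hcb : S.IsCobd b := by
      by_contra h
      exact hgb ⟨hbd, h⟩
    obtain ⟨h1, h2⟩ := T'.siteConj_eq hab hga ha ha' hb hb' hbd
    exact Or.inl ⟨hcb, h1, h2, T'.commX b hbd⟩

end StarPlaquetteSystem

/-! ### Commutation of string operators -/

section StringOperators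

variable {E : Type*} [Fintype E] [DecidableEq E]

/-- The tensor product of the operators `X q` for `q ∈ S`. -/
noncomputable def stringOf (X : E → QubitOp) (S : Finset E) : QOp E :=
  tensorOp fun q => if q ∈ S then X q else 1

theorem stringOf_eq_mul_erase (X : E → QubitOp) {S : Finset E} {a : E} (ha : a ∈ S) :
    stringOf X S = siteOp a (X a) * stringOf X (S.erase a) := by
  rw [stringOf, stringOf, siteOp, tensorOp_mul]
  congr 1
  ext1 e
  rcases eq_or_ne e a with rfl | he
  · simp [ha]
  · simp [he]

theorem commute_stringOf {X : E → QubitOp} {S : Finset E} {h : QOp E}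
    (H : ∀ a ∈ S, Commute (siteOp a (X a)) h) : Commute (stringOf X S) h := by
  induction S using Finset.induction_on with
  | empty =>
    have : stringOf X ∅ = 1 := by simp only [stringOf, Finset.notMem_empty, if_false, tensorOp_one]
    rw [this]
    exact Commute.one_left h
  | insert a S ha ih =>
    rw [stringOf_eq_mul_erase X (Finset.mem_insert_self a S), Finset.erase_insert ha]
    exact (H a (Finset.mem_insert_self a S)).mul_left
      (ih fun e he => H e (Finset.mem_insert_of_mem he))

theorem commute_mul_of_siteConj_eq {a b : E} {X Y : QubitOp} (hX : IsReflection X)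
    (hY : IsReflection Y) {h : QOp E} (H : siteConj a X h = siteConj b Y h)
    (hab : Commute (siteOp a X) (siteOp b Y)) : Commute (siteOp a X * siteOp b Y) h := by
  have e1 := siteOp_mul_siteOp_self hX a
  have e2 := siteOp_mul_siteOp_self hY b
  have h1 := congrArg (fun m => siteOp b Y * m * siteOp a X) H
  simp only [siteConj] at h1
  have e3 : siteOp b Y * (siteOp a X * h * siteOp a X) * siteOp a X =
      siteOp a X * siteOp b Y * h := by
    rw [hab.eq]
    simp only [mul_assoc, e1, mul_one]
  have e4 : siteOp b Y * (siteOp b Y * h * siteOp b Y) * siteOp a X =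
      h * (siteOp a X * siteOp b Y) := by
    rw [hab.eq]
    simp only [← mul_assoc, e2, one_mul]
  rwa [e3, e4] at h1

theorem commute_stringOf_of_pair {X : E → QubitOp} (hX : ∀ q, IsReflection (X q)) {S : Finset E}
    {h : QOp E} {a b : E} (ha : a ∈ S) (hb : b ∈ S) (hab : a ≠ b)
    (H : siteConj a (X a) h = siteConj b (X b) h)
    (H' : ∀ c ∈ S, c ≠ a → c ≠ b → Commute (siteOp c (X c)) h) : Commute (stringOf X S) h := by
  rw [stringOf_eq_mul_erase X ha, stringOf_eq_mul_erase X (Finset.mem_erase.2 ⟨hab.symm, hb⟩),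
    ← mul_assoc]
  refine (commute_mul_of_siteConj_eq (hX a) (hX b) H (siteOp_commute hab _ _)).mul_left
    (commute_stringOf fun c hc => ?_)
  rw [Finset.mem_erase, Finset.mem_erase] at hc
  exact H' c hc.2.2 hc.2.1 hc.1

end StringOperators

/-! ### Routing strings to the boundary or the coboundary -/

/-- Nodes in `I`, joined when they have a common element. -/
def nodeGraph {T E : Type*} (inc : T → Set E) (I : Set T) : SimpleGraph T where
  Adj u v := u ≠ v ∧ u ∈ I ∧ v ∈ I ∧ ∃ e, e ∈ inc u ∧ e ∈ inc v
  symm := ⟨fun _ _ h => ⟨h.1.symm, h.2.2.1, h.2.1, h.2.2.2.imp fun _ h' => ⟨h'.2, h'.1⟩⟩⟩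
  loopless := ⟨fun _ h => h.1 rfl⟩

theorem mem_of_nodeGraph_reachable {T E : Type*} {inc : T → Set E} {I : Set T} {s t : T}
    (hs : s ∈ I) (h : (nodeGraph inc I).Reachable s t) : t ∈ I := by
  obtain ⟨w⟩ := h
  induction w with
  | nil => exact hs
  | cons hadj _ ih => exact ih hadj.2.2.1

/-- Sequences on `ℕ` are easy to concatenate; the values of `e` from `k` on are irrelevant. -/
theorem exists_chain_of_reachable {T E : Type*} [Inhabited E] {inc : T → Set E} {I : Set T}
    {s t : T} (h : (nodeGraph inc I).Reachable s t) :
    ∃ (k : ℕ) (c : ℕ → T) (e : ℕ → E), c 0 = s ∧ c k = t ∧ Set.InjOn c {i | i ≤ k} ∧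
      (∀ i, (nodeGraph inc I).Reachable s (c i)) ∧
      ∀ i < k, e i ∈ inc (c i) ∧ e i ∈ inc (c (i + 1)) := by
  obtain ⟨p, hp⟩ := h.exists_isPath
  have hadj : ∀ i, ∃ e, i < p.length → e ∈ inc (p.getVert i) ∧ e ∈ inc (p.getVert (i + 1)) := by
    intro i
    by_cases hi : i < p.length
    · obtain ⟨e, he⟩ := (p.adj_getVert_succ hi).2.2.2
      exact ⟨e, fun _ => he⟩
    · exact ⟨default, fun h => absurd h hi⟩
  choose e he using hadj
  exact ⟨p.length, p.getVert, e, p.getVert_zero, p.getVert_length, hp.getVert_injOn,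
    fun i => (p.take i).reachable, fun i hi => he i hi⟩

namespace StarPlaquetteSystem

variable {V F E : Type*} [Fintype E] [DecidableEq E] {S : StarPlaquetteSystem V F E}
  {Z X : E → QubitOp}

variable (S) in
/-- The stars all of whose qubits are neither in the boundary nor in the coboundary. -/
def interior : Set V := {v | ∀ q ∈ S.starOf v, S.IsGood q}

variable (S X) in
/-- A string of operators `X q` along a path from the star `s` to the coboundary flips the
operator of that star only. -/
def HasAccess (s : V) : Prop :=
  ∃ (r : ℕ) (c : Fin (r + 1) → V) (e : Fin (r + 1) → E),
    c 0 = s ∧ (∀ i, e i ∈ S.starOf (c i)) ∧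
    (∀ i : Fin r, c i.castSucc ≠ c i.succ ∧ e i.castSucc ∈ S.starOf (c i.succ)) ∧
    Function.Injective e ∧ S.IsCobd (e (Fin.last r)) ∧
    (stringOf X (Finset.univ.image e) * tracelessPart (S.A s) =
      -(tracelessPart (S.A s) * stringOf X (Finset.univ.image e))) ∧
    (∀ v, v ≠ s → Commute (stringOf X (Finset.univ.image e)) (S.A v)) ∧
    ∀ f, Commute (stringOf X (Finset.univ.image e)) (S.B f)

/-- The link of `v` is connected, and each of its steps moves the flip across a plaquette. -/
theorem IsToric.siteConj_eq_of_interior (T : S.IsToric Z X) {v : V} (hv : v ∈ S.interior) {a b : E}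
    (ha : a ∈ S.starOf v) (hb : b ∈ S.starOf v) :
    siteConj a (X a) (S.A v) = siteConj b (X b) (S.A v) := by
  obtain ⟨w⟩ := S.star_conn v a b ha hb
  induction w with
  | nil => rfl
  | cons h _ ih =>
    obtain ⟨hne, h1, h2, f, h3, h4⟩ := h
    rw [← ih h2 hb]
    exact (T.siteConj_eq hne (hv _ h1) h1 h3 h2 h4 (hv _ h2).1).1

/-- The sum `D` of `A` and its flip commutes with `Z e` and `X e` for every `e` of the star, as the
flip may be made at `e`. So `D` is a scalar `c`, the flip of `A` is `c - A`, and taking traces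
identifies `c / 2` with the normalized trace of `A`. -/
theorem IsToric.siteOp_mul_tracelessPart (T : S.IsToric Z X) {v : V} (hv : v ∈ S.interior) {a : E}
    (ha : a ∈ S.starOf v) : siteOp a (X a) * tracelessPart (S.A v) =
      -(tracelessPart (S.A v) * siteOp a (X a)) := by
  set D := S.A v + siteConj a (X a) (S.A v) with hD
  have hXX : ∀ e, siteOp e (X e) * siteOp e (X e) = 1 := fun e =>
    siteOp_mul_siteOp_self (T.reflX e) e
  have hZX : ∀ e, siteOp e (Z e) * siteOp e (X e) = -(siteOp e (X e) * siteOp e (Z e)) := fun e => by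
    rw [← siteOp_mul, ← siteOp_mul, T.anti, siteOp_neg]
  have hDZ : ∀ e ∈ S.starOf v, Commute (siteOp e (Z e)) D := by
    intro e he
    have h1 := T.commZ e (hv e he).2 v
    refine h1.add_right ?_
    rw [T.siteConj_eq_of_interior hv ha he, siteConj]
    rw [Commute, SemiconjBy, ← mul_assoc, ← mul_assoc, hZX, neg_mul, neg_mul, mul_assoc _ _ (S.A v),
      h1.eq, mul_assoc, mul_assoc, mul_assoc, hZX]
    simp only [mul_neg, neg_neg, mul_assoc]
  have hDX : ∀ e ∈ S.starOf v, Commute (siteOp e (X e)) D := by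
    intro e he
    have h1 : siteOp e (X e) * D = D * siteOp e (X e) := by
      rw [hD, T.siteConj_eq_of_interior hv ha he, siteConj, mul_add, add_mul, ← mul_assoc,
        ← mul_assoc, hXX, one_mul, mul_assoc _ (siteOp e (X e)), hXX, mul_one, add_comm]
    exact h1
  have hDt : ∀ e, TrivialAt D e := by
    intro e
    by_cases he : e ∈ S.starOf v
    · rw [trivialAt_iff_block]
      intro x y
      obtain ⟨c, hc⟩ := (T.reflZ e).eq_smul_one_of_commute (T.reflX e) (T.anti e)
        (commute_siteOp_iff.1 (hDZ e he) x y) (commute_siteOp_iff.1 (hDX e he) x y)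
      rw [hc]
      simp
    · have hea : e ≠ a := fun h => he (h ▸ ha)
      exact (S.trivA v e he).add (((trivialAt_siteOp hea _).mul (S.trivA v e he)).mul
        (trivialAt_siteOp hea _))
  obtain ⟨c, hc⟩ := eq_smul_one_of_forall_trivialAt hDt
  have htr : 2 * (S.A v).trace = c * Fintype.card (E → Fin 2) := by
    have h1 := congrArg Matrix.trace hc
    rw [hD, Matrix.trace_add, siteConj, Matrix.trace_mul_comm, ← mul_assoc, hXX, one_mul,
      Matrix.trace_smul, Matrix.trace_one, smul_eq_mul] at h1
    rw [← h1, two_mul]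
  have hcard : (Fintype.card (E → Fin 2) : ℂ) ≠ 0 := by
    exact_mod_cast Fintype.card_ne_zero
  have hdiv : (S.A v).trace / (Fintype.card (E → Fin 2) : ℂ) = c / 2 := by
    field_simp
    linear_combination htr
  have hXA : siteOp a (X a) * S.A v = (c • 1 - S.A v) * siteOp a (X a) := by
    rw [← hc, hD, add_sub_cancel_left, siteConj, mul_assoc, hXX, mul_one]
  rw [tracelessPart, hdiv, mul_sub, sub_mul, hXA, sub_mul]
  simp only [smul_mul_assoc, mul_smul_comm, one_mul, mul_one]
  have : c • siteOp a (X a) = (c / 2) • siteOp a (X a) + (c / 2) • siteOp a (X a) := by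
    rw [← add_smul, add_halves]
  rw [this]
  abel

/-- A string along a path of distinct stars that starts in the interior and ends at the
coboundary. -/
theorem IsToric.hasAccess_of_path (T : S.IsToric Z X) {s : V} (hs : s ∈ S.interior) {r : ℕ}
    (hr : 1 ≤ r) {c : ℕ → V} {e : ℕ → E} (hc0 : c 0 = s) (hce : ∀ i ≤ r, e i ∈ S.starOf (c i))
    (hce' : ∀ i < r, e i ∈ S.starOf (c (i + 1))) (hinj : Set.InjOn c {i | i ≤ r})
    (hgood : ∀ i < r, S.IsGood (e i)) (hlast : S.IsCobd (e r)) (hnt : ¬ TrivialAt (S.A (c r)) (e r))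
    (hXB : ∀ f, Commute (siteOp (e r) (X (e r))) (S.B f))
    (hconj : ∀ i < r, siteConj (e i) (X (e i)) (S.A (c (i + 1))) =
      siteConj (e (i + 1)) (X (e (i + 1))) (S.A (c (i + 1)))) : S.HasAccess X s := by
  have hcne : ∀ i < r, c i ≠ c (i + 1) := fun i hi h => by
    have := hinj (show i ≤ r by omega) (show i + 1 ≤ r by omega) h
    omega
  have hmem : ∀ l < r, ∀ t, e l ∈ S.starOf t → t = c l ∨ t = c (l + 1) := by
    intro l hl t ht
    rcases S.star_le_two (e l) t (c l) (c (l + 1)) ht (hce l hl.le) (hce' l hl) with h | h | h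
    · exact Or.inl h
    · exact Or.inr h
    · exact absurd h (hcne l hl)
  have hmem' : ∀ l < r, ∀ k ≤ r, e l ∈ S.starOf (c k) → k = l ∨ k = l + 1 := by
    intro l hl k hk h
    exact (hmem l hl _ h).imp (fun h => hinj hk (show l ≤ r by omega) h)
      fun h => hinj hk (show l + 1 ≤ r by omega) h
  -- Before the last one, an edge lies in exactly two stars of the path, which are consecutive; the
  -- last edge is in the coboundary, unlike the others.
  have hlt : ∀ i j, i < j → j ≤ r → e i ≠ e j := by
    intro i j hij hj h
    have hjr : j < r := by
      refine lt_of_le_of_ne hj ?_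
      rintro rfl
      exact (hgood i hij).2 (h ▸ hlast)
    have h1 := hmem' i (by omega) j hj (h ▸ hce j hj)
    have h2 := hmem' i (by omega) (j + 1) (by omega) (h ▸ hce' j hjr)
    omega
  have hne : ∀ i ≤ r, ∀ j ≤ r, i ≠ j → e i ≠ e j := by
    intro i hi j hj hij
    rcases lt_or_gt_of_ne hij with h | h
    · exact hlt i j h hj
    · exact (hlt j i h hi).symm
  -- The star beyond the last edge is not disturbed, since `c r` is the only star acting there.
  have htriv : ∀ t, t ≠ c r → TrivialAt (S.A t) (e r) := by
    intro t ht
    by_contra h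
    exact ht (hlast h hnt)
  have hS : ∀ x, x ∈ Finset.univ.image (fun i : Fin (r + 1) => e i) ↔ ∃ i ≤ r, e i = x := by
    intro x
    simp only [Finset.mem_image, Finset.mem_univ, true_and]
    constructor
    · rintro ⟨i, rfl⟩
      exact ⟨i, by omega, rfl⟩
    · rintro ⟨i, hi, rfl⟩
      exact ⟨⟨i, by omega⟩, rfl⟩
  have hother : ∀ t, ∀ l ≤ r, (l < r → t ≠ c l ∧ t ≠ c (l + 1)) → (l = r → t ≠ c r) →
      Commute (siteOp (e l) (X (e l))) (S.A t) := by
    intro t l hl h1 h2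
    rcases lt_or_eq_of_le hl with h | rfl
    · refine S.trivA t _ (fun hm => ?_) _
      rcases hmem l h t hm with h' | h'
      · exact (h1 h).1 h'
      · exact (h1 h).2 h'
    · exact htriv t (h2 rfl) _
  refine ⟨r, fun i => c i, fun i => e i, hc0, fun i => hce i (by omega), fun i => ⟨?_, ?_⟩, ?_,
    by simpa using hlast, ?_, ?_, ?_⟩
  · simpa using hcne i i.2
  · simpa using hce' i i.2
  · intro i j hij
    by_contra h
    exact hne i (by omega) j (by omega) (fun h' => h (Fin.ext h')) hij
  · have h0 : e 0 ∈ Finset.univ.image (fun i : Fin (r + 1) => e i) := (hS _).2 ⟨0, by omega, rfl⟩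
    have h0s : e 0 ∈ S.starOf s := hc0 ▸ hce 0 (by omega)
    rw [stringOf_eq_mul_erase X h0]
    have hrest : Commute (stringOf X ((Finset.univ.image fun i : Fin (r + 1) => e i).erase (e 0)))
        (tracelessPart (S.A s)) := by
      refine commute_stringOf fun x hx => ?_
      rw [Finset.mem_erase, hS] at hx
      obtain ⟨hx0, l, hl, rfl⟩ := hx
      have hl0 : l ≠ 0 := by rintro rfl; exact hx0 rfl
      refine Commute.sub_right ?_ ((Commute.one_right _).smul_right _)
      refine hother s l hl (fun hl' => ⟨?_, ?_⟩) (fun hl' => ?_)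
      · rw [← hc0]
        intro h
        exact hl0 (hinj (show 0 ≤ r by omega) hl h).symm
      · rw [← hc0]
        intro h
        have := hinj (show 0 ≤ r by omega) (show l + 1 ≤ r by omega) h
        omega
      · rw [← hc0]
        intro h
        have := hinj (show 0 ≤ r by omega) (show r ≤ r by omega) h
        omega
    rw [mul_assoc, hrest.eq, ← mul_assoc, T.siteOp_mul_tracelessPart hs h0s, neg_mul, mul_assoc]
  · intro t ht
    -- A star entered along `e i` is left along `e (i + 1)`, and the two flips cancel. Stars off the
    -- path are not flipped.
    by_cases hk : ∃ i < r, c (i + 1) = t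
    · obtain ⟨i, hi, rfl⟩ := hk
      refine commute_stringOf_of_pair T.reflX (a := e i) (b := e (i + 1))
        ((hS _).2 ⟨i, by omega, rfl⟩) ((hS _).2 ⟨i + 1, by omega, rfl⟩)
        (hlt i (i + 1) (by omega) (by omega)) (hconj i hi) ?_
      intro x hx hxa hxb
      obtain ⟨l, hl, rfl⟩ := (hS x).1 hx
      have hl1 : l ≠ i := by rintro rfl; exact hxa rfl
      have hl2 : l ≠ i + 1 := by rintro rfl; exact hxb rfl
      refine hother _ l hl (fun hl' => ⟨fun h => ?_, fun h => ?_⟩) (fun hl' h => ?_)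
      · exact hl2 (hinj (show i + 1 ≤ r by omega) hl h).symm
      · have := hinj (show i + 1 ≤ r by omega) (show l + 1 ≤ r by omega) h
        omega
      · have := hinj (show i + 1 ≤ r by omega) (show r ≤ r by omega) h
        omega
    · push Not at hk
      have hk' : ∀ i ≤ r, t ≠ c i := by
        intro i hi h
        rcases i with _ | i
        · exact ht (h.trans hc0)
        · exact hk i (by omega) h.symm
      refine commute_stringOf fun x hx => ?_
      obtain ⟨l, hl, rfl⟩ := (hS x).1 hx
      exact hother t l hl (fun hl' => ⟨hk' l hl, hk' (l + 1) hl'⟩) fun _ => hk' r le_rfl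
  · intro f
    refine commute_stringOf fun x hx => ?_
    obtain ⟨l, hl, rfl⟩ := (hS x).1 hx
    rcases lt_or_eq_of_le hl with h | rfl
    · exact T.commX _ (hgood l h).1 f
    · exact hXB f

/-- The same when the path starts with a connection through the interior, followed by stars that
cannot be reached in this way. -/
theorem IsToric.hasAccess_of_tail (T : S.IsToric Z X) {s : V} (hs : s ∈ S.interior) {m : ℕ}
    (hm : 1 ≤ m) {g : ℕ → V} {q : ℕ → E}
    (hg0 : (nodeGraph S.starOf S.interior).Reachable s (g 0))
    (hout : ∀ i, 0 < i → i ≤ m → ¬ (nodeGraph S.starOf S.interior).Reachable s (g i))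
    (hinj : Set.InjOn g {i | i ≤ m})
    (hgq : ∀ i ≤ m, q i ∈ S.starOf (g i)) (hgq' : ∀ i < m, q i ∈ S.starOf (g (i + 1)))
    (hgood : ∀ i < m, S.IsGood (q i)) (hlast : S.IsCobd (q m)) (hnt : ¬ TrivialAt (S.A (g m)) (q m))
    (hXB : ∀ f, Commute (siteOp (q m) (X (q m))) (S.B f))
    (hconj : ∀ i < m, siteConj (q i) (X (q i)) (S.A (g (i + 1))) =
      siteConj (q (i + 1)) (X (q (i + 1))) (S.A (g (i + 1)))) : S.HasAccess X s := by
  have : Inhabited E := ⟨q 0⟩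
  obtain ⟨k, c, e, hc0, hck, hcinj, hcr, hce⟩ := exists_chain_of_reachable hg0
  have hint : ∀ i, c i ∈ S.interior := fun i => mem_of_nodeGraph_reachable hs (hcr i)
  -- At index `k` the star is still `c k = g 0`, but the edge is already `q 0`, which leaves it.
  set C : ℕ → V := fun i => if i ≤ k then c i else g (i - k) with hC
  set D : ℕ → E := fun i => if i < k then e i else q (i - k) with hD
  have C1 : ∀ i ≤ k, C i = c i := fun i hi => if_pos hi
  have C2 : ∀ i, C (k + i) = g i := by
    intro i
    rcases Nat.eq_zero_or_pos i with rfl | hi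
    · rw [add_zero, C1 k le_rfl, hck]
    · simp only [hC]
      rw [if_neg (by omega), Nat.add_sub_cancel_left]
  have D1 : ∀ i < k, D i = e i := fun i hi => if_pos hi
  have D2 : ∀ i, D (k + i) = q i := fun i => by
    simp only [hD]
    rw [if_neg (by omega), Nat.add_sub_cancel_left]
  have hsplit : ∀ i, i < k ∨ ∃ j, i = k + j := fun i => by
    rcases lt_or_ge i k with h | h
    · exact Or.inl h
    · exact Or.inr ⟨i - k, by omega⟩
  have hCD : ∀ i ≤ k + m, D i ∈ S.starOf (C i) := by
    intro i hi
    rcases hsplit i with h | ⟨j, rfl⟩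
    · rw [C1 i h.le, D1 i h]
      exact (hce i h).1
    · rw [C2, D2]
      exact hgq j (by omega)
  have hCD' : ∀ i < k + m, D i ∈ S.starOf (C (i + 1)) := by
    intro i hi
    rcases hsplit i with h | ⟨j, rfl⟩
    · rw [C1 (i + 1) h, D1 i h]
      exact (hce i h).2
    · rw [add_assoc, C2, D2]
      exact hgq' j (by omega)
  refine T.hasAccess_of_path hs (r := k + m) (c := C) (e := D) (by omega)
    ((C1 0 (by omega)).trans hc0) hCD hCD' ?_ ?_ (by rwa [D2]) (by rwa [C2, D2])
    (by rwa [D2]) ?_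
  · intro i hi j hj hij
    simp only [Set.mem_ofPred_eq] at hi hj
    -- Stars of the chain are reachable through the interior, those of the tail after `g 0` are not.
    have aux : ∀ i ≤ k, ∀ j, 0 < j → j ≤ m → C i ≠ C (k + j) := by
      intro i hi j hj hjm h
      rw [C1 i hi, C2] at h
      exact hout j hj hjm (h ▸ hcr i)
    rcases le_or_gt i k with h1 | h1 <;> rcases le_or_gt j k with h2 | h2
    · rw [C1 i h1, C1 j h2] at hij
      exact hcinj h1 h2 hij
    · obtain ⟨j, rfl⟩ := Nat.exists_eq_add_of_lt h2
      exact absurd hij (aux i h1 (j + 1) (by omega) (by omega))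
    · obtain ⟨i, rfl⟩ := Nat.exists_eq_add_of_lt h1
      exact absurd hij.symm (aux j h2 (i + 1) (by omega) (by omega))
    · obtain ⟨i, rfl⟩ := Nat.exists_eq_add_of_lt h1
      obtain ⟨j, rfl⟩ := Nat.exists_eq_add_of_lt h2
      rw [add_assoc, add_assoc, C2, C2] at hij
      have := hinj (show i + 1 ≤ m by omega) (show j + 1 ≤ m by omega) hij
      omega
  · intro i hi
    rcases hsplit i with h | ⟨j, rfl⟩
    · rw [D1 i h]
      exact hint i _ (hce i h).1
    · rw [D2]
      exact hgood j (by omega)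
  · intro i hi
    rcases hsplit i with h | ⟨j, rfl⟩
    · refine T.siteConj_eq_of_interior ?_ (hCD' i hi) (hCD (i + 1) hi)
      rw [C1 (i + 1) h]
      exact hint _
    · rw [add_assoc, C2, D2, D2]
      exact hconj j (by omega)

variable (S) in
/-- The stars connected to `s` through interior stars. -/
abbrev ReachInterior (s t : V) : Prop := (nodeGraph S.starOf S.interior).Reachable s t

theorem interior_swap : S.swap.interior = {f | ∀ q ∈ S.plaqOf f, S.IsGood q} := by
  ext f
  exact forall₂_congr fun q _ => S.isGood_swap

/-- Turning about `v'` from `q₀`, the flips of `A v'` agree up to the first bad edge, where `final`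
applies. An `X`-string then goes through `v` and `v'`; a `Z`-string follows the plaquettes passed
while turning. -/
theorem IsStringToric.hasAccess_of_exit (T : S.IsStringToric Z X) {s : V} {p : F}
    (hs : s ∈ S.interior) (hp : p ∈ S.swap.interior) {v v' : V} {f : F} {q₀ : E}
    (hv : S.ReachInterior s v) (hf : S.swap.ReachInterior p f) (hqv : q₀ ∈ S.starOf v)
    (hqv' : q₀ ∈ S.starOf v') (hqf : q₀ ∈ S.plaqOf f) (hv' : v' ∉ S.interior) :
    S.HasAccess X s ∨ S.swap.HasAccess Z p := by
  have hvI := mem_of_nodeGraph_reachable hs hv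
  have hv'out : ¬ S.ReachInterior s v' := fun h => hv' (mem_of_nodeGraph_reachable hs h)
  have hvv' : v ≠ v' := fun h => hv' (h ▸ hvI)
  obtain ⟨x, hx, hxb⟩ : ∃ x ∈ S.starOf v', ¬ S.IsGood x := by
    simpa [interior] using hv'
  obtain ⟨w, hw⟩ := (S.star_conn v' q₀ x hqv' hx).exists_isPath
  set y : ℕ → E := w.getVert with hy
  have hbad : ∃ i, i ≤ w.length ∧ ¬ S.IsGood (y i) :=
    ⟨w.length, le_rfl, by rw [hy, w.getVert_length]; exact hxb⟩
  classical
  -- The first bad edge met around `v'`; `m ≥ 1` because `q₀` belongs to the interior star `v`.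
  set m := Nat.find hbad with hm
  obtain ⟨hmw, hmb⟩ := Nat.find_spec hbad
  rw [← hm] at hmw hmb
  have hgood : ∀ i < m, S.IsGood (y i) := by
    intro i hi
    by_contra h
    exact Nat.find_min hbad hi ⟨by omega, h⟩
  have hy0 : y 0 = q₀ := w.getVert_zero
  have hm1 : 1 ≤ m := by
    by_contra h
    have : m = 0 := by omega
    rw [this, hy0] at hmb
    exact hmb (hvI _ hqv)
  have hyinj : ∀ i ≤ m, ∀ j ≤ m, y i = y j → i = j := fun i hi j hj h =>
    hw.getVert_injOn (show i ≤ w.length by omega) (show j ≤ w.length by omega) h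
  have hadj : ∀ i, ∃ h, i < m → y i ∈ S.plaqOf h ∧ y (i + 1) ∈ S.plaqOf h := by
    intro i
    by_cases hi : i < m
    · obtain ⟨h, hh⟩ := (w.adj_getVert_succ (show i < w.length by omega)).2.2.2
      exact ⟨h, fun _ => hh⟩
    · exact ⟨f, fun h => absurd h hi⟩
  choose G hG using hadj
  have hyv : ∀ i ≤ m, y i ∈ S.starOf v' := by
    intro i hi
    rcases i with _ | i
    · rwa [hy0]
    · exact (w.adj_getVert_succ (show i < w.length by omega)).2.2.1
  obtain ⟨n, hn⟩ : ∃ n, m = n + 1 := ⟨m - 1, by omega⟩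
  have hfin := T.final (v := v') (f := G n) (a := y n) (b := y m)
    (fun h => by have := hyinj n (by omega) m le_rfl h; omega) (hgood n (by omega)) hmb
    (hyv n (by omega)) (hG n (by omega)).1 (hyv m le_rfl) (hn ▸ (hG n (by omega)).2)
  rcases hfin with ⟨h1, h2, h3, h4⟩ | ⟨h1, h2, h3, h4⟩
  · left
    have hchain : ∀ i ≤ n, siteConj (y 0) (X (y 0)) (S.A v') = siteConj (y i) (X (y i)) (S.A v') := by
      intro i
      induction i with
      | zero => intro _; rfl
      | succ i ih =>
        intro hi
        rw [ih (by omega)]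
        exact (T.siteConj_eq (fun h => by have := hyinj i (by omega) (i + 1) (by omega) h; omega)
          (hgood i (by omega)) (hyv i (by omega)) (hG i (by omega)).1 (hyv _ (by omega))
          (hG i (by omega)).2 (hgood (i + 1) (by omega)).1).1
    -- The path enters `v'` through `q₀` and leaves it at once through `y m`.
    refine T.hasAccess_of_tail hs (m := 1) le_rfl (g := fun i => if i = 0 then v else v')
      (q := fun i => if i = 0 then q₀ else y m) (by simpa using hv) ?_ ?_ ?_ ?_ ?_
      (by simpa using h1) (by simpa using h3) (by simpa using h4) ?_
    · intro i hi hi1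
      have : i ≠ 0 := by omega
      simpa [this] using hv'out
    · intro i hi j hj hij
      simp only [Set.mem_ofPred_eq] at hi hj
      have hi' : i = 0 ∨ i = 1 := by omega
      have hj' : j = 0 ∨ j = 1 := by omega
      rcases hi' with rfl | rfl <;> rcases hj' with rfl | rfl
      · rfl
      · exact absurd (by simpa using hij) hvv'
      · exact absurd (by simpa using hij.symm) hvv'
      · rfl
    · intro i hi
      have hi' : i = 0 ∨ i = 1 := by omega
      rcases hi' with rfl | rfl
      · simpa using hqv
      · simpa using hyv m le_rfl
    · intro i hi
      obtain rfl : i = 0 := by omega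
      simpa using hqv'
    · intro i hi
      obtain rfl : i = 0 := by omega
      simpa [hy0] using hgood 0 (by omega)
    · intro i hi
      obtain rfl : i = 0 := by omega
      have := (hchain n le_rfl).trans h2
      rw [hy0] at this
      simpa using this
  · right
    set g : ℕ → F := fun i => if i = 0 then f else G (i - 1) with hg
    have hg0 : g 0 = f := rfl
    have hgs : ∀ i, g (i + 1) = G i := fun i => rfl
    have hyg : ∀ i ≤ m, y i ∈ S.plaqOf (g i) := by
      intro i hi
      rcases i with _ | i
      · rw [hg0, hy0]
        exact hqf
      · rw [hgs]
        exact (hG i (by omega)).2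
    have hyg' : ∀ i < m, y i ∈ S.plaqOf (g (i + 1)) := fun i hi => (hG i hi).1
    set R : ℕ → Prop := fun i => S.swap.ReachInterior p (g i) with hR
    have hR0 : R 0 := hf
    -- The tail starts at the last plaquette reachable through the interior, so it cannot meet the
    -- chain from `p` again. `j < m`, as `g m` contains the bad edge `y m`.
    set j := Nat.findGreatest R m with hj
    have hRj : R j := Nat.findGreatest_spec (Nat.zero_le m) hR0
    have hjm : j ≤ m := Nat.findGreatest_le m
    have hjlt : j < m := by
      refine lt_of_le_of_ne hjm fun h => ?_
      have := mem_of_nodeGraph_reachable hp hRj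
      rw [h, interior_swap] at this
      exact hmb (this _ (hyg m le_rfl))
    have hnR : ∀ i, j < i → i ≤ m → ¬ R i := fun i h h' => Nat.findGreatest_is_greatest h h'
    have hpos : ∀ i ≤ m - j, j + i ≤ m := fun i hi => by omega
    refine T.swap.hasAccess_of_tail hp (m := m - j) (by omega) (g := fun i => g (j + i))
      (q := fun i => y (j + i)) hRj (fun i hi hi' => hnR _ (by omega) (by omega)) ?_
      (fun i hi => hyg _ (hpos i hi)) (fun i hi => hyg' (j + i) (by omega))
      (fun i hi => S.isGood_swap.2 (hgood _ (by omega))) ?_ ?_ ?_ ?_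
    · have aux : ∀ i k, i < k → k ≤ m - j → g (j + i) ≠ g (j + k) := by
        intro i k hik hk h
        rcases Nat.eq_zero_or_pos i with rfl | hi
        · exact hnR (j + k) (by omega) (by omega) (by
            rw [hR]
            simp only
            rw [← h]
            exact hRj)
        · obtain ⟨a, ha⟩ : ∃ a, j + i = a + 1 := ⟨j + i - 1, by omega⟩
          obtain ⟨b, hb⟩ : ∃ b, j + k = b + 1 := ⟨j + k - 1, by omega⟩
          rw [ha, hb, hgs, hgs] at h
          -- If `G a` and `G b` coincided, this plaquette would share three edges with `v'`.
          rcases S.shared_le_two v' (G a) (y a) (y (a + 1)) (y (b + 1)) (hyv _ (by omega))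
            (hyv _ (by omega)) (hyv _ (by omega)) (hG a (by omega)).1 (hG a (by omega)).2
            (h ▸ (hG b (by omega)).2) with h' | h' | h'
          · have := hyinj _ (by omega) _ (by omega) h'
            omega
          · have := hyinj _ (by omega) _ (by omega) h'
            omega
          · have := hyinj _ (by omega) _ (by omega) h'
            omega
      intro i hi k hk hik
      simp only [Set.mem_ofPred_eq] at hi hk
      rcases lt_trichotomy i k with h | h | h
      · exact absurd hik (aux i k h hk)
      · exact h
      · exact absurd hik.symm (aux k i h hi)
    · simp only [Nat.add_sub_cancel' hjm]
      exact h1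
    · simp only [Nat.add_sub_cancel' hjm]
      rw [hn, hgs]
      rw [hn] at h3
      exact h3
    · simp only [Nat.add_sub_cancel' hjm]
      exact h4
    · intro i hi
      change siteConj (y (j + i)) (Z (y (j + i))) (S.B (G (j + i))) =
        siteConj (y (j + i + 1)) (Z (y (j + i + 1))) (S.B (G (j + i)))
      rcases lt_or_eq_of_le (show j + i ≤ n by omega) with h | h
      · exact (T.swap.siteConj_eq
          (fun h' => by have := hyinj _ (by omega) _ (by omega) h'; omega)
          (S.isGood_swap.2 (hgood (j + i) (by omega))) (hG _ (by omega)).1 (hyv _ (by omega))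
          (hG _ (by omega)).2 (hyv _ (by omega)) (hgood (j + i + 1) (by omega)).2).1
      · rw [h]
        rw [hn] at h2
        exact h2

/-- An adjacent pair of an interior star and an interior plaquette has access to the boundary or
the coboundary as soon as the component of the star contains one of their qubits. -/
theorem IsStringToric.hasAccess (T : S.IsStringToric Z X) {s : V} {p : F} (hs : s ∈ S.interior)
    (hp : p ∈ S.swap.interior) {e₀ : E} (he₀ : e₀ ∈ S.starOf s) (he₀' : e₀ ∈ S.plaqOf p) {v : V}
    (hv : (nodeGraph S.starOf Set.univ).Reachable s v) (hvI : v ∉ S.interior) :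
    S.HasAccess X s ∨ S.swap.HasAccess Z p := by
  by_contra hno
  have exit₁ : ∀ {u u' : V} {f : F} {e : E}, S.ReachInterior s u → S.swap.ReachInterior p f →
      e ∈ S.starOf u → e ∈ S.starOf u' → e ∈ S.plaqOf f → u' ∈ S.interior := by
    intro u u' f e h1 h2 h3 h4 h5
    by_contra h
    exact hno (T.hasAccess_of_exit hs hp h1 h2 h3 h4 h5 h)
  have exit₂ : ∀ {u : V} {f f' : F} {e : E}, S.ReachInterior s u → S.swap.ReachInterior p f →
      e ∈ S.starOf u → e ∈ S.plaqOf f → e ∈ S.plaqOf f' → f' ∈ S.swap.interior := by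
    intro u f f' e h1 h2 h3 h4 h5
    by_contra h
    exact hno (T.swap.hasAccess_of_exit hp hs h2 h1 h4 h5 h3 h).symm
  -- Without access the exploration never leaves the interior, so it exhausts the component. The
  -- reached plaquette touching `u` is carried along to keep `exit₁` and `exit₂` applicable.
  have key : ∀ u, (nodeGraph S.starOf Set.univ).Reachable s u → S.ReachInterior s u ∧
      ∃ f e, S.swap.ReachInterior p f ∧ e ∈ S.starOf u ∧ e ∈ S.plaqOf f := by
    intro u hu
    rw [SimpleGraph.reachable_iff_reflTransGen] at hu
    induction hu with
    | refl => exact ⟨SimpleGraph.Reachable.refl _, p, e₀, SimpleGraph.Reachable.refl _, he₀, he₀'⟩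
    | @tail b c _ hadj ih =>
      obtain ⟨hb, f, e, hf, he, hef⟩ := ih
      obtain ⟨hne, -, -, e₁, he₁, he₁'⟩ := hadj
      -- Turning about `b`, each plaquette passed is interior by `exit₂`, so some reached plaquette
      -- contains the edge towards the next star.
      have around : ∀ x, (linkGraph (S.starOf b) S.plaqOf).Reachable e x →
          ∃ f', S.swap.ReachInterior p f' ∧ x ∈ S.plaqOf f' := by
        intro x hx
        rw [SimpleGraph.reachable_iff_reflTransGen] at hx
        induction hx with
        | refl => exact ⟨f, hf, hef⟩
        | @tail x y _ hxy ih' =>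
          obtain ⟨f', hf', hxf'⟩ := ih'
          obtain ⟨-, hxb, -, f'', hxf'', hyf''⟩ := hxy
          refine ⟨f'', ?_, hyf''⟩
          rcases eq_or_ne f' f'' with rfl | hff
          · exact hf'
          · exact hf'.trans (SimpleGraph.Adj.reachable ⟨hff, mem_of_nodeGraph_reachable hp hf',
              exit₂ hb hf' hxb hxf' hxf'', x, hxf', hxf''⟩)
      obtain ⟨f', hf', hef'⟩ := around e₁ (S.star_conn b e e₁ he he₁)
      have hc := exit₁ hb hf' he₁ he₁' hef'
      exact ⟨hb.trans (SimpleGraph.Adj.reachable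
        ⟨hne, mem_of_nodeGraph_reachable hs hb, hc, e₁, he₁, he₁'⟩), f', e₁, hf', he₁', hef'⟩
  exact hvI (mem_of_nodeGraph_reachable hs (key v hv).1)

end StarPlaquetteSystem

/-! ### A reflection commuting with all terms makes its qubit classical -/

section Classical

theorem mem_eigenspace_iff {P : QubitOp} {σ : ℂ} {φ : Fin 2 → ℂ} :
    φ ∈ LinearMap.ker (Matrix.mulVecLin (P - σ • 1)) ↔ P.mulVec φ = σ • φ := by
  rw [LinearMap.mem_ker, Matrix.mulVecLin_apply, Matrix.sub_mulVec, Matrix.smul_mulVec,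
    Matrix.one_mulVec, sub_eq_zero]

theorem IsReflection.isCompl_eigenspaces {P : QubitOp} (hP : IsReflection P) :
    IsCompl (LinearMap.ker (Matrix.mulVecLin (P - (1 : ℂ) • 1)))
      (LinearMap.ker (Matrix.mulVecLin (P - (-1 : ℂ) • 1))) := by
  constructor
  · rw [Submodule.disjoint_def]
    intro φ h1 h2
    rw [mem_eigenspace_iff] at h1 h2
    rw [h1, one_smul, neg_one_smul, eq_neg_iff_add_eq_zero, ← two_smul ℂ] at h2
    exact (smul_eq_zero.1 h2).resolve_left two_ne_zero
  · rw [codisjoint_iff, Submodule.eq_top_iff']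
    intro φ
    rw [Submodule.mem_sup]
    have hPP : P.mulVec (P.mulVec φ) = φ := by rw [Matrix.mulVec_mulVec, hP.sq, Matrix.one_mulVec]
    refine ⟨(2⁻¹ : ℂ) • (φ + P.mulVec φ), ?_, (2⁻¹ : ℂ) • (φ - P.mulVec φ), ?_, ?_⟩
    · rw [mem_eigenspace_iff, Matrix.mulVec_smul, Matrix.mulVec_add, hPP, one_smul, add_comm]
    · rw [mem_eigenspace_iff, Matrix.mulVec_smul, Matrix.mulVec_sub, hPP, neg_one_smul,
        ← smul_neg, neg_sub]
    · rw [← smul_add, add_add_sub_cancel, ← two_smul ℂ, smul_smul, inv_mul_cancel₀ two_ne_zero,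
        one_smul]

theorem IsReflection.finrank_eigenspace_lt {P : QubitOp} (hP : IsReflection P) (σ : ℂ) :
    Module.finrank ℂ (LinearMap.ker (Matrix.mulVecLin (P - σ • 1))) < 2 := by
  have h : LinearMap.ker (Matrix.mulVecLin (P - σ • 1)) ≠ ⊤ := by
    intro h
    apply hP.ne_smul_one σ
    refine Matrix.mulVec_injective (funext fun φ => ?_)
    rw [Matrix.smul_mulVec, Matrix.one_mulVec, ← mem_eigenspace_iff, h]
    trivial
  simpa using Submodule.finrank_lt h

theorem IsReflection.finrank_eigenspaces {P : QubitOp} (hP : IsReflection P) :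
    Module.finrank ℂ (LinearMap.ker (Matrix.mulVecLin (P - (1 : ℂ) • 1))) = 1 ∧
      Module.finrank ℂ (LinearMap.ker (Matrix.mulVecLin (P - (-1 : ℂ) • 1))) = 1 := by
  have h1 := hP.finrank_eigenspace_lt 1
  have h2 := hP.finrank_eigenspace_lt (-1)
  have h3 := Submodule.finrank_add_eq_of_isCompl hP.isCompl_eigenspaces
  have h4 : Module.finrank ℂ (Fin 2 → ℂ) = 2 := by simp
  omega

variable {E : Type*} [Fintype E] [DecidableEq E]

theorem mem_qubitSubspace_eigenspace_iff {q : E} {P : QubitOp} {σ : ℂ}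
    {ψ : (E → Fin 2) → ℂ} :
    ψ ∈ qubitSubspace q (LinearMap.ker (Matrix.mulVecLin (P - σ • 1))) ↔
      (siteOp q P).mulVec ψ = σ • ψ := by
  have h0 : ψ ∈ qubitSubspace q (LinearMap.ker (Matrix.mulVecLin (P - σ • 1))) ↔
      ∀ x : E → Fin 2, (fun i => ψ (Function.update x q i)) ∈
        LinearMap.ker (Matrix.mulVecLin (P - σ • 1)) := Iff.rfl
  rw [h0]
  simp only [mem_eigenspace_iff]
  constructor
  · intro h
    ext1 x
    have := congrFun (h x) (x q)
    rw [siteOp_mulVec_apply]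
    simpa [Matrix.mulVec, dotProduct] using this
  · intro h x
    ext1 i
    have := congrFun h (Function.update x q i)
    rw [siteOp_mulVec_apply] at this
    simpa [Matrix.mulVec, dotProduct] using this

variable {V F : Type*} {K : PolygonalComplex V E F}

theorem CLHInstance.isClassical_of_commute (H : CLHInstance K) {q : E} {P : QubitOp}
    (hP : IsReflection P) (h : ∀ t, Commute (siteOp q P) (H.term t)) : H.IsClassical q := by
  have hinv : ∀ (σ : ℂ) (t : V ⊕ F),
      ∀ ψ ∈ qubitSubspace q (LinearMap.ker (Matrix.mulVecLin (P - σ • 1))),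
        (H.term t).mulVec ψ ∈ qubitSubspace q (LinearMap.ker (Matrix.mulVecLin (P - σ • 1))) := by
    intro σ t ψ hψ
    rw [mem_qubitSubspace_eigenspace_iff] at hψ ⊢
    rw [Matrix.mulVec_mulVec, (h t).eq, ← Matrix.mulVec_mulVec, hψ, Matrix.mulVec_smul]
  refine ⟨![LinearMap.ker (Matrix.mulVecLin (P - (1 : ℂ) • 1)),
    LinearMap.ker (Matrix.mulVecLin (P - (-1 : ℂ) • 1))], hP.isCompl_eigenspaces, fun i => ?_⟩
  fin_cases i
  · exact ⟨hP.finrank_eigenspaces.1, hinv 1⟩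
  · exact ⟨hP.finrank_eigenspaces.2, hinv (-1)⟩

end Classical

/-! ### Incidences in a polygonal surface -/

namespace PolygonalComplex

variable {V E F : Type*} {K : PolygonalComplex V E F}

theorem exists_ne_ends (e : E) : ∃ v w, v ≠ w ∧ K.ends e = s(v, w) := by
  have h := K.ends_ne e
  induction hs : K.ends e using Sym2.ind with
  | _ v w => exact ⟨v, w, by rintro rfl; exact h (by rw [hs]; simp), rfl⟩

theorem star_inter {v v' : V} {a b : E} (hv : v ≠ v') (ha : v ∈ K.ends a) (ha' : v' ∈ K.ends a)
    (hb : v ∈ K.ends b) (hb' : v' ∈ K.ends b) : a = b :=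
  K.ends_inj (((Sym2.mem_and_mem_iff hv).1 ⟨ha, ha'⟩).trans
    ((Sym2.mem_and_mem_iff hv).1 ⟨hb, hb'⟩).symm)

theorem star_le_two {e : E} {u v w : V} (hu : u ∈ K.ends e) (hv : v ∈ K.ends e)
    (hw : w ∈ K.ends e) : u = v ∨ u = w ∨ v = w := by
  obtain ⟨a, b, -, h⟩ := K.exists_ne_ends e
  rw [h, Sym2.mem_iff] at hu hv hw
  rcases hu with rfl | rfl <;> rcases hv with rfl | rfl <;> rcases hw with rfl | rfl <;> simp

/-- A common edge brings two common vertices. This excludes an intersection in one vertex, and in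
the other case identifies the edge, which is determined by its endpoints. -/
theorem plaq_inter {f g : F} {a b : E} (hfg : f ≠ g) (ha : a ∈ K.bd f) (ha' : a ∈ K.bd g)
    (hb : b ∈ K.bd f) (hb' : b ∈ K.bd g) : a = b := by
  have key : ∀ c, c ∈ K.bd f → c ∈ K.bd g → ∀ v ∈ K.ends c,
      v ∈ {v | (∃ e ∈ K.bd f, v ∈ K.ends e) ∧ (∃ e ∈ K.bd g, v ∈ K.ends e)} :=
    fun c hc hc' v hv => ⟨⟨c, hc, hv⟩, ⟨c, hc', hv⟩⟩
  rcases K.face_inter f g hfg with h | ⟨e, -, -, h⟩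
  · obtain ⟨v, w, hvw, hs⟩ := K.exists_ne_ends a
    exact absurd (h (key a ha ha' v (by rw [hs]; simp)) (key a ha ha' w (by rw [hs]; simp))) hvw
  · have aux : ∀ c, c ∈ K.bd f → c ∈ K.bd g → c = e := by
      intro c hc hc'
      obtain ⟨v, w, hvw, hs⟩ := K.exists_ne_ends c
      have hv := key c hc hc' v (by rw [hs]; simp)
      have hw := key c hc hc' w (by rw [hs]; simp)
      rw [h] at hv hw
      exact star_inter hvw (by rw [hs]; simp) (by rw [hs]; simp) hv hw
    rw [aux a ha ha', aux b hb hb']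

theorem plaq_le_two (hK : K.IsSurface) {e : E} {u v w : F} (hu : e ∈ K.bd u) (hv : e ∈ K.bd v)
    (hw : e ∈ K.bd w) : u = v ∨ u = w ∨ v = w := by
  by_contra! hc
  have h1 : ({u, v, w} : Set F).encard = 3 := Set.encard_eq_three.2
    ⟨u, v, w, hc.1, hc.2.1, hc.2.2, rfl⟩
  have h2 : ({u, v, w} : Set F) ⊆ {f | e ∈ K.bd f} := by
    rintro x (rfl | rfl | rfl)
    · exact hu
    · exact hv
    · exact hw
  have h3 := (Set.encard_le_encard h2).trans (hK.1 e).2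
  rw [h1] at h3
  exact absurd h3 (by decide)

/-- The sides of a face at one of its vertices. -/
theorem exists_two_sides (f : F) (v : V) (h : ∃ e ∈ K.bd f, v ∈ K.ends e) :
    ∃ a b, a ≠ b ∧ ∀ e, (e ∈ K.bd f ∧ v ∈ K.ends e) ↔ e = a ∨ e = b := by
  obtain ⟨n, hn, p, d, hp, hd, hbd⟩ := K.bd_polygon f
  have : Fact (2 < n) := ⟨hn⟩
  have : Fact (1 < n) := ⟨by omega⟩
  -- Here `n ≥ 3` matters: in a two-sided polygon both sides would have the same endpoints.
  have h2 : (2 : ZMod n) ≠ 0 := by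
    intro h
    have h' : ((2 : ℕ) : ZMod n) = 0 := by exact_mod_cast h
    have := Nat.le_of_dvd (by omega) ((ZMod.natCast_eq_zero_iff 2 n).1 h')
    omega
  obtain ⟨k, rfl⟩ : ∃ k, v = p k := by
    obtain ⟨e, he, hv⟩ := h
    rw [hbd] at he
    obtain ⟨i, rfl⟩ := he
    rw [hd, Sym2.mem_iff] at hv
    rcases hv with rfl | rfl
    · exact ⟨i, rfl⟩
    · exact ⟨i + 1, rfl⟩
  refine ⟨d (k - 1), d k, ?_, fun e => ?_⟩
  · intro h
    have h1 := hd (k - 1)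
    rw [h, hd k, sub_add_cancel, Sym2.eq_iff] at h1
    rcases h1 with ⟨h1, -⟩ | ⟨-, h1⟩
    · have h3 := hp h1
      exact one_ne_zero (sub_eq_self.1 h3.symm)
    · have h3 := hp h1
      apply h2
      linear_combination h3
  · rw [hbd]
    constructor
    · rintro ⟨⟨i, rfl⟩, hv⟩
      rw [hd, Sym2.mem_iff] at hv
      rcases hv with h | h
      · right; rw [hp h]
      · left; rw [hp h, add_sub_cancel_right]
    · rintro (rfl | rfl)
      · exact ⟨⟨_, rfl⟩, by rw [hd, sub_add_cancel]; simp⟩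
      · exact ⟨⟨_, rfl⟩, by rw [hd]; simp⟩

theorem exists_shared {v : V} {f : F} {e : E} (hv : v ∈ K.ends e) (hf : e ∈ K.bd f) :
    ∃ e', e' ≠ e ∧ v ∈ K.ends e' ∧ e' ∈ K.bd f := by
  obtain ⟨a, b, hab, h⟩ := K.exists_two_sides f v ⟨e, hf, hv⟩
  rcases (h e).1 ⟨hf, hv⟩ with rfl | rfl
  · exact ⟨b, hab.symm, ((h b).2 (Or.inr rfl)).2, ((h b).2 (Or.inr rfl)).1⟩
  · exact ⟨a, hab, ((h a).2 (Or.inl rfl)).2, ((h a).2 (Or.inl rfl)).1⟩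

theorem shared_le_two {v : V} {f : F} {x y z : E} (hx : v ∈ K.ends x) (hy : v ∈ K.ends y)
    (hz : v ∈ K.ends z) (hx' : x ∈ K.bd f) (hy' : y ∈ K.bd f) (hz' : z ∈ K.bd f) :
    x = y ∨ x = z ∨ y = z := by
  obtain ⟨a, b, -, h⟩ := K.exists_two_sides f v ⟨x, hx', hx⟩
  rcases (h x).1 ⟨hx', hx⟩ with rfl | rfl <;> rcases (h y).1 ⟨hy', hy⟩ with rfl | rfl <;>
    rcases (h z).1 ⟨hz', hz⟩ with rfl | rfl <;> simp

theorem star_conn (hK : K.IsSurface) {v : V} {a b : E} (ha : v ∈ K.ends a) (hb : v ∈ K.ends b) :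
    (linkGraph {e | v ∈ K.ends e} K.bd).Reachable a b := by
  let φ : K.link v →g linkGraph {e | v ∈ K.ends e} K.bd :=
    { toFun := Subtype.val
      map_rel' := fun {x y} h => ⟨fun h' => h.1 (Subtype.ext h'), x.2, y.2, h.2⟩ }
  exact ((hK.2 v).preconnected ⟨a, ha⟩ ⟨b, hb⟩).map φ

theorem plaq_conn {f : F} {a b : E} (ha : a ∈ K.bd f) (hb : b ∈ K.bd f) :
    (linkGraph (K.bd f) fun v => {e | v ∈ K.ends e}).Reachable a b := by
  obtain ⟨n, hn, p, d, hp, hd, hbd⟩ := K.bd_polygon f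
  have : NeZero n := ⟨by omega⟩
  have key : ∀ i : ℕ, (linkGraph (K.bd f) fun v => {e | v ∈ K.ends e}).Reachable (d 0)
      (d (i : ZMod n)) := by
    intro i
    induction i with
    | zero => rw [Nat.cast_zero]
    | succ i ih =>
      refine ih.trans ?_
      rcases eq_or_ne (d (i : ZMod n)) (d ((i + 1 : ℕ) : ZMod n)) with h | h
      · rw [h]
      · refine SimpleGraph.Adj.reachable ⟨h, ?_, ?_, p ((i : ZMod n) + 1), ?_, ?_⟩
        · rw [hbd]; exact ⟨_, rfl⟩
        · rw [hbd]; exact ⟨_, rfl⟩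
        · show _ ∈ K.ends _
          rw [hd]; simp
        · show _ ∈ K.ends _
          rw [hd]; simp
  have key' : ∀ i : ZMod n, (linkGraph (K.bd f) fun v => {e | v ∈ K.ends e}).Reachable (d 0)
      (d i) := fun i => by
    have := key i.val
    rwa [ZMod.natCast_zmod_val] at this
  rw [hbd] at ha hb
  obtain ⟨i, rfl⟩ := ha
  obtain ⟨j, rfl⟩ := hb
  exact (key' i).symm.trans (key' j)

end PolygonalComplex

/-! ### From the Hamiltonian to the symmetric system, and the main theorem -/

namespace CLHInstance

variable {V E F : Type*} [Fintype E] [DecidableEq E] {K : PolygonalComplex V E F}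

/-- The star and plaquette operators of a commuting local Hamiltonian without nontrivial classical
qubits on a surface. -/
def toSystem (hK : K.IsSurface) (H : CLHInstance K)
    (hcl : ∀ q, H.IsClassical q → H.IsTrivial q) : StarPlaquetteSystem V F E where
  starOf v := K.edgesOf (.inl v)
  plaqOf f := K.edgesOf (.inr f)
  A v := H.term (.inl v)
  B f := H.term (.inr f)
  hermA _ := H.hermitian _
  hermB _ := H.hermitian _
  trivA v e he := actsTrivially_iff.1 (H.isLocal _ e he)
  trivB f e he := actsTrivially_iff.1 (H.isLocal _ e he)
  commAA _ _ := H.commuting _ _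
  commBB _ _ := H.commuting _ _
  commAB _ _ := H.commuting _ _
  star_inter _ _ _ _ h h1 h2 h3 h4 := K.star_inter h h1 h2 h3 h4
  plaq_inter _ _ _ _ h h1 h2 h3 h4 := K.plaq_inter h h1 h2 h3 h4
  star_le_two _ _ _ _ h1 h2 h3 := K.star_le_two h1 h2 h3
  plaq_le_two _ _ _ _ h1 h2 h3 := PolygonalComplex.plaq_le_two hK h1 h2 h3
  exists_shared _ _ _ h1 h2 := K.exists_shared h1 h2
  shared_le_two _ _ _ _ _ h1 h2 h3 h4 h5 h6 := K.shared_le_two h1 h2 h3 h4 h5 h6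
  star_conn _ _ _ h1 h2 := PolygonalComplex.star_conn hK h1 h2
  plaq_conn _ _ _ h1 h2 := PolygonalComplex.plaq_conn h1 h2
  not_classical q P hP h1 h2 := by
    have h := hcl q (H.isClassical_of_commute hP (Sum.rec h1 h2))
    exact ⟨fun v => actsTrivially_iff.1 (h _), fun f => actsTrivially_iff.1 (h _)⟩

variable {hK : K.IsSurface} {H : CLHInstance K} {hcl : ∀ q, H.IsClassical q → H.IsTrivial q}

theorem isBd_iff {q : E} : (H.toSystem hK hcl).IsBd q ↔ H.IsBoundary q := by
  simp only [StarPlaquetteSystem.IsBd, IsBoundary, actsTrivially_iff]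
  rfl

theorem isCobd_iff {q : E} : (H.toSystem hK hcl).IsCobd q ↔ H.IsCoboundary q := by
  simp only [StarPlaquetteSystem.IsCobd, IsCoboundary, actsTrivially_iff]
  rfl

theorem isGood_iff {q : E} :
    (H.toSystem hK hcl).IsGood q ↔ ¬ H.IsBoundary q ∧ ¬ H.IsCoboundary q :=
  and_congr (not_congr isBd_iff) (not_congr isCobd_iff)

/-- An operator that acts nontrivially on `q` and commutes with the reflection `P` on `q` induces
the algebra generated by `P`. -/
theorem inducedAlgebra_eq_adjoin {h : QOp E} {q : E} {P : QubitOp} (hP : IsReflection P)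
    (hPh : Commute (siteOp q P) h) (hq : ¬ TrivialAt h q) :
    inducedAlgebra h q = StarAlgebra.adjoin ℂ {P} := by
  apply le_antisymm
  · refine StarAlgebra.adjoin_le ?_
    rintro m ⟨x, y, rfl⟩
    obtain ⟨a, b, hab⟩ := hP.exists_eq_of_commute (commute_siteOp_iff.1 hPh x y)
    have hmem : block q x y h ∈ StarAlgebra.adjoin ℂ ({P} : Set QubitOp) := by
      rw [hab]
      exact add_mem (SMulMemClass.smul_mem _ (one_mem _))
        (SMulMemClass.smul_mem _ (StarAlgebra.subset_adjoin ℂ _ rfl))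
    exact hmem
  · refine StarAlgebra.adjoin_le ?_
    intro m hm
    obtain rfl : P = m := (Set.mem_singleton_iff.1 hm).symm
    rw [trivialAt_iff_block] at hq
    push Not at hq
    obtain ⟨x, y, hxy⟩ := hq
    obtain ⟨a, b, hab⟩ := hP.exists_eq_of_commute (commute_siteOp_iff.1 hPh x y)
    have hb : b ≠ 0 := by
      rintro rfl
      rw [zero_smul, add_zero] at hab
      apply hxy
      rw [hab]
      simp
    have hm : block q x y h ∈ inducedAlgebra h q := StarAlgebra.subset_adjoin ℂ _ ⟨x, y, rfl⟩
    have : P = b⁻¹ • (block q x y h - a • 1) := by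
      rw [hab, add_sub_cancel_left, smul_smul, inv_mul_cancel₀ hb, one_smul]
    rw [SetLike.mem_coe, this]
    exact SMulMemClass.smul_mem _ (sub_mem hm (SMulMemClass.smul_mem _ (one_mem _)))

theorem stringOp_eq_stringOf (U : E → Matrix.unitaryGroup (Fin 2) ℂ) (m : QubitOp)
    (S : Finset E) : stringOp U m S = stringOf (fun q => inBasis (U q) m) S := rfl

end CLHInstance

open StarPlaquetteSystem CLHInstance in
theorem mainTheorem4 {V E F : Type*} [Finite V] [Fintype E] [DecidableEq E] [Finite F]
    (K : PolygonalComplex V E F) (hK : K.IsSurface) (H : CLHInstance K)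
    (hcl : ∀ q, H.IsClassical q → H.IsTrivial q) :
    ∃ U : E → Matrix.unitaryGroup (Fin 2) ℂ, H.IsToricBasis U ∧
      ∀ (s : V) (p : F), K.Adjacent s p → H.IsInterior (.inl s) → H.IsInterior (.inr p) →
        (∃ q, (H.IsBoundary q ∨ H.IsCoboundary q) ∧
          ∃ v ∈ K.ends q, K.skeleton.Reachable s v) →
        H.AccessToCoboundary U s ∨ H.AccessToBoundary U p := by
  obtain ⟨Z, X, T⟩ := (H.toSystem hK hcl).exists_isStringToric
  choose U hUZ hUX using fun q => (T.reflZ q).exists_inBasis (T.reflX q) (T.anti q)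
  refine ⟨U, ⟨?_, ?_⟩, ?_⟩
  · intro s q hq hc
    have hc' : ¬ (H.toSystem hK hcl).IsCobd q := fun h => hc (isCobd_iff.1 h)
    rw [hUZ]
    exact inducedAlgebra_eq_adjoin (T.reflZ q) (T.commZ q hc' s) (not_trivialAt_of_not_isCobd hc' hq)
  · intro p q hq hb
    have hb' : ¬ (H.toSystem hK hcl).IsBd q := fun h => hb (isBd_iff.1 h)
    rw [hUX]
    exact inducedAlgebra_eq_adjoin (T.reflX q) (T.commX q hb' p)
      (not_trivialAt_of_not_isCobd (S := (H.toSystem hK hcl).swap) hb' hq)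
  · rintro s p ⟨e, -, -, hes, hep, -, -⟩ hs hp ⟨q, hq, v, hv, hsv⟩
    have hle : K.skeleton ≤ nodeGraph (H.toSystem hK hcl).starOf Set.univ := by
      rintro a b ⟨hab, e, he⟩
      exact ⟨hab, trivial, trivial, e, show a ∈ K.ends e by rw [he]; simp,
        show b ∈ K.ends e by rw [he]; simp⟩
    have key := T.hasAccess (s := s) (p := p) (fun x hx => isGood_iff.2 (hs x hx))
      (by
        rw [interior_swap]
        exact fun x hx => isGood_iff.2 (hp x hx)) hes hep (hsv.mono hle)
      -- The star `v` contains the boundary or coboundary qubit `q`, so it is not interior.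
      (fun h => by
        have := isGood_iff.1 (h q hv)
        tauto)
    have hZ : (fun q => inBasis (U q) pauliZ) = Z := funext hUZ
    have hX : (fun q => inBasis (U q) pauliX) = X := funext hUX
    rcases key with ⟨r, c, d, h0, h1, h2, h3, h4, h5, h6, h7⟩ | ⟨r, c, d, h0, h1, h2, h3, h4, h5, h6, h7⟩
    · refine Or.inl ⟨r, c, d, ⟨h0, h1, h2, h3⟩, isCobd_iff.1 h4, ?_⟩
      rw [stringOp_eq_stringOf, hX]
      refine ⟨h5, ?_⟩
      rintro (t | t) ht
      · exact h6 t fun h => ht (h ▸ rfl)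
      · exact h7 t
    · refine Or.inr ⟨r, c, d, ⟨h0, h1, h2, h3⟩,
        isBd_iff.1 (show (H.toSystem hK hcl).IsBd _ from h4), ?_⟩
      rw [stringOp_eq_stringOf, hZ]
      refine ⟨h5, ?_⟩
      rintro (t | t) ht
      · exact h7 t
      · exact h6 t fun h => ht (h ▸ rfl)
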